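/- Let $k$ be a field, let $X$ be a smooth scheme over $k$ (for instance a smooth variety), and let $i\colon S\hookrightarrow X$ and $j\colon T\hookrightarrow X$ be closed subschemes that are smooth over $k$, with $S\subseteq T$; write $h\colon S\hookrightarrow T$ for the inclusion, so $j\circ h=i$. Let $\mathcal N_{T/X}=\mathcal Hom_{\mathcal O_T}(\mathcal I_T/\mathcal I_T^2,\mathcal O_T)$ be the normal bundle of $T$ in $X$, where $\mathcal I_T\subseteq\mathcal O_X$ is the ideal sheaf of $T$, and let $\mathcal N_{T/X}^\vee$ be its dual. Then for every integer $q\ge 0$ there is an isomorphism of $\mathcal O_X$-modules \[ \mathcal Tor_q^{\mathcal O_X}(i_*\mathcal O_S,\,j_*\mathcal O_T)\;\cong\; i_*\bigl((\Lambda^q\mathcal N_{T/X}^\vee)|_S\bigr), \] where $E|_S=h^*E$ for an $\mathcal O_T$-module $E$, and $\Lambda^0\mathcal N_{T/X}^\vee=\mathcal O_T$. Here $\mathcal Tor_q^{\mathcal O_X}$ is the sheaf Tor, i.e. the sheaf associated with the presheaf $U\mapsto \mathrm{Tor}_q^{\mathcal O_X(U)}(F(U),G(U))$. The same holds when $X$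 is a (finite-dimensional) complex manifold, $S\subseteq T$ are closed complex submanifolds of $X$, and $\mathcal O$ denotes the sheaves of holomorphic functions. -/

import Mathlib

open CategoryTheory Limits Opposite TopologicalSpace AlgebraicGeometry MonoidalCategory
open scoped Manifold ContDiff

universe u

noncomputable section

/-! ### Presheaves of modules: projective resolutions, exterior powers, duals -/

namespace PresheafOfModules

section EnoughProjectives

variable {C : Type u} [SmallCategory.{u} C]

instance projective_free_yoneda (R : Cᵒᵖ ⥤ RingCat.{u}) (X : C) :
    Projective ((free R).obj (yoneda.obj X)) where
  factors {E M} f e _ := by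
    obtain ⟨y, hy⟩ := surjective_of_epi e (op X) (freeYonedaEquiv f)
    refine ⟨freeYonedaEquiv.symm y, freeYonedaEquiv.injective ?_⟩
    rw [freeYonedaEquiv_comp, Equiv.apply_symm_apply, hy]

instance enoughProjectives (R : Cᵒᵖ ⥤ RingCat.{u}) :
    EnoughProjectives (PresheafOfModules.{u} R) where
  presentation M := ⟨{ p := M.freeYonedaCoproduct, f := M.fromFreeYonedaCoproduct }⟩

instance monoidalPreadditive (R : Cᵒᵖ ⥤ CommRingCat.{u}) :
    MonoidalPreadditive (PresheafOfModules.{u} (R ⋙ forget₂ CommRingCat RingCat)) where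
  whiskerLeft_zero := by
    intros; ext1 U; exact MonoidalPreadditive.whiskerLeft_zero (C := ModuleCat (R.obj U))
  zero_whiskerRight := by
    intros; ext1 U; exact MonoidalPreadditive.zero_whiskerRight (C := ModuleCat (R.obj U))
  whiskerLeft_add := by
    intros; ext1 U; exact MonoidalPreadditive.whiskerLeft_add (C := ModuleCat (R.obj U)) _ _
  add_whiskerRight := by
    intros; ext1 U; exact MonoidalPreadditive.add_whiskerRight (C := ModuleCat (R.obj U)) _ _

end EnoughProjectives

section Semilinear

variable {A B D : Type u} [CommRing A] [CommRing B] [CommRing D] {φ : A →+* B} {ψ : B →+* D}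
  {χ : A →+* D}
  {M N P : Type u} [AddCommGroup M] [Module A M] [AddCommGroup N] [Module B N]
  [AddCommGroup P] [Module D P]

/-- The map `m₁ ∧ ⋯ ∧ m_q ↦ f m₁ ∧ ⋯ ∧ f m_q` on exterior powers induced by a semilinear map. -/
def semilinearExteriorPower (q : ℕ) (f : M →ₛₗ[φ] N) : ⋀[A]^q M →ₛₗ[φ] ⋀[B]^q N :=
  letI : Module A (⋀[B]^q N) := Module.compHom _ φ
  let l : ⋀[A]^q M →ₗ[A] ⋀[B]^q N := exteriorPower.alternatingMapLinearEquiv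
    { toFun := fun x => exteriorPower.ιMulti B q (fun i => f (x i))
      map_update_add' := by
        intro _ x i a b
        have h : ∀ c, (fun j => f (Function.update x i c j)) =
            Function.update (fun j => f (x j)) i (f c) := fun c =>
          funext fun j => Function.apply_update (fun _ => f) x i c j
        rw [h, h, h, map_add]
        exact (exteriorPower.ιMulti B q).map_update_add _ _ _ _
      map_update_smul' := by
        intro _ x i r a
        have h : ∀ c, (fun j => f (Function.update x i c j)) =
            Function.update (fun j => f (x j)) i (f c) := fun c =>
          funext fun j => Function.apply_update (fun _ => f) x i c j
        rw [h, h, f.map_smulₛₗ]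
        exact (exteriorPower.ιMulti B q).map_update_smul _ _ _ _
      map_eq_zero_of_eq' := by
        intro x i j hx hij
        exact (exteriorPower.ιMulti B q).map_eq_zero_of_eq _ (by simp only [hx]) hij }
  { toFun := l
    map_add' := l.map_add
    map_smul' := l.map_smul }

lemma semilinearExteriorPower_ιMulti (q : ℕ) (f : M →ₛₗ[φ] N) (x : Fin q → M) :
    semilinearExteriorPower q f (exteriorPower.ιMulti A q x) =
      exteriorPower.ιMulti B q (fun i => f (x i)) :=
  letI : Module A (⋀[B]^q N) := Module.compHom _ φ
  exteriorPower.alternatingMapLinearEquiv_apply_ιMulti _ x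

lemma semilinearExteriorPower_id (σ : A →+* A) (hσ : σ = RingHom.id A) (q : ℕ)
    (f : M →ₛₗ[σ] M) (hf : ∀ m, f m = m) (y : ⋀[A]^q M) : semilinearExteriorPower q f y = y := by
  subst hσ
  have h : semilinearExteriorPower q f = LinearMap.id :=
    exteriorPower.linearMap_ext (AlternatingMap.ext fun x => by
      refine (semilinearExteriorPower_ιMulti q f x).trans ?_
      simp only [hf]
      rfl)
  exact LinearMap.congr_fun h y

lemma semilinearExteriorPower_comp (q : ℕ) (f : M →ₛₗ[φ] N) (g : N →ₛₗ[ψ] P) (k : M →ₛₗ[χ] P)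
    (hχ : χ = ψ.comp φ) (h : ∀ m, k m = g (f m)) (y : ⋀[A]^q M) :
    semilinearExteriorPower q k y =
      semilinearExteriorPower q g (semilinearExteriorPower q f y) := by
  have hy : y ∈ _root_.Submodule.span A (Set.range (exteriorPower.ιMulti A q (M := M))) := by
    rw [exteriorPower.ιMulti_span]
    trivial
  induction hy using Submodule.span_induction with
  | mem y hy =>
    obtain ⟨x, rfl⟩ := hy
    simp only [semilinearExteriorPower_ιMulti, h]
  | zero => simp only [map_zero]
  | add a b _ _ ha hb => simp only [map_add, ha, hb]
  | smul r a _ ha => simp only [LinearMap.map_smulₛₗ, ha, hχ, RingHom.comp_apply]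

end Semilinear

section Constructions

variable {C : Type u} [SmallCategory.{u} C]

/-- A family of modules with functorial semilinear restriction maps is a presheaf of modules. -/
def ofSemilinear {R : Cᵒᵖ ⥤ RingCat.{u}} (N : ∀ U, ModuleCat.{u} (R.obj U))
    (res : ∀ {U V : Cᵒᵖ} (f : U ⟶ V), N U →ₛₗ[(R.map f).hom] N V)
    (res_id : ∀ (U : Cᵒᵖ) (x : N U), res (𝟙 U) x = x)
    (res_comp : ∀ {U V W : Cᵒᵖ} (f : U ⟶ V) (g : V ⟶ W) (x : N U),
      res (f ≫ g) x = res g (res f x)) : PresheafOfModules.{u} R where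
  obj := N
  map {_ V} f := ModuleCat.ofHom (Y := (ModuleCat.restrictScalars (R.map f).hom).obj (N V))
    { toFun := res f
      map_add' := (res f).map_add
      map_smul' := (res f).map_smulₛₗ }
  map_id U := ModuleCat.hom_ext (LinearMap.ext (res_id U))
  map_comp f g := ModuleCat.hom_ext (LinearMap.ext (res_comp f g))

variable {R : Cᵒᵖ ⥤ CommRingCat.{u}}
  (M : PresheafOfModules.{u} (R ⋙ forget₂ CommRingCat RingCat))

/-- The presheaf `U ↦ ⋀^q M(U)`, exterior power over `R(U)`. -/
def exteriorPower (q : ℕ) : PresheafOfModules.{u} (R ⋙ forget₂ CommRingCat RingCat) :=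
  ofSemilinear (fun U => ModuleCat.of (R.obj U) (⋀[R.obj U]^q (M.obj U)))
    (fun f => semilinearExteriorPower (φ := (R.map f).hom) q (M.restrictₛₗ f))
    (fun U => semilinearExteriorPower_id (R.map (𝟙 U)).hom
      (by rw [R.map_id]; rfl) q (M.restrictₛₗ (𝟙 U)) (fun m => by
        rw [restrictₛₗ_apply, M.map_id]; rfl))
    (fun f g => semilinearExteriorPower_comp (φ := (R.map f).hom) (ψ := (R.map g).hom)
      (χ := (R.map (f ≫ g)).hom) q (M.restrictₛₗ f) (M.restrictₛₗ g)
      (M.restrictₛₗ (f ≫ g)) (by rw [R.map_comp]; rfl) (M.map_comp_apply f g))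

/-- Families of `R(V)`-linear maps `M(V) → R(V)`, one for each `V` over `U`. The scalar ring
`R(U)` acts on the component at `V` through the restriction `R(U) → R(V)`. -/
abbrev DualFamily (U : Cᵒᵖ) : Type u :=
  ∀ (V : Cᵒᵖ) (i : U ⟶ V), (ModuleCat.restrictScalars (R.map i).hom).obj
    (ModuleCat.of (R.obj V) (M.obj V →ₗ[R.obj V] R.obj V))

/-- The component at `i : U ⟶ V` of a family. -/
def DualFamily.app {M : PresheafOfModules.{u} (R ⋙ forget₂ CommRingCat RingCat)} {U : Cᵒᵖ}
    (φ : DualFamily M U) {V : Cᵒᵖ} (i : U ⟶ V) : M.obj V →ₗ[R.obj V] R.obj V := φ V i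

lemma DualFamily.add_app {M : PresheafOfModules.{u} (R ⋙ forget₂ CommRingCat RingCat)} {U : Cᵒᵖ}
    (φ ψ : DualFamily M U) {V : Cᵒᵖ} (i : U ⟶ V) (x : M.obj V) :
    DualFamily.app (φ + ψ) i x = φ.app i x + ψ.app i x := rfl

lemma DualFamily.smul_app {M : PresheafOfModules.{u} (R ⋙ forget₂ CommRingCat RingCat)} {U : Cᵒᵖ}
    (r : R.obj U) (φ : DualFamily M U) {V : Cᵒᵖ} (i : U ⟶ V) (x : M.obj V) :
    DualFamily.app (r • φ) i x = R.map i r * φ.app i x := rfl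

lemma DualFamily.ext {M : PresheafOfModules.{u} (R ⋙ forget₂ CommRingCat RingCat)} {U : Cᵒᵖ}
    {φ ψ : DualFamily M U}
    (h : ∀ (V : Cᵒᵖ) (i : U ⟶ V) (x : M.obj V), φ.app i x = ψ.app i x) : φ = ψ :=
  funext fun V => funext fun i => LinearMap.ext (h V i)

lemma ringMap_comp_apply {U V W : Cᵒᵖ} (f : U ⟶ V) (g : V ⟶ W) (r : R.obj U) :
    R.map (f ≫ g) r = R.map g (R.map f r) := by
  rw [R.map_comp]
  rfl

/-- The `R(U)`-module `Hom(M|_U, R|_U)`: the families of linear maps `M(V) → R(V)`, `V` over `U`,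
that commute with the restriction maps. -/
def dualSections (U : Cᵒᵖ) : _root_.Submodule (R.obj U) (DualFamily M U) where
  carrier := { φ | ∀ (V W : Cᵒᵖ) (i : U ⟶ V) (g : V ⟶ W) (m : M.obj V),
    φ.app (i ≫ g) (M.restrictₛₗ g m) = R.map g (φ.app i m) }
  add_mem' {φ ψ} hφ hψ V W i g m := by
    rw [DualFamily.add_app, DualFamily.add_app, map_add, hφ, hψ]
  zero_mem' V W i g m := (map_zero (R.map g).hom).symm
  smul_mem' r φ hφ V W i g m := by
    rw [DualFamily.smul_app, DualFamily.smul_app, map_mul, hφ, ringMap_comp_apply]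

/-- Restriction of a family along `f`. -/
def DualFamily.restrict {U V : Cᵒᵖ} (f : U ⟶ V) (φ : DualFamily M U) : DualFamily M V :=
  fun _ i => φ.app (f ≫ i)

/-- The restriction map `Hom(M|_U, R|_U) → Hom(M|_V, R|_V)`. -/
def dualRestrict {U V : Cᵒᵖ} (f : U ⟶ V) :
    dualSections M U →ₛₗ[(R.map f).hom] dualSections M V where
  toFun φ := ⟨DualFamily.restrict M f φ.1, fun V W i g m => by
    have h := φ.2 V W (f ≫ i) g m
    rw [Category.assoc] at h
    exact h⟩
  map_add' φ ψ := rfl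
  map_smul' r φ := Subtype.ext (DualFamily.ext fun W i x => by
    refine (DualFamily.smul_app r φ.1 (f ≫ i) x).trans ?_
    refine Eq.trans ?_ (DualFamily.smul_app (R.map f r) (DualFamily.restrict M f φ.1) i x).symm
    rw [ringMap_comp_apply]
    rfl)

lemma dualRestrict_id (U : Cᵒᵖ) (φ : dualSections M U) : dualRestrict M (𝟙 U) φ = φ :=
  Subtype.ext (funext fun W => funext fun i => by
    change φ.1.app (𝟙 U ≫ i) = φ.1.app i
    rw [Category.id_comp])

lemma dualRestrict_comp {U V W : Cᵒᵖ} (f : U ⟶ V) (g : V ⟶ W) (φ : dualSections M U) :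
    dualRestrict M (f ≫ g) φ = dualRestrict M g (dualRestrict M f φ) :=
  Subtype.ext (funext fun W => funext fun i => by
    change φ.1.app ((f ≫ g) ≫ i) = φ.1.app (f ≫ g ≫ i)
    rw [Category.assoc])

/-- The dual presheaf `U ↦ Hom(M|_U, R|_U)`. -/
def dual : PresheafOfModules.{u} (R ⋙ forget₂ CommRingCat RingCat) :=
  ofSemilinear (fun U => ModuleCat.of (R.obj U) (dualSections M U))
    (fun f => dualRestrict M f) (dualRestrict_id M) (dualRestrict_comp M)

end Constructions

end PresheafOfModules

/-! ### Sheaves of modules on a locally ringed space -/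

namespace AlgebraicGeometry.LocallyRingedSpace

variable {X Y : LocallyRingedSpace.{u}}

/-- The structure sheaf as a sheaf of rings. -/
abbrev ringCatSheaf (X : LocallyRingedSpace.{u}) : TopCat.Sheaf RingCat.{u} X.toTopCat :=
  (sheafCompose _ (forget₂ CommRingCat RingCat.{u})).obj X.sheaf

/-- The underlying continuous map of a morphism. -/
def Hom.continuousMap (f : X ⟶ Y) : X.toTopCat ⟶ Y.toTopCat := f.base

/-- The map of sheaves of rings `𝒪_Y ⟶ f_* 𝒪_X`. -/
def Hom.toRingCatSheafHom (f : X ⟶ Y) :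
    ringCatSheaf Y ⟶ ((Opens.map (Hom.continuousMap f)).sheafPushforwardContinuous
      _ _ _).obj (ringCatSheaf X) where
  hom := Functor.whiskerRight f.c _

/-- The category of sheaves of `𝒪_X`-modules. -/
abbrev Modules (X : LocallyRingedSpace.{u}) := SheafOfModules.{u} (ringCatSheaf X)

/-- The structure sheaf `𝒪_X` as a module over itself. -/
abbrev structureModule (X : LocallyRingedSpace.{u}) : Modules X :=
  SheafOfModules.unit (ringCatSheaf X)

/-- The direct image functor `f_*`. -/
abbrev modulePushforward (f : X ⟶ Y) : Modules X ⥤ Modules Y :=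
  SheafOfModules.pushforward (Hom.toRingCatSheafHom f)

instance isRightAdjoint_modulePushforward (f : X ⟶ Y) : (modulePushforward f).IsRightAdjoint := by
  unfold modulePushforward
  have : (PresheafOfModules.pushforward (Hom.toRingCatSheafHom f).hom).IsRightAdjoint :=
    PresheafOfModules.instIsRightAdjointPushforward _
  exact SheafOfModules.instIsRightAdjointPushforward _

/-- The inverse image functor `f^*`, left adjoint to `f_*`. -/
abbrev modulePullback (f : X ⟶ Y) : Modules Y ⥤ Modules X :=
  SheafOfModules.pullback (Hom.toRingCatSheafHom f)

/-- The sheaf of modules associated with a presheaf of `𝒪_X`-modules. -/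
abbrev moduleSheafification (X : LocallyRingedSpace.{u}) :
    PresheafOfModules.{u} (ringCatSheaf X).obj ⥤ Modules X :=
  PresheafOfModules.sheafification (𝟙 (ringCatSheaf X).obj)

/-- The sheaf `Tor_q^X(F, G)`: the sheaf associated with the presheaf
`U ↦ Tor_q^{𝒪(U)}(F(U), G(U))`. The latter is the `q`-th left derived functor of the tensor product
of presheaves of modules, a category with enough projectives in which exactness, tensor products
and homology are computed over each open set and in which the sections of the projective resolution
over each open set are projective. The stalk of this sheaf at `x` is `Tor_q^{𝒪_x}(F_x, G_x)`. -/
def tor (q : ℕ) (F G : Modules X) : Modules X :=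
  (moduleSheafification X).obj
    (((Tor (PresheafOfModules.{u} (X.presheaf ⋙ forget₂ CommRingCat RingCat)) q).obj F.val).obj
      G.val)

/-- The exterior power `Λ^q F`, the sheaf associated with `U ↦ Λ^q F(U)`. -/
def moduleExteriorPower (q : ℕ) (F : Modules X) : Modules X :=
  (moduleSheafification X).obj
    (PresheafOfModules.exteriorPower (R := X.presheaf) F.val q)

/-- The dual `F^∨ = ℋom(F, 𝒪_X)`. Its presheaf `U ↦ Hom(F|_U, 𝒪_U)` is already a sheaf; the
sheafification only serves to regard it as one. -/
def moduleDual (F : Modules X) : Modules X :=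
  (moduleSheafification X).obj (PresheafOfModules.dual (R := X.presheaf) F.val)

/-- The ideal sheaf of a closed subspace `j : T ⟶ X`: the kernel of `𝒪_X ⟶ j_* 𝒪_T`. -/
def idealSheaf (j : X ⟶ Y) : Modules Y :=
  kernel (SheafOfModules.unitToPushforwardObjUnit (Hom.toRingCatSheafHom j))

/-- The conormal sheaf `I/I² = j^* I` of a closed subspace `j : T ⟶ X` with ideal sheaf `I`. -/
def conormalSheaf (j : X ⟶ Y) : Modules X :=
  (modulePullback j).obj (idealSheaf j)

/-- The normal sheaf `N_{T/X} = ℋom(I/I², 𝒪_T)` of a closed subspace `j : T ⟶ X`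
with ideal sheaf `I`; it is the sheaf of sections of the normal bundle when `T` and `X`
are smooth. -/
def normalSheaf (j : X ⟶ Y) : Modules X :=
  moduleDual (conormalSheaf j)

end AlgebraicGeometry.LocallyRingedSpace

/-! ### Complex manifolds -/

namespace ComplexManifold

/-- A complex manifold modelled on `E`, with its sheaf of holomorphic functions
(over `ℂ`, functions of class `C^∞` are the holomorphic functions). -/
abbrev ringedSpace (E : Type) [NormedAddCommGroup E] [NormedSpace ℂ E]
    (X : Type) [TopologicalSpace X] [ChartedSpace E X] : LocallyRingedSpace.{0} :=
  ChartedSpace.locallyRingedSpace 𝓘(ℂ, E) X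

variable {E F : Type} [NormedAddCommGroup E] [NormedSpace ℂ E]
  [NormedAddCommGroup F] [NormedSpace ℂ F]
  {M N : Type} [TopologicalSpace M] [ChartedSpace E M] [TopologicalSpace N] [ChartedSpace F N]

/-- Holomorphic maps between manifolds modelled on `E` and `F`. -/
def IsHolomorphic (E F : Type) [NormedAddCommGroup E] [NormedSpace ℂ E]
    [NormedAddCommGroup F] [NormedSpace ℂ F]
    {M N : Type} [TopologicalSpace M] [ChartedSpace E M] [TopologicalSpace N] [ChartedSpace F N]
    (f : M → N) : Prop :=
  ContMDiff 𝓘(ℂ, E) 𝓘(ℂ, F) ω f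

/-- The morphism of ringed spaces, given by composition of functions, of a holomorphic map. -/
def map (f : M → N) (hf : IsHolomorphic E F f) : ringedSpace E M ⟶ ringedSpace F N :=
  ChartedSpace.locallyRingedSpaceMap f (ContMDiff.of_le hf le_top)

/-- `f` identifies `M` with a closed complex submanifold of `N`: it is a holomorphic immersion
(in suitable holomorphic charts, the inclusion `u ↦ (u, 0)`) and a homeomorphism onto a closed
subset. -/
structure IsClosedSubmanifold (E F : Type) [NormedAddCommGroup E] [NormedSpace ℂ E]
    [NormedAddCommGroup F] [NormedSpace ℂ F]
    {M N : Type} [TopologicalSpace M] [ChartedSpace E M] [TopologicalSpace N] [ChartedSpace F N]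
    (f : M → N) : Prop where
  isSmoothEmbedding : Manifold.IsSmoothEmbedding 𝓘(ℂ, E) 𝓘(ℂ, F) ω f
  isClosed_range : IsClosed (Set.range f)

lemma IsClosedSubmanifold.isHolomorphic {f : M → N} (hf : IsClosedSubmanifold E F f) :
    IsHolomorphic E F f :=
  hf.isSmoothEmbedding.contMDiff

end ComplexManifold

end

/-! Let A be the ring of functions on a small open subset W of X. There T is cut out by a weakly
regular sequence f_1, …, f_c in A, so the Koszul complex on the exterior powers of A^c is a free
resolution of the functions on T ∩ W. The coefficients of its differential lie in the ideal of T.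
They kill the functions on S ∩ W because S ⊆ T, so tensoring with these functions makes every
differential zero, and Tor_q becomes O_S ⊗ Λ^q A^c. Regularity also says that a relation among the
f_l has its coefficients in the ideal of T. Hence the conormal sheaf is free on the classes of the
f_l, it agrees with its bidual N^∨, and the right-hand side over W is O_S ⊗ Λ^q A^c as well.

The local isomorphisms must be independent of the sequence. Instead of comparing them on overlaps,
one fixes a projective resolution P of the presheaf j_* O_T and defines a correspondence between
presheaf Tor and the sheaf on the right. Given finitely many sections g_k of the ideal of T, a
system (`Koszul.IsSystem`) is a family of chains in P that obeys the Koszul formula for the g_k and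
starts from 1. Any two systems for the same g_k are homotopic, and after tensoring with an element x
killed by the g_k the difference of two systems is a boundary
(`Koszul.IsSystem.exists_tmul_sub_eq`). So the class of x ⊗ φ(v) depends only on x, the g_k and v;
it is paired with x times the exterior product of the classes of the g_(v k) in the conormal sheaf
(`IsCorresponding`). The pairs involve no choice of f, and restriction preserves them. Over the
small W above, `Koszul.exists_comparison` shows that their span is the graph of a bijection
(`IsKoszulOn.existsUnique`), and a correspondence that is locally the graph of a bijection gives an
isomorphism of the associated sheaves (`nonempty_iso_of_relation`). This yields `nonempty_tor_iso`
for every j satisfying `IsLocallyKoszul`.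

The remaining input is local. For schemes, the sequence `I/I² → Ω_X|_T → Ω_T` is split exact by
smoothness, so local generators of the ideal can be chosen with linearly independent differentials
(`Algebra.Smooth.exists_generators_ker`). Such functions make X smooth, hence flat, over affine
space, and the images of the variables in a flat algebra are weakly regular. For complex manifolds
the sequence consists of the normal coordinates of an immersion chart; on a ball, Hadamard's lemma
identifies the ideal of some of the coordinates with the functions vanishing on their common zeros.
-/

noncomputable section

/-! ### Contraction on exterior algebras and the Koszul complex -/

namespace ExteriorAlgebra

variable {A M : Type*} [CommRing A] [AddCommGroup M] [Module A M]

/-- Contraction with a linear form on the exterior algebra. -/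
def contract (s : Module.Dual A M) : ExteriorAlgebra A M →ₗ[A] ExteriorAlgebra A M :=
  CliffordAlgebra.contractLeft s

lemma contract_ι_mul (s : Module.Dual A M) (m : M) (x : ExteriorAlgebra A M) :
    contract s (ι A m * x) = s m • x - ι A m * contract s x :=
  CliffordAlgebra.contractLeft_ι_mul _ _ _

lemma contract_algebraMap (s : Module.Dual A M) (a : A) :
    contract s (algebraMap A (ExteriorAlgebra A M) a) = 0 :=
  CliffordAlgebra.contractLeft_algebraMap _ _ _

lemma contract_ι (s : Module.Dual A M) (m : M) :
    contract s (ι A m) = algebraMap A _ (s m) :=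
  CliffordAlgebra.contractLeft_ι _ _ _

lemma contract_contract (s : Module.Dual A M) (x : ExteriorAlgebra A M) :
    contract s (contract s x) = 0 :=
  CliffordAlgebra.contractLeft_contractLeft _ _

lemma contract_comm (s t : Module.Dual A M) (x : ExteriorAlgebra A M) :
    contract s (contract t x) = -contract t (contract s x) :=
  CliffordAlgebra.contractLeft_comm _ _ _

lemma contract_add (s t : Module.Dual A M) (x : ExteriorAlgebra A M) :
    contract (s + t) x = contract s x + contract t x := by
  simp [contract]

lemma contract_smul (a : A) (s : Module.Dual A M) (x : ExteriorAlgebra A M) :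
    contract (a • s) x = a • contract s x := by
  simp [contract]

lemma ι_mul_mem {n : ℕ} (m : M) {x : ExteriorAlgebra A M} (hx : x ∈ ⋀[A]^n M) :
    ι A m * x ∈ ⋀[A]^(n + 1) M := by
  rw [exteriorPower, pow_succ']
  exact Submodule.mul_mem_mul (LinearMap.mem_range_self _ m) hx

/-- Contraction is an antiderivation, so splitting off the first factor gives the alternating sum by
induction. This is the link between contraction and the Koszul formula used for systems. -/
lemma contract_ιMulti (s : Module.Dual A M) {n : ℕ} (v : Fin (n + 1) → M) :
    contract s (ιMulti A (n + 1) v) =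
      ∑ i : Fin (n + 1), (-1 : A) ^ (i : ℕ) • s (v i) • ιMulti A n (v ∘ i.succAbove) := by
  induction n with
  | zero =>
    rw [ιMulti_succ_apply]
    simp [contract_ι, Algebra.algebraMap_eq_smul_one]
  | succ n ih =>
    rw [ιMulti_succ_apply, contract_ι_mul, ih, sub_eq_add_neg]
    conv_rhs => rw [Fin.sum_univ_succ]
    congr 1
    · simp
      rfl
    · rw [Finset.mul_sum, ← Finset.sum_neg_distrib]
      refine Finset.sum_congr rfl fun i _ => ?_
      rw [ιMulti_succ_apply (v ∘ _)]
      simp only [mul_smul_comm, Fin.val_succ, pow_succ, mul_neg, mul_one, neg_smul]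
      congr 4
      refine congrArg (ιMulti A n) (funext fun k => ?_)
      simp [Matrix.vecTail]

lemma contract_mem (s : Module.Dual A M) {n : ℕ} {x : ExteriorAlgebra A M}
    (hx : x ∈ ⋀[A]^(n + 1) M) : contract s x ∈ ⋀[A]^n M := by
  rw [← ιMulti_span_fixedDegree] at hx
  induction hx using Submodule.span_induction with
  | mem x hx =>
    obtain ⟨v, rfl⟩ := hx
    rw [contract_ιMulti]
    exact Submodule.sum_mem _ fun i _ => Submodule.smul_mem _ _ (Submodule.smul_mem _ _
      (ιMulti_range A n (Set.mem_range_self _)))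
  | zero => rw [map_zero]; exact Submodule.zero_mem _
  | add x y _ _ hx hy => rw [map_add]; exact Submodule.add_mem _ hx hy
  | smul a x _ hx => rw [map_smul]; exact Submodule.smul_mem _ _ hx

/-- If `s e = 1` and `p` is the projection with kernel `⟨e⟩` onto the kernel of `s`, then every
element of the exterior algebra splits as an element free of `e` and a multiple of `e`. -/
lemma eq_map_add_ι_mul_contract (s : Module.Dual A M) (e : M) (p : M →ₗ[A] M)
    (hp : ∀ m, p m = m - s m • e) (x : ExteriorAlgebra A M) :
    x = map p x + ι A e * contract s x := by
  induction x using CliffordAlgebra.left_induction with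
  | algebraMap r =>
    change algebraMap A (ExteriorAlgebra A M) r = map p (algebraMap A (ExteriorAlgebra A M) r) +
      ι A e * contract s (algebraMap A (ExteriorAlgebra A M) r)
    rw [contract_algebraMap, AlgHom.commutes]
    simp
  | add x y hx hy => rw [map_add, map_add, mul_add, add_add_add_comm, ← hx, ← hy]
  | ι_mul x m hx =>
    change ι A m * x = map p (ι A m * x) + ι A e * contract s (ι A m * x)
    have h1 : map p x = x - ι A e * contract s x := eq_sub_of_add_eq hx.symm
    have h2 : ι A m * ι A e = -(ι A e * ι A m) := by
      rw [eq_neg_iff_add_eq_zero]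
      exact ι_add_mul_swap m e
    rw [map_mul, map_apply_ι, h1, hp, contract_ι_mul, map_sub, map_smul]
    simp only [sub_mul, mul_sub, ← mul_assoc, smul_mul_assoc, mul_smul_comm, ι_sq_zero, h2]
    simp

end ExteriorAlgebra

/-! ### Exactness of the Koszul complex of a weakly regular sequence -/

namespace Koszul

variable {A : Type*} [CommRing A]

/-- `f 0, f 1, …` is a weakly regular sequence. -/
def IsWeaklyRegular {c : ℕ} (f : Fin c → A) : Prop :=
  ∀ (k : Fin c) (a : A), f k * a ∈ Ideal.span (f '' Set.Iio k) → a ∈ Ideal.span (f '' Set.Iio k)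

variable {c : ℕ} (f : Fin c → A)

/-- The linear form with the coefficients `f l`, `l < k`. -/
def form (k : ℕ) : Module.Dual A (Fin c → A) :=
  ∑ l : Fin c, (if (l : ℕ) < k then f l else 0) • LinearMap.proj l

open ExteriorAlgebra

lemma form_apply (k : ℕ) (v : Fin c → A) :
    form f k v = ∑ l : Fin c, (if (l : ℕ) < k then f l else 0) * v l := by
  rw [form, LinearMap.sum_apply]
  rfl

lemma form_succ (k : Fin c) : form f (k + 1) = form f k + f k • LinearMap.proj k := by
  refine LinearMap.ext fun v => ?_
  rw [LinearMap.add_apply, form_apply, form_apply, LinearMap.smul_apply, LinearMap.proj_apply,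
    smul_eq_mul]
  have : f k * v k = ∑ l : Fin c, if l = k then f l * v l else 0 := by simp
  rw [this, ← Finset.sum_add_distrib]
  refine Finset.sum_congr rfl fun l _ => ?_
  rcases lt_trichotomy l k with h | h | h
  · have h' : (l : ℕ) < k := h
    simp [h.ne, h', h'.trans (Nat.lt_succ_self _)]
  · subst h; simp
  · have h' : (k : ℕ) < l := h
    simp [h.ne', not_lt.2 h'.le, not_lt.2 (Nat.succ_le_of_lt h')]

lemma form_single (k : ℕ) (l : Fin c) :
    form f k (Pi.single l 1) = if (l : ℕ) < k then f l else 0 := by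
  rw [form_apply]
  simp [Pi.single_apply]

lemma form_mem (k : ℕ) (v : Fin c → A) : form f k v ∈ Ideal.span (f '' {l | (l : ℕ) < k}) := by
  rw [form_apply]
  refine Ideal.sum_mem _ fun l _ => Ideal.mul_mem_right _ _ ?_
  split_ifs with h
  · exact Ideal.subset_span ⟨l, h, rfl⟩
  · exact Ideal.zero_mem _

/-- The lowest degree of the Koszul complex on the first k generators: the image of the linear form
on vectors supported there is the ideal of the first k elements. -/
lemma exists_form_eq_iff (k : ℕ) (a : A) :
    (∃ v : Fin c → A, (∀ l : Fin c, k ≤ l → v l = 0) ∧ form f k v = a) ↔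
      a ∈ Ideal.span (f '' {l | (l : ℕ) < k}) := by
  constructor
  · rintro ⟨v, -, rfl⟩
    exact form_mem f k v
  · intro h
    induction h using Submodule.span_induction with
    | mem x hx =>
      obtain ⟨l, hl, rfl⟩ := hx
      have hl' : (l : ℕ) < k := hl
      refine ⟨Pi.single l 1, fun i hi => ?_, by simp [form_single, hl']⟩
      rw [Pi.single_apply, if_neg]
      rintro rfl
      exact absurd hl' (not_lt.2 hi)
    | zero => exact ⟨0, by simp, by simp⟩
    | add x y _ _ hx hy =>
      obtain ⟨v, hv, rfl⟩ := hx
      obtain ⟨w, hw, rfl⟩ := hy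
      exact ⟨v + w, fun l hl => by simp [hv l hl, hw l hl], by simp⟩
    | smul b x _ hx =>
      obtain ⟨v, hv, rfl⟩ := hx
      exact ⟨b • v, fun l hl => by simp [hv l hl], by simp⟩

/-- An element killed by contraction with a coordinate does not involve the corresponding basis
vector, so it is unchanged when that vector is sent to 0. Doing this for all coordinates applies the
zero map, which annihilates positive degrees. -/
lemma eq_zero_of_contract_proj_eq_zero {n : ℕ} {x : ExteriorAlgebra A (Fin c → A)}
    (hx : x ∈ ⋀[A]^(n + 1) (Fin c → A))
    (h : ∀ l : Fin c, contract (LinearMap.proj l) x = 0) : x = 0 := by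
  let p : ℕ → (Fin c → A) →ₗ[A] (Fin c → A) := fun k =>
    LinearMap.pi fun l => if (l : ℕ) < k then 0 else LinearMap.proj l
  have hp : ∀ k ≤ c, map (p k) x = x := by
    intro k
    induction k with
    | zero =>
      intro _
      have : p 0 = LinearMap.id := by
        refine LinearMap.ext fun v => funext fun l => ?_
        simp [p]
      rw [this, map_id, AlgHom.id_apply]
    | succ k ih =>
      intro hk
      -- The projection that kills the single coordinate k; it fixes x because the term of the
      -- splitting containing the contraction of x vanishes.
      let q : (Fin c → A) →ₗ[A] (Fin c → A) :=
        LinearMap.id - (LinearMap.proj (⟨k, hk⟩ : Fin c)).smulRight (Pi.single ⟨k, hk⟩ 1)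
      have hq : map q x = x := by
        have := eq_map_add_ι_mul_contract (LinearMap.proj (⟨k, hk⟩ : Fin c))
          (Pi.single ⟨k, hk⟩ (1 : A)) q (fun m => rfl) x
        rw [h, mul_zero, add_zero] at this
        exact this.symm
      have hpq : p (k + 1) = p k ∘ₗ q := by
        refine LinearMap.ext fun v => funext fun l => ?_
        have e : q v l = v l - v ⟨k, hk⟩ * (Pi.single ⟨k, hk⟩ (1 : A) : Fin c → A) l := rfl
        simp only [p, LinearMap.pi_apply, LinearMap.comp_apply]
        rcases lt_trichotomy (l : ℕ) k with hl | hl | hl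
        · simp [hl, hl.trans (Nat.lt_succ_self _)]
        · have : l = ⟨k, hk⟩ := Fin.ext hl
          subst this
          simp [e]
        · have : l ≠ ⟨k, hk⟩ := fun h => by rw [h] at hl; exact lt_irrefl _ hl
          simp [not_lt.2 hl.le, not_lt.2 (Nat.succ_le_of_lt hl), e, this]
      rw [hpq, ← map_comp_map, AlgHom.comp_apply, hq, ih (by omega)]
  have h0 : p c = 0 := by
    refine LinearMap.ext fun v => funext fun l => ?_
    simp [p]
  rw [← hp c le_rfl, h0]
  rw [← ιMulti_span_fixedDegree] at hx
  clear h hp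
  induction hx using Submodule.span_induction with
  | mem x hx =>
    obtain ⟨v, rfl⟩ := hx
    rw [ιMulti_succ_apply, map_mul, map_apply_ι]
    simp
  | zero => rw [map_zero]
  | add x y _ _ hx hy => rw [map_add, hx, hy, add_zero]
  | smul a x _ hx => rw [map_smul, hx, smul_zero]

/-- Induction on the number k of elements. The condition on contractions with coordinates `l ≥ k`
singles out the exterior algebra on the first k basis vectors, so all the smaller Koszul complexes
live in one algebra. Write `x = a + e ∧ b` with e the new basis vector; then b is a cycle and `d a =
-f_k b`. By induction `b = d g` and `a + f_k g = d y`, whence `x = d (y - e ∧ g)`. The hypothesis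
`h0` plays the role of the augmentation in degree 0. -/
lemma exists_contract_form_eq (hf : IsWeaklyRegular f) (k : ℕ) (hk : k ≤ c) (n : ℕ)
    (x : ExteriorAlgebra A (Fin c → A)) (hx : x ∈ ⋀[A]^n (Fin c → A))
    (hx' : ∀ l : Fin c, k ≤ l → contract (LinearMap.proj l) x = 0)
    (hd : contract (form f k) x = 0)
    (h0 : n = 0 → ∃ a ∈ Ideal.span (f '' {l | (l : ℕ) < k}), x = algebraMap A _ a) :
    ∃ y ∈ ⋀[A]^(n + 1) (Fin c → A), (∀ l : Fin c, k ≤ l → contract (LinearMap.proj l) y = 0) ∧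
      contract (form f k) y = x := by
  induction k generalizing n x with
  | zero =>
    have : x = 0 := by
      cases n with
      | zero =>
        obtain ⟨a, ha, rfl⟩ := h0 rfl
        simp only [not_lt_zero, Set.ofPred_false, Set.image_empty, Ideal.span_empty,
          Ideal.mem_bot] at ha
        rw [ha, map_zero]
      | succ n => exact eq_zero_of_contract_proj_eq_zero hx fun l => hx' l (Nat.zero_le _)
    exact ⟨0, Submodule.zero_mem _, by simp, by simp [this]⟩
  | succ k ih =>
    cases n with
    | zero =>
      obtain ⟨a, ha, rfl⟩ := h0 rfl
      obtain ⟨v, hv, rfl⟩ := (exists_form_eq_iff f (k + 1) a).2 ha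
      refine ⟨ι A v, by simp [exteriorPower], fun l hl => ?_, contract_ι _ _⟩
      rw [contract_ι, LinearMap.proj_apply, hv l hl, map_zero]
    | succ n =>
      set K : Fin c := ⟨k, hk⟩ with hK
      set e : Fin c → A := Pi.single K 1 with he
      set pk : Module.Dual A (Fin c → A) := LinearMap.proj K with hpk
      have hpe : pk e = 1 := by simp [hpk, he]
      have hse : form f k e = 0 := by rw [he, form_single, if_neg (lt_irrefl _)]
      have hform : form f (k + 1) = form f k + f K • pk := form_succ f K
      -- The coefficient of the new basis vector in x.
      set b := contract pk x with hb
      have hbmem : b ∈ ⋀[A]^n (Fin c → A) := contract_mem _ hx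
      have hxb : contract (form f k) x = -(f K • b) := by
        rw [hform, contract_add, contract_smul] at hd
        exact eq_neg_of_add_eq_zero_left hd
      have hbl : ∀ l : Fin c, k ≤ l → contract (LinearMap.proj l) b = 0 := by
        intro l hl
        rcases hl.eq_or_lt with h | h
        · have : l = K := Fin.ext h.symm
          rw [this]
          exact contract_contract _ _
        · rw [hb, contract_comm, hx' l h, map_zero, neg_zero]
      have hdb : contract (form f k) b = 0 := by
        rw [hb, contract_comm, hxb, map_neg, map_smul, contract_contract, smul_zero, neg_zero,
          neg_zero]
      set a := x - ι A e * b with ha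
      have hamem : a ∈ ⋀[A]^(n + 1) (Fin c → A) := Submodule.sub_mem _ hx (ι_mul_mem _ hbmem)
      have hal : ∀ l : Fin c, k ≤ l → contract (LinearMap.proj l) a = 0 := by
        intro l hl
        rw [ha, map_sub, contract_ι_mul, hbl l hl, mul_zero, sub_zero]
        rcases hl.eq_or_lt with h | h
        · have : l = K := Fin.ext h.symm
          subst this
          change b - pk e • b = 0
          rw [hpe, one_smul, sub_self]
        · have : l ≠ K := fun h' => by rw [h'] at h; exact lt_irrefl _ h
          rw [hx' l h, LinearMap.proj_apply, he, Pi.single_apply, if_neg this, zero_smul, sub_zero]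
      have hda : contract (form f k) a = -(f K • b) := by
        rw [ha, map_sub, contract_ι_mul, hse, hdb, hxb]
        simp
      have hset : {l : Fin c | (l : ℕ) < k} = Set.Iio K := rfl
      -- Regularity enters only when b has degree 0: then b is a scalar r, and the equation for the
      -- differential of a puts `f_k r` in the ideal of the earlier elements, so r lies there too.
      obtain ⟨g, hg, hgl, hgd⟩ := ih (by omega) n b hbmem hbl hdb (by
        rintro rfl
        rw [exteriorPower, pow_zero, Submodule.mem_one] at hbmem
        obtain ⟨r, hr⟩ := hbmem
        refine ⟨r, ?_, hr.symm⟩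
        rw [hset]
        refine hf K r ?_
        rw [exteriorPower, zero_add, pow_one] at hamem
        obtain ⟨m, hm⟩ := hamem
        rw [← hm, contract_ι, ← hr, Algebra.smul_def, ← map_mul, ← map_neg] at hda
        rw [← neg_neg (f K * r), ← (algebraMap_leftInverse _).injective hda]
        exact (Ideal.neg_mem_iff _).2 (form_mem f k m))
      obtain ⟨y, hy, hyl, hyd⟩ := ih (by omega) (n + 1) (a + f K • g)
        (Submodule.add_mem _ hamem (Submodule.smul_mem _ _ hg))
        (fun l hl => by rw [map_add, map_smul, hal l hl, hgl l hl, smul_zero, add_zero])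
        (by rw [map_add, map_smul, hda, hgd, neg_add_cancel]) (by simp)
      refine ⟨y - ι A e * g, Submodule.sub_mem _ hy (ι_mul_mem _ hg), fun l hl => ?_, ?_⟩
      · have : l ≠ K := fun h' => by rw [h'] at hl; exact absurd hl (by simp [K])
        rw [map_sub, contract_ι_mul, hyl l (by omega), hgl l (by omega), LinearMap.proj_apply, he,
          Pi.single_apply, if_neg this]
        simp
      · have hpy : contract pk y = 0 := hyl K le_rfl
        have hpg : contract pk g = 0 := hgl K le_rfl
        rw [map_sub, contract_ι_mul, hform]
        simp only [contract_add, contract_smul, hpy, hpg, hyd, hgd, LinearMap.add_apply,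
          LinearMap.smul_apply, hse, hpe, ha]
        simp only [smul_eq_mul, mul_one, zero_add, smul_zero, add_zero]
        abel

end Koszul

/-! ### Systems of Koszul chains in a projective resolution, and their homotopies -/

namespace Koszul

section Systems

variable {A : Type*} [CommRing A]

/-- Koszul's `d ∘ d = 0` for an arbitrary function h of tuples: omitting two indices in either order
leaves the same tuple with opposite signs, so the terms cancel in pairs. -/
lemma sum_sum_faces_eq_zero {X N : Type*} [AddCommGroup N] [Module A N] {n : ℕ} (a : X → A)
    (h : (Fin n → X) → N) (v : Fin (n + 2) → X) :
    ∑ i : Fin (n + 2), (-1 : A) ^ (i : ℕ) • a (v i) • ∑ k : Fin (n + 1), (-1 : A) ^ (k : ℕ) •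
      a ((v ∘ i.succAbove) k) • h ((v ∘ i.succAbove) ∘ k.succAbove) = 0 := by
  simp only [Finset.smul_sum]
  rw [← Finset.sum_product']
  refine Finset.sum_involution (fun p _ => (p.1.succAbove p.2, p.2.predAbove p.1)) ?_ ?_ ?_ ?_
  · rintro ⟨i, k⟩ _
    have h1 : ((v ∘ (i.succAbove k).succAbove) ∘ (k.predAbove i).succAbove) =
        (v ∘ i.succAbove) ∘ k.succAbove :=
      funext fun l => by simp [Fin.succAbove_succAbove_succAbove_predAbove]
    have h2 : (v ∘ (i.succAbove k).succAbove) (k.predAbove i) = v i := by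
      simp [Fin.succAbove_succAbove_predAbove]
    have h3 := Fin.neg_one_pow_succAbove_add_predAbove (R := A) i k
    dsimp only
    rw [h1, h2]
    simp only [smul_smul, Function.comp_apply]
    rw [← add_smul]
    convert! zero_smul A _
    rw [pow_add, pow_add] at h3
    linear_combination (a (v i) * a (v (i.succAbove k))) * h3
  · rintro ⟨i, k⟩ _ _ h
    exact Fin.succAbove_ne i k (congrArg Prod.fst h)
  · simp
  · rintro ⟨i, k⟩ _
    simp [Fin.succAbove_succAbove_predAbove, Fin.predAbove_predAbove_succAbove]

end Systems

variable {A : Type u} [CommRing A]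

/-- A family of chains indexed by the tuples in `X` that behaves like the family of exterior
products of the basis vectors of the Koszul complex of `a : X → A`. -/
structure IsSystem (C : ChainComplex (ModuleCat.{u} A) ℕ) {G : ModuleCat.{u} A} (ε : C.X 0 ⟶ G)
    {X : Type*} (a : X → A) (g : G) (φ : ∀ n, (Fin n → X) → C.X n) : Prop where
  aug (v : Fin 0 → X) : ε.hom (φ 0 v) = g
  diff (n : ℕ) (v : Fin (n + 1) → X) : (C.d (n + 1) n).hom (φ (n + 1) v) =
    ∑ i : Fin (n + 1), (-1 : A) ^ (i : ℕ) • a (v i) • φ n (v ∘ i.succAbove)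

variable {G : ModuleCat.{u} A} (P : ProjectiveResolution G)

/-- The augmentation of a projective resolution. -/
def augmentation : P.complex.X 0 ⟶ G := P.π.f 0

lemma exists_d_eq_of_augmentation_eq_zero (x : P.complex.X 0) (hx : (augmentation P).hom x = 0) :
    ∃ y, (P.complex.d 1 0).hom y = x := by
  have : (ShortComplex.mk (P.complex.d 1 0) (augmentation P) P.complex_d_comp_π_f_zero).Exact :=
    ShortComplex.exact_of_g_is_cokernel _ P.isColimitCokernelCofork
  rw [ShortComplex.moduleCat_exact_iff] at this
  exact this x hx

lemma exists_d_eq (n : ℕ) (x : P.complex.X (n + 1)) (hx : (P.complex.d (n + 1) n).hom x = 0) :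
    ∃ y, (P.complex.d (n + 2) (n + 1)).hom y = x := by
  have := P.exact_succ n
  rw [ShortComplex.moduleCat_exact_iff] at this
  exact this x hx

/-- The hypothesis says that `d h` and `φ - φ'` have the same Koszul boundary. Therefore `φ - φ'`
minus the Koszul boundary of h is a cycle one degree higher, and exactness of P makes it a boundary.
-/
lemma IsSystem.exists_homotopy_succ {X : Type*} {a : X → A} {g : G}
    {φ φ' : ∀ n, (Fin n → X) → P.complex.X n}
    (hφ : IsSystem P.complex (augmentation P) a g φ)
    (hφ' : IsSystem P.complex (augmentation P) a g φ') (n : ℕ)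
    (h : (Fin n → X) → P.complex.X (n + 1))
    (hh : ∀ v : Fin (n + 1) → X, ∑ i : Fin (n + 1), (-1 : A) ^ (i : ℕ) • a (v i) •
      (P.complex.d (n + 1) n).hom (h (v ∘ i.succAbove)) =
      ∑ i : Fin (n + 1), (-1 : A) ^ (i : ℕ) • a (v i) •
        (φ n (v ∘ i.succAbove) - φ' n (v ∘ i.succAbove))) :
    ∃ h' : (Fin (n + 1) → X) → P.complex.X (n + 2),
      ∀ v, φ (n + 1) v - φ' (n + 1) v = (P.complex.d (n + 2) (n + 1)).hom (h' v) +
        ∑ i : Fin (n + 1), (-1 : A) ^ (i : ℕ) • a (v i) • h (v ∘ i.succAbove) := by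
  have key : ∀ v, ∃ y, (P.complex.d (n + 2) (n + 1)).hom y = φ (n + 1) v - φ' (n + 1) v -
      ∑ i : Fin (n + 1), (-1 : A) ^ (i : ℕ) • a (v i) • h (v ∘ i.succAbove) := fun v => by
    refine exists_d_eq P n _ ?_
    rw [map_sub, map_sub, hφ.diff, hφ'.diff, map_sum, sub_eq_zero, ← Finset.sum_sub_distrib]
    simp only [map_smul, ← smul_sub]
    exact (hh v).symm
  choose h' h'' using key
  exact ⟨h', fun v => by rw [h'', sub_add_cancel]⟩

/-- Two systems over the same elements are homotopic. -/
lemma IsSystem.exists_homotopy {X : Type*} {a : X → A} {g : G}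
    {φ φ' : ∀ n, (Fin n → X) → P.complex.X n}
    (hφ : IsSystem P.complex (augmentation P) a g φ)
    (hφ' : IsSystem P.complex (augmentation P) a g φ') (n : ℕ) :
    ∃ (h : (Fin n → X) → P.complex.X (n + 1)) (h' : (Fin (n + 1) → X) → P.complex.X (n + 2)),
      ∀ v, φ (n + 1) v - φ' (n + 1) v = (P.complex.d (n + 2) (n + 1)).hom (h' v) +
        ∑ i : Fin (n + 1), (-1 : A) ^ (i : ℕ) • a (v i) • h (v ∘ i.succAbove) := by
  induction n with
  | zero =>
    have : ∀ v, ∃ y, (P.complex.d 1 0).hom y = φ 0 v - φ' 0 v := fun v => by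
      refine exists_d_eq_of_augmentation_eq_zero P _ ?_
      rw [map_sub, hφ.aug, hφ'.aug, sub_self]
    choose h hh using this
    obtain ⟨h', hh'⟩ := hφ.exists_homotopy_succ P hφ' 0 h (fun v => by simp only [hh])
    exact ⟨h, h', hh'⟩
  | succ n ih =>
    obtain ⟨h, h', hh'⟩ := ih
    have hh'' : ∀ v, (P.complex.d (n + 2) (n + 1)).hom (h' v) = φ (n + 1) v - φ' (n + 1) v -
        ∑ i : Fin (n + 1), (-1 : A) ^ (i : ℕ) • a (v i) • h (v ∘ i.succAbove) :=
      fun v => eq_sub_of_add_eq (hh' v).symm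
    -- Substituting the formula for `d h'` leaves a double Koszul boundary of h, which vanishes.
    obtain ⟨k, hk⟩ := hφ.exists_homotopy_succ P hφ' (n + 1) h' (fun v => by
      refine (Finset.sum_congr rfl fun i _ => by rw [hh'', smul_sub, smul_sub]).trans ?_
      rw [Finset.sum_sub_distrib, sum_sum_faces_eq_zero, sub_zero])
    exact ⟨h', k, hk⟩

open TensorProduct in
/-- The class of `x ⊗ φ v` modulo boundaries does not depend on the system `φ`, if `x` is killed
by the elements that define the system. -/
lemma IsSystem.exists_tmul_sub_eq {X : Type*} {a : X → A} {g : G}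
    {φ φ' : ∀ n, (Fin n → X) → P.complex.X n}
    (hφ : IsSystem P.complex (augmentation P) a g φ)
    (hφ' : IsSystem P.complex (augmentation P) a g φ') {F : Type*} [AddCommGroup F] [Module A F]
    (x : F) (hx : ∀ i, a i • x = 0) (n : ℕ) (v : Fin n → X) :
    ∃ y : P.complex.X (n + 1), x ⊗ₜ[A] φ n v - x ⊗ₜ[A] φ' n v =
      x ⊗ₜ[A] (P.complex.d (n + 1) n).hom y := by
  cases n with
  | zero =>
    obtain ⟨y, hy⟩ := exists_d_eq_of_augmentation_eq_zero P (φ 0 v - φ' 0 v)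
      (by rw [map_sub, hφ.aug, hφ'.aug, sub_self])
    exact ⟨y, by rw [hy, tmul_sub]⟩
  | succ n =>
    obtain ⟨h, h', hh⟩ := hφ.exists_homotopy P hφ' n
    refine ⟨h' v, ?_⟩
    rw [← tmul_sub, hh, tmul_add, tmul_sum, Finset.sum_eq_zero, add_zero]
    -- Each remaining term carries a coefficient `a (v i)`, which moves across the tensor sign and
    -- kills x.
    intro i _
    rw [smul_comm, ← smul_tmul, hx, zero_tmul]

section HomotopyEquiv

variable {K C : ChainComplex (ModuleCat.{u} A) ℕ} (F : Type*) [AddCommGroup F] [Module A F]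

open LinearMap (lTensor)

lemma lTensor_hom_comp {X Y Z : ModuleCat.{u} A} (f : X ⟶ Y) (g : Y ⟶ Z) (x : TensorProduct A F X) :
    lTensor F (f ≫ g).hom x = lTensor F g.hom (lTensor F f.hom x) := by
  rw [ModuleCat.hom_comp, LinearMap.lTensor_comp]
  rfl

lemma lTensor_d_lTensor_f (e : K ⟶ C) (i j : ℕ) (y : TensorProduct A F (K.X i)) :
    lTensor F (C.d i j).hom (lTensor F (e.f i).hom y) =
      lTensor F (e.f j).hom (lTensor F (K.d i j).hom y) := by
  rw [← lTensor_hom_comp, ← lTensor_hom_comp, e.comm]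

/-- The homotopy formula evaluated on a cycle: the summand that begins with the differential drops
out. -/
lemma lTensor_f_lTensor_f_of_homotopy {e : K ⟶ C} {e' : C ⟶ K} (h : Homotopy (e ≫ e') (𝟙 K))
    (q : ℕ) (z : TensorProduct A F (K.X q)) (hz : ∀ j, lTensor F (K.d q j).hom z = 0) :
    lTensor F (e'.f q).hom (lTensor F (e.f q).hom z) =
      z + lTensor F (K.d (q + 1) q).hom (lTensor F (h.hom q (q + 1)).hom z) := by
  have h1 := h.comm q
  have h2 : lTensor F (dNext q h.hom).hom z = 0 := by
    change lTensor F (K.d q _ ≫ h.hom _ q).hom z = 0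
    rw [lTensor_hom_comp, hz, map_zero]
  rw [← lTensor_hom_comp, ← HomologicalComplex.comp_f, h1, Homotopy.prevD_chainComplex, ModuleCat.hom_add,
    ModuleCat.hom_add, LinearMap.lTensor_add, LinearMap.lTensor_add, LinearMap.add_apply,
    LinearMap.add_apply, h2, zero_add, add_comm, lTensor_hom_comp, HomologicalComplex.id_f,
    ModuleCat.hom_id, LinearMap.lTensor_id]
  rfl

/-- A homotopy equivalence from a complex that has zero differentials after tensoring with `F`
computes the homology of the tensor product with `F`. -/
lemma exists_lTensor_of_homotopyEquiv (e : HomotopyEquiv K C)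
    (hK : ∀ i j, lTensor F (K.d i j).hom = 0) (q : ℕ) :
    (∀ (j : ℕ) (y : TensorProduct A F (K.X q)),
      lTensor F (C.d q j).hom (lTensor F (e.hom.f q).hom y) = 0) ∧
    (∀ (y : TensorProduct A F (K.X q)) (w : TensorProduct A F (C.X (q + 1))),
      lTensor F (e.hom.f q).hom y = lTensor F (C.d (q + 1) q).hom w → y = 0) ∧
    (∀ z : TensorProduct A F (C.X q), (∀ j, lTensor F (C.d q j).hom z = 0) →
      ∃ (y : TensorProduct A F (K.X q)) (w : TensorProduct A F (C.X (q + 1))),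
        z = lTensor F (e.hom.f q).hom y + lTensor F (C.d (q + 1) q).hom w) := by
  refine ⟨fun j y => ?_, fun y w h => ?_, fun z hz => ?_⟩
  · rw [lTensor_d_lTensor_f, hK, LinearMap.zero_apply, map_zero]
  · have h1 := lTensor_f_lTensor_f_of_homotopy F e.homotopyHomInvId q y
      (fun j => by rw [hK, LinearMap.zero_apply])
    rw [hK, LinearMap.zero_apply, add_zero, h, ← lTensor_d_lTensor_f, hK,
      LinearMap.zero_apply] at h1
    exact h1.symm
  · exact ⟨lTensor F (e.inv.f q).hom z, -lTensor F (e.homotopyInvHomId.hom q (q + 1)).hom z, by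
      rw [lTensor_f_lTensor_f_of_homotopy F e.homotopyInvHomId q z hz, map_neg,
        add_neg_cancel_right]⟩

end HomotopyEquiv

/-! ### The Koszul complex -/

section Complex

variable {c : ℕ} (f : Fin c → A)

open ExteriorAlgebra

/-- The Koszul differential. -/
def differential (s : Module.Dual A (Fin c → A)) (n : ℕ) :
    ⋀[A]^(n + 1) (Fin c → A) →ₗ[A] ⋀[A]^n (Fin c → A) :=
  (contract s).restrict fun _ => contract_mem s

lemma differential_differential (s : Module.Dual A (Fin c → A)) (n : ℕ)
    (x : ⋀[A]^(n + 2) (Fin c → A)) : differential s n (differential s (n + 1) x) = 0 :=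
  Subtype.ext (contract_contract s _)

lemma differential_ιMulti (s : Module.Dual A (Fin c → A)) (n : ℕ) (v : Fin (n + 1) → Fin c → A) :
    differential s n (exteriorPower.ιMulti A (n + 1) v) =
      ∑ i : Fin (n + 1), (-1 : A) ^ (i : ℕ) • s (v i) •
        exteriorPower.ιMulti A n (v ∘ i.succAbove) :=
  Subtype.ext (by
    refine (contract_ιMulti s v).trans ?_
    simp)

/-- The Koszul complex of the elements `f 0, f 1, …`. -/
def complex : ChainComplex (ModuleCat.{u} A) ℕ :=
  ChainComplex.of (fun n => ModuleCat.of A (⋀[A]^n (Fin c → A)))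
    (fun n => ModuleCat.ofHom (differential (form f c) n))
    (fun n => ModuleCat.hom_ext (LinearMap.ext fun x => differential_differential _ n x))

lemma complex_d (n : ℕ) : (complex f).d (n + 1) n = ModuleCat.ofHom (differential (form f c) n) :=
  ChainComplex.of_d (fun n => ModuleCat.of A (⋀[A]^n (Fin c → A)))
    (fun n => ModuleCat.ofHom (differential (form f c) n)) n

lemma exists_differential_eq (hf : IsWeaklyRegular f) (n : ℕ) (x : ⋀[A]^(n + 1) (Fin c → A))
    (hx : differential (form f c) n x = 0) : ∃ y, differential (form f c) (n + 1) y = x := by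
  obtain ⟨y, hy, -, hyx⟩ := exists_contract_form_eq f hf c le_rfl (n + 1) x.1 x.2
    (fun l hl => absurd l.2 (not_lt.2 hl)) (congrArg Subtype.val hx) (by simp)
  exact ⟨⟨y, hy⟩, Subtype.ext hyx⟩

variable (π : ModuleCat.of A A ⟶ G)

/-- The augmentation of the Koszul complex. -/
def complexπ : (complex f).X 0 ⟶ G :=
  ModuleCat.ofHom (π.hom ∘ₗ (exteriorPower.zeroEquiv A (Fin c → A)).toLinearMap)

lemma zeroEquiv_differential (x : ⋀[A]^1 (Fin c → A)) :
    exteriorPower.zeroEquiv A (Fin c → A) (differential (form f c) 0 x) =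
      form f c (exteriorPower.oneEquiv A (Fin c → A) x) := by
  have : (exteriorPower.zeroEquiv A (Fin c → A)).toLinearMap ∘ₗ differential (form f c) 0 =
      form f c ∘ₗ (exteriorPower.oneEquiv A (Fin c → A)).toLinearMap :=
    exteriorPower.linearMap_ext (AlternatingMap.ext fun v => by
      simp [differential_ιMulti])
  exact LinearMap.congr_fun this x

lemma complexπ_comp (hker : LinearMap.ker π.hom = Ideal.span (Set.range f)) :
    (complex f).d 1 0 ≫ complexπ f π = 0 := by
  rw [complex_d]
  refine ModuleCat.hom_ext (LinearMap.ext fun (x : ⋀[A]^1 (Fin c → A)) => ?_)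
  change π.hom (exteriorPower.zeroEquiv A (Fin c → A) (differential (form f c) 0 x)) = 0
  rw [zeroEquiv_differential, ← LinearMap.mem_ker, hker]
  refine Ideal.span_mono ?_ (form_mem f c _)
  rintro _ ⟨l, -, rfl⟩
  exact ⟨l, rfl⟩

lemma exact_complexπ (hker : LinearMap.ker π.hom = Ideal.span (Set.range f)) :
    (ShortComplex.mk _ _ (complexπ_comp f π hker)).Exact := by
  rw [ShortComplex.moduleCat_exact_iff]
  intro (x : ⋀[A]^0 (Fin c → A)) hx
  have h1 : exteriorPower.zeroEquiv A (Fin c → A) x ∈ LinearMap.ker π.hom := hx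
  rw [hker] at h1
  obtain ⟨v, -, hv⟩ := (exists_form_eq_iff f c _).2 (Ideal.span_mono (by
    rintro _ ⟨l, rfl⟩
    exact ⟨l, l.2, rfl⟩) h1)
  refine ⟨(exteriorPower.oneEquiv A (Fin c → A)).symm v,
    (exteriorPower.zeroEquiv A (Fin c → A)).injective ?_⟩
  change exteriorPower.zeroEquiv A (Fin c → A) (((complex f).d 1 0).hom _) = _
  rw [complex_d]
  refine (zeroEquiv_differential f _).trans ?_
  rw [LinearEquiv.apply_symm_apply, hv]

lemma complexπ_surjective (hπ : Function.Surjective π.hom) :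
    Function.Surjective (complexπ f π).hom :=
  hπ.comp (exteriorPower.zeroEquiv A (Fin c → A)).surjective

lemma exactAt_complex (hf : IsWeaklyRegular f) (n : ℕ) : (complex f).ExactAt (n + 1) := by
  rw [HomologicalComplex.exactAt_iff' _ (n + 1 + 1) (n + 1) n (by simp) (by simp),
    ShortComplex.moduleCat_exact_iff]
  intro (x : ⋀[A]^(n + 1) (Fin c → A)) hx
  change ((complex f).d (n + 1) n).hom x = 0 at hx
  rw [complex_d] at hx
  obtain ⟨y, hy⟩ := exists_differential_eq f hf n x hx
  refine ⟨y, ?_⟩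
  change ((complex f).d (n + 2) (n + 1)).hom y = x
  rw [complex_d]
  exact hy

/-- The Koszul complex of a weakly regular sequence is a resolution. -/
def resolution (hf : IsWeaklyRegular f) (hπ : Function.Surjective π.hom)
    (hker : LinearMap.ker π.hom = Ideal.span (Set.range f)) : ProjectiveResolution G where
  complex := complex f
  projective n := ModuleCat.projective_of_free (Module.Free.chooseBasis A (⋀[A]^n (Fin c → A)))
  π := (ChainComplex.toSingle₀Equiv _ _).symm ⟨complexπ f π, complexπ_comp f π hker⟩
  quasiIso := ⟨fun n => by
    cases n
    -- In degree 0 a quasi-isomorphism onto the single complex means exactness at the augmentation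
    -- together with its surjectivity.
    · rw [ChainComplex.quasiIsoAt₀_iff, ShortComplex.quasiIso_iff_of_zeros']
      · refine (ShortComplex.exact_and_epi_g_iff_of_iso ?_).2 ⟨exact_complexπ f π hker,
          (ModuleCat.epi_iff_surjective _).2 (complexπ_surjective f π hπ)⟩
        exact ShortComplex.isoMk (Iso.refl _) (Iso.refl _) (Iso.refl _)
          ((Category.id_comp _).trans (Category.comp_id _).symm)
          ((Category.id_comp _).trans (Category.comp_id _).symm)
      all_goals rfl
    · rw [quasiIsoAt_iff_exactAt']
      · exact exactAt_complex f hf _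
      · apply ChainComplex.exactAt_succ_single_obj⟩

open TensorProduct

lemma form_smul_eq_zero {F : Type*} [AddCommGroup F] [Module A F]
    (hF : ∀ (x : F) (l : Fin c), f l • x = 0) (k : ℕ) (v : Fin c → A) (x : F) :
    form f k v • x = 0 := by
  rw [form_apply, Finset.sum_smul]
  refine Finset.sum_eq_zero fun l _ => ?_
  split_ifs
  · rw [mul_comm, mul_smul, hF, smul_zero]
  · rw [zero_mul, zero_smul]

/-- Every coefficient of the differential is a combination of the f_l and moves across the tensor
sign onto F, where it acts as zero. For F the functions on S, this is where `S ⊆ T` makes the Tor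
computation collapse. -/
lemma lTensor_differential {F : Type*} [AddCommGroup F] [Module A F]
    (hF : ∀ (x : F) (l : Fin c), f l • x = 0) (k n : ℕ) :
    LinearMap.lTensor F (differential (form f k) n) = 0 := by
  refine TensorProduct.ext' fun x y => ?_
  rw [LinearMap.lTensor_tmul, LinearMap.zero_apply]
  have hy : y ∈ Submodule.span A (Set.range (exteriorPower.ιMulti A (n + 1))) := by
    rw [exteriorPower.ιMulti_span]; trivial
  induction hy using Submodule.span_induction with
  | mem y hy =>
    obtain ⟨v, rfl⟩ := hy
    rw [differential_ιMulti, tmul_sum]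
    refine Finset.sum_eq_zero fun i _ => ?_
    rw [smul_comm, ← smul_tmul, form_smul_eq_zero f hF, zero_tmul]
  | zero => rw [map_zero, tmul_zero]
  | add y z _ _ hy hz => rw [map_add, tmul_add, hy, hz, add_zero]
  | smul a y _ hy => rw [map_smul, tmul_smul, hy, smul_zero]

lemma lTensor_complex_d {F : Type*} [AddCommGroup F] [Module A F]
    (hF : ∀ (x : F) (l : Fin c), f l • x = 0) (i j : ℕ) :
    LinearMap.lTensor F ((complex f).d i j).hom = 0 := by
  by_cases h : j + 1 = i
  · subst h
    rw [complex_d]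
    exact lTensor_differential f hF c j
  · rw [(complex f).shape i j h]
    exact LinearMap.lTensor_zero F

/-- The comparison of the Koszul resolution with an arbitrary projective resolution `P`: if `F` is
a module killed by the elements of the sequence, then the homology of `F ⊗ P` is `F ⊗ ⋀ Aᶜ`. -/
lemma exists_comparison (P : ProjectiveResolution G) (hf : IsWeaklyRegular f)
    (hπ : Function.Surjective π.hom)
    (hker : LinearMap.ker π.hom = Ideal.span (Set.range f)) :
    ∃ φ : ∀ n, ⋀[A]^n (Fin c → A) →ₗ[A] P.complex.X n,
      (∀ (X : Type) (B : X → Fin c → A), IsSystem P.complex (augmentation P)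
        (fun x => form f c (B x)) (π.hom (1 : A))
          (fun n v => φ n (exteriorPower.ιMulti A n (B ∘ v)))) ∧
      ∀ (F : Type u) [AddCommGroup F] [Module A F], (∀ (x : F) (l : Fin c), f l • x = 0) → ∀ q : ℕ,
        (∀ (j : ℕ) (y : F ⊗[A] ⋀[A]^q (Fin c → A)), LinearMap.lTensor F (P.complex.d q j).hom
          (LinearMap.lTensor F (φ q) y) = 0) ∧
        (∀ (y : F ⊗[A] ⋀[A]^q (Fin c → A)) (w : F ⊗[A] P.complex.X (q + 1)),
          LinearMap.lTensor F (φ q) y = LinearMap.lTensor F (P.complex.d (q + 1) q).hom w →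
            y = 0) ∧
        (∀ z : F ⊗[A] P.complex.X q,
          (∀ j, LinearMap.lTensor F (P.complex.d q j).hom z = 0) →
            ∃ (y : F ⊗[A] ⋀[A]^q (Fin c → A)) (w : F ⊗[A] P.complex.X (q + 1)),
              z = LinearMap.lTensor F (φ q) y +
                LinearMap.lTensor F (P.complex.d (q + 1) q).hom w) := by
  let K := resolution f π hf hπ hker
  let e := ProjectiveResolution.homotopyEquiv K P
  -- The comparison respects augmentations, so the images of exterior products start from the image
  -- of 1, as a system must.
  have haug : e.hom.f 0 ≫ augmentation P = complexπ f π := by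
    have := congrArg (fun g => g.f 0) (ProjectiveResolution.homotopyEquiv_hom_π K P)
    refine this.trans ?_
    exact ChainComplex.toSingle₀Equiv_symm_apply_f_zero (C := complex f) _ (complexπ_comp f π hker)
  have hcomm : ∀ n (x : ⋀[A]^(n + 1) (Fin c → A)),
      (P.complex.d (n + 1) n).hom ((e.hom.f (n + 1)).hom x) =
      (e.hom.f n).hom (differential (form f c) n x) := fun n x => by
    have := LinearMap.congr_fun (congrArg ModuleCat.Hom.hom (e.hom.comm (n + 1) n)) x
    refine this.trans ?_
    change (e.hom.f n).hom (((complex f).d (n + 1) n).hom x) = _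
    rw [complex_d]
    rfl
  refine ⟨fun n => (e.hom.f n).hom, fun X B => ⟨fun v => ?_, fun n v => ?_⟩, fun F _ _ hF q =>
    exists_lTensor_of_homotopyEquiv F e (lTensor_complex_d f hF) q⟩
  · refine (LinearMap.congr_fun (congrArg ModuleCat.Hom.hom haug)
      (exteriorPower.ιMulti A 0 (B ∘ v))).trans ?_
    exact congrArg π.hom (exteriorPower.zeroEquiv_ιMulti _)
  · refine (hcomm n _).trans ?_
    rw [differential_ιMulti]
    let g : ⋀[A]^n (Fin c → A) →ₗ[A] P.complex.X n := (e.hom.f n).hom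
    refine (map_sum g _ _).trans (Finset.sum_congr rfl fun i _ => ?_)
    exact (g.map_smul _ _).trans (congrArg _ (g.map_smul _ _))

end Complex

end Koszul

/-! ### Sections of projective resolutions, and homology classes represented by cycles -/

namespace PresheafOfModules

variable {C : Type u} [SmallCategory.{u} C]

section Evaluation

variable (R : Cᵒᵖ ⥤ RingCat.{u}) (U : Cᵒᵖ)

lemma projective_free_obj (F : Cᵒᵖ ⥤ Type u) : Projective (((free R).obj F).obj U) :=
  inferInstanceAs (Projective ((ModuleCat.free (R.obj U)).obj (F.obj U)))

/-- A projective presheaf is a retract of a coproduct of free presheaves on representables, and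
evaluation turns such a coproduct into a coproduct of free modules. Consequently a projective
resolution of presheaves gives one of modules over each open set, which can be compared with a
Koszul complex. -/
instance preservesProjectiveObjects_evaluation :
    (evaluation.{u} R U).PreservesProjectiveObjects where
  projective_obj {M} hM := by
    have : Projective ((evaluation R U).obj M.freeYonedaCoproduct) := by
      have : ∀ m : M.Elements, Projective ((evaluation R U).obj m.freeYoneda) :=
        fun m => projective_free_obj R U _
      exact Projective.of_iso
        (PreservesCoproduct.iso (evaluation R U) (Elements.freeYoneda (M := M))).symm inferInstance
    exact (Retract.map
      { i := Projective.factorThru (𝟙 M) M.fromFreeYonedaCoproduct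
        r := M.fromFreeYonedaCoproduct } (evaluation R U)).projective

variable {R} {U}

lemma exact_app {S : ShortComplex (PresheafOfModules.{u} R)} (hS : S.Exact) (x : S.X₂.obj U)
    (hx : (S.g.app U).hom x = 0) : ∃ y, (S.f.app U).hom y = x := by
  have := hS.map (evaluation R U)
  rw [ShortComplex.moduleCat_exact_iff] at this
  exact this x hx

end Evaluation

section Homology

variable {R : Cᵒᵖ ⥤ RingCat.{u}} (T : ChainComplex (PresheafOfModules.{u} R) ℕ) (q : ℕ)

/-- The cycle `z` over `U` represents the homology class `a`. -/
def Represents (U : Cᵒᵖ) (z : (T.X q).obj U) (a : (T.homology q).obj U) : Prop :=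
  ∃ c : (T.cycles q).obj U, ((T.iCycles q).app U).hom c = z ∧ ((T.homologyπ q).app U).hom c = a

variable {T q} {U V : Cᵒᵖ}

lemma Represents.add {z w : (T.X q).obj U} {a b : (T.homology q).obj U}
    (hz : Represents T q U z a) (hw : Represents T q U w b) :
    Represents T q U (z + w) (a + b) := by
  obtain ⟨c, rfl, rfl⟩ := hz
  obtain ⟨d, rfl, rfl⟩ := hw
  exact ⟨c + d, map_add _ _ _, map_add _ _ _⟩

lemma Represents.smul {z : (T.X q).obj U} {a : (T.homology q).obj U} (r : R.obj U)
    (hz : Represents T q U z a) : Represents T q U (r • z) (r • a) := by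
  obtain ⟨c, rfl, rfl⟩ := hz
  exact ⟨r • c, map_smul _ _ _, map_smul _ _ _⟩

lemma Represents.zero : Represents T q U 0 0 := ⟨0, map_zero _, map_zero _⟩

lemma Represents.map (f : U ⟶ V) {z : (T.X q).obj U} {a : (T.homology q).obj U}
    (hz : Represents T q U z a) :
    Represents T q V ((T.X q).restrictₛₗ f z) ((T.homology q).restrictₛₗ f a) := by
  obtain ⟨c, rfl, rfl⟩ := hz
  exact ⟨(T.cycles q).restrictₛₗ f c, naturality_apply (T.iCycles q) f c,
    naturality_apply (T.homologyπ q) f c⟩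

lemma exists_represents (z : (T.X q).obj U) (hz : ∀ j, ((T.d q j).app U).hom z = 0) :
    ∃ a, Represents T q U z a := by
  have h : (ShortComplex.mk _ _ (T.iCycles_d q ((ComplexShape.down ℕ).next q))).Exact :=
    ShortComplex.exact_of_f_is_kernel _ (T.cyclesIsKernel q _ rfl)
  obtain ⟨c, hc⟩ := exact_app h z (hz _)
  exact ⟨_, c, hc, rfl⟩

lemma exists_represents' (a : (T.homology q).obj U) :
    ∃ z, (∀ j, ((T.d q j).app U).hom z = 0) ∧ Represents T q U z a := by
  obtain ⟨c, rfl⟩ := surjective_of_epi (T.homologyπ q) U a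
  refine ⟨_, fun j => ?_, c, rfl, rfl⟩
  exact LinearMap.congr_fun (congrArg (fun g => (g.app U).hom) (T.iCycles_d q j)) c

/-- Evaluation at U is exact, so the cycles and boundaries of the presheaf homology are the ones
over U. With this, classes are handled through representing cycles, and no isomorphism with the
homology of the sections is needed. -/
lemma Represents.eq_zero_iff {z : (T.X q).obj U} {a : (T.homology q).obj U}
    (hz : Represents T q U z a) : a = 0 ↔ ∃ w, ((T.d (q + 1) q).app U).hom w = z := by
  obtain ⟨c, rfl, rfl⟩ := hz
  have h : (ShortComplex.mk _ _ (T.toCycles_comp_homologyπ (q + 1) q)).Exact :=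
    ShortComplex.exact_of_g_is_cokernel _ (T.homologyIsCokernel (q + 1) q (by simp))
  have hi : ∀ w, ((T.iCycles q).app U).hom (((T.toCycles (q + 1) q).app U).hom w) =
      ((T.d (q + 1) q).app U).hom w := fun w =>
    LinearMap.congr_fun (congrArg (fun g => (g.app U).hom) (T.toCycles_i (q + 1) q)) w
  constructor
  · intro h0
    obtain ⟨w, hw⟩ := exact_app h c h0
    exact ⟨w, by rw [← hi, ← hw]⟩
  · rintro ⟨w, hw⟩
    rw [← hi] at hw
    rw [← injective_of_mono (T.iCycles q) U hw]
    exact LinearMap.congr_fun (congrArg (fun g => (g.app U).hom)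
      (T.toCycles_comp_homologyπ (q + 1) q)) w

end Homology

section Tor

variable {R : Cᵒᵖ ⥤ CommRingCat.{u}}
  (F G : PresheafOfModules.{u} (R ⋙ forget₂ CommRingCat RingCat))

/-- The complex `F ⊗ P` for a projective resolution `P`. -/
def torComplex {G : PresheafOfModules.{u} (R ⋙ forget₂ CommRingCat RingCat)}
    (P : ProjectiveResolution G) :
    ChainComplex (PresheafOfModules.{u} (R ⋙ forget₂ CommRingCat RingCat)) ℕ :=
  (((tensoringLeft _).obj F).mapHomologicalComplex _).obj P.complex

/-- Tor is the homology of the tensor product with a projective resolution. -/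
def torIso (P : ProjectiveResolution G) (q : ℕ) :
    ((Tor (PresheafOfModules.{u} (R ⋙ forget₂ CommRingCat RingCat)) q).obj F).obj G ≅
      (torComplex F P).homology q :=
  P.isoLeftDerivedObj _ q

/-- The resolution of `G(U)` given by the sections over `U`. -/
def resolutionApp {G : PresheafOfModules.{u} (R ⋙ forget₂ CommRingCat RingCat)}
    (P : ProjectiveResolution G) (U : Cᵒᵖ) :
    ProjectiveResolution (C := ModuleCat.{u} (R.obj U)) (G.obj U) :=
  (evaluation (R ⋙ forget₂ CommRingCat RingCat) U).mapProjectiveResolution P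

end Tor

end PresheafOfModules

/-! ### Sections, restriction and gluing -/

namespace AlgebraicGeometry.LocallyRingedSpace

variable {X Y : LocallyRingedSpace.{u}}

/-- Presheaves of modules on a locally ringed space. -/
abbrev PreModules (X : LocallyRingedSpace.{u}) :=
  PresheafOfModules.{u} (X.presheaf ⋙ forget₂ CommRingCat RingCat)

/-- The ring of functions over an open subset. -/
abbrev Fun (U : Opens X) : Type u := X.presheaf.obj (op U)

/-- Restriction of functions. -/
def resFun {U V : Opens X} (h : V ≤ U) : Fun U →+* Fun V := (X.presheaf.map (homOfLE h).op).hom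

/-- The sections of a presheaf of modules over an open subset. -/
def Sec (M : PreModules X) (U : Opens X) : Type u := M.obj (op U)

instance (M : PreModules X) (U : Opens X) : AddCommGroup (Sec M U) :=
  inferInstanceAs (AddCommGroup (M.obj (op U)))

instance (M : PreModules X) (U : Opens X) : Module (Fun U) (Sec M U) :=
  inferInstanceAs (Module ((X.presheaf ⋙ forget₂ CommRingCat RingCat).obj (op U)) (M.obj (op U)))

/-- Restriction of sections. -/
def res (M : PreModules X) {U V : Opens X} (h : V ≤ U) : Sec M U →ₛₗ[resFun h] Sec M V :=
  M.restrictₛₗ (homOfLE h).op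

section Restriction

variable (M N : PreModules X) {U V W : Opens X}

@[simp]
lemma resFun_self (h : U ≤ U) (a : Fun U) : resFun h a = a :=
  congrArg (fun g => g.hom a) (X.presheaf.map_id (op U))

@[simp]
lemma resFun_resFun (h : V ≤ U) (h' : W ≤ V) (a : Fun U) :
    resFun h' (resFun h a) = resFun (h'.trans h) a :=
  (congrArg (fun g => g.hom a)
    (X.presheaf.map_comp (homOfLE h).op (homOfLE h').op)).symm

@[simp]
lemma res_self (h : U ≤ U) (x : Sec M U) : res M h x = x := by
  change M.map (𝟙 _) x = x
  rw [M.map_id]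
  rfl

@[simp]
lemma res_res (h : V ≤ U) (h' : W ≤ V) (x : Sec M U) :
    res M h' (res M h x) = res M (h'.trans h) x :=
  (M.map_comp_apply (homOfLE h).op (homOfLE h').op x).symm

variable {M N}

/-- The map on sections induced by a morphism of presheaves of modules. -/
def appSec (φ : M ⟶ N) (U : Opens X) : Sec M U →ₗ[Fun U] Sec N U := (φ.app (op U)).hom

lemma res_appSec (φ : M ⟶ N) (h : V ≤ U) (x : Sec M U) :
    res N h (appSec φ U x) = appSec φ V (res M h x) :=
  (PresheafOfModules.naturality_apply φ (homOfLE h).op x).symm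

end Restriction

section Gluing

variable (F : Modules X)

/-- The underlying presheaf of modules. -/
abbrev pre (F : Modules X) : PreModules X := F.val

lemma eq_of_locally_eq {U : Opens X} (x y : Sec (pre F) U)
    (h : ∀ p ∈ U, ∃ (V : Opens X) (hV : V ≤ U), p ∈ V ∧ res (pre F) hV x = res (pre F) hV y) :
    x = y := by
  choose V hV hp he using h
  refine TopCat.Sheaf.eq_of_locally_eq' (C := Ab.{u}) ⟨F.val.presheaf, F.isSheaf⟩
    (fun p : U => V p.1 p.2) U (fun p => homOfLE (hV p.1 p.2)) (fun p hpU => ?_) x y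
    (fun p => he p.1 p.2)
  rw [Opens.mem_iSup]
  exact ⟨⟨p, hpU⟩, hp p hpU⟩

/-- Sections that are locally given by a property which determines them uniquely can be glued. -/
lemma exists_glue {U : Opens X} (P : ∀ (V : Opens X), V ≤ U → Sec (pre F) V → Prop)
    (hex : ∀ p ∈ U, ∃ (V : Opens X) (hV : V ≤ U), p ∈ V ∧ ∃ s, P V hV s)
    (hP : ∀ (V : Opens X) (hV : V ≤ U) (V' : Opens X) (hV' : V' ≤ U) s s', P V hV s → P V' hV' s' →
      res (pre F) inf_le_left s = res (pre F) (inf_le_right : V ⊓ V' ≤ V') s') :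
    ∃ t : Sec (pre F) U, ∀ V hV s, P V hV s → res (pre F) hV t = s := by
  let ι := {i : (V : Opens X) × Sec (pre F) V // ∃ h : i.1 ≤ U, P i.1 h i.2}
  obtain ⟨t, ht, -⟩ := TopCat.Sheaf.existsUnique_gluing' (C := Ab.{u})
    ⟨F.val.presheaf, F.isSheaf⟩ (fun i : ι => i.1.1) U (fun i => homOfLE i.2.1)
    (fun p hp => by
      obtain ⟨V, hV, hpV, s, hs⟩ := hex p hp
      rw [Opens.mem_iSup]
      exact ⟨⟨⟨V, s⟩, hV, hs⟩, hpV⟩) (fun i => i.1.2)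
    (fun i j => hP _ i.2.1 _ j.2.1 _ _ i.2.2 j.2.2)
  exact ⟨t, fun V hV s hs => ht ⟨⟨V, s⟩, hV, hs⟩⟩

end Gluing

end AlgebraicGeometry.LocallyRingedSpace

namespace PresheafOfModules

variable {C : Type u} [SmallCategory.{u} C] {R : Cᵒᵖ ⥤ CommRingCat.{u}}
  (M : PresheafOfModules.{u} (R ⋙ forget₂ CommRingCat RingCat))

/-- Exterior products of sections. -/
def wedge (q : ℕ) (U : Cᵒᵖ) : M.obj U [⋀^Fin q]→ₗ[R.obj U] (exteriorPower M q).obj U :=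
  exteriorPower.ιMulti (R.obj U) q (M := M.obj U)

lemma restrict_wedge (q : ℕ) {U V : Cᵒᵖ} (f : U ⟶ V) (x : Fin q → M.obj U) :
    (exteriorPower M q).restrictₛₗ f (wedge M q U x) =
      wedge M q V (fun i => M.restrictₛₗ f (x i)) :=
  semilinearExteriorPower_ιMulti (φ := (R.map f).hom) q (M.restrictₛₗ f) x

/-- The basis of the exterior power given by a basis. -/
def exteriorPowerBasis {ι : Type*} [LinearOrder ι] (q : ℕ) (U : Cᵒᵖ)
    (b : Module.Basis ι (R.obj U) (M.obj U)) :
    Module.Basis (Set.powersetCard ι q) (R.obj U) ((exteriorPower M q).obj U) :=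
  b.exteriorPower q

lemma exteriorPowerBasis_apply {ι : Type*} [LinearOrder ι] (q : ℕ) (U : Cᵒᵖ)
    (b : Module.Basis ι (R.obj U) (M.obj U)) (s : Set.powersetCard ι q) :
    exteriorPowerBasis M q U b s = wedge M q U (b ∘ Set.powersetCard.ofFinEmbEquiv.symm s) :=
  exteriorPower.basis_apply _ _ _ _

end PresheafOfModules

/-! ### Local bases: sheafification, duals and exterior powers -/

namespace AlgebraicGeometry.LocallyRingedSpace

variable {X Y : LocallyRingedSpace.{u}}

section Sheafification

variable (P : PreModules X)

/-- The map from a presheaf of modules to its sheafification. -/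
def unitSh : P ⟶ pre ((moduleSheafification X).obj P) :=
  (PresheafOfModules.sheafificationAdjunction (𝟙 (ringCatSheaf X).obj)).unit.app P

variable {P}

lemma exists_appSec_unitSh_eq {U : Opens X} (s : Sec (pre ((moduleSheafification X).obj P)) U)
    (p : X) (hp : p ∈ U) : ∃ (V : Opens X) (hV : V ≤ U), p ∈ V ∧ ∃ t : Sec P V,
      appSec (unitSh P) V t = res _ hV s := by
  have h := Presheaf.imageSieve_mem (Opens.grothendieckTopology X)
    (CategoryTheory.toSheafify (Opens.grothendieckTopology X) P.presheaf) (U := op U) s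
  obtain ⟨V, f, ⟨t, ht⟩, hpV⟩ := h p hp
  exact ⟨V, f.le, hpV, t, ht⟩

lemma exists_res_eq_of_appSec_unitSh_eq {U : Opens X} (x y : Sec P U)
    (h : appSec (unitSh P) U x = appSec (unitSh P) U y) (p : X) (hp : p ∈ U) :
    ∃ (V : Opens X) (hV : V ≤ U), p ∈ V ∧ res P hV x = res P hV y := by
  have h := Presheaf.equalizerSieve_mem (Opens.grothendieckTopology X)
    (CategoryTheory.toSheafify (Opens.grothendieckTopology X) P.presheaf) (X := op U) x y h
  obtain ⟨V, f, hf, hpV⟩ := h p hp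
  exact ⟨V, f.le, hpV, hf⟩

end Sheafification

section Functions

lemma eq_of_locally_eq_fun {U : Opens X} (a b : Fun U)
    (h : ∀ p ∈ U, ∃ (V : Opens X) (hV : V ≤ U), p ∈ V ∧ resFun hV a = resFun hV b) : a = b :=
  eq_of_locally_eq (structureModule X) (U := U) a b h

lemma exists_glue_fun {U : Opens X} (P : ∀ (V : Opens X), V ≤ U → Fun V → Prop)
    (hex : ∀ p ∈ U, ∃ (V : Opens X) (hV : V ≤ U), p ∈ V ∧ ∃ s, P V hV s)
    (hP : ∀ (V : Opens X) (hV : V ≤ U) (V' : Opens X) (hV' : V' ≤ U) s s', P V hV s → P V' hV' s' →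
      resFun inf_le_left s = resFun (inf_le_right : V ⊓ V' ≤ V') s') :
    ∃ t : Fun U, ∀ V hV s, P V hV s → resFun hV t = s :=
  exists_glue (structureModule X) (U := U) P hex hP

end Functions

section Basis

variable {ι : Type}

/-- The sections `e i` over `U` restrict to a basis over every open subset of `U`. -/
def IsBasisOn (M : PreModules X) (U : Opens X) (e : ι → Sec M U) : Prop :=
  ∀ (V : Opens X) (h : V ≤ U), LinearIndependent (Fun V) (fun i => res M h (e i)) ∧
    ⊤ ≤ Submodule.span (Fun V) (Set.range (fun i => res M h (e i)))

namespace IsBasisOn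

variable {M : PreModules X} {U V : Opens X} {e : ι → Sec M U}

/-- The basis over an open subset. -/
def basis (he : IsBasisOn M U e) (h : V ≤ U) : Module.Basis ι (Fun V) (Sec M V) :=
  Module.Basis.mk (he V h).1 (he V h).2

lemma basis_apply (he : IsBasisOn M U e) (h : V ≤ U) (i : ι) : he.basis h i = res M h (e i) :=
  Module.Basis.mk_apply _ _ i

lemma restrict (he : IsBasisOn M U e) (h : V ≤ U) : IsBasisOn M V (fun i => res M h (e i)) := by
  intro W hW
  simpa only [res_res] using he W (hW.trans h)

lemma ext_basis (he : IsBasisOn M U e) {N : Type u} [AddCommGroup N] [Module (Fun V) N] (h : V ≤ U)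
    {f g : Sec M V →ₗ[Fun V] N} (hfg : ∀ i, f (res M h (e i)) = g (res M h (e i))) : f = g :=
  (he.basis h).ext fun i => by rw [basis_apply, hfg]

variable [Fintype ι]

lemma basis_repr_res (he : IsBasisOn M U e) {W : Opens X} (h : V ≤ U) (h' : W ≤ V)
    (s : Sec M V) (i : ι) :
    (he.basis (h'.trans h)).repr (res M h' s) i = resFun h' ((he.basis h).repr s i) := by
  have hs : res M h' s = ∑ k, resFun h' ((he.basis h).repr s k) • he.basis (h'.trans h) k := by
    conv_lhs => rw [← (he.basis h).sum_repr s]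
    rw [map_sum]
    refine Finset.sum_congr rfl fun k _ => ?_
    rw [LinearMap.map_smulₛₗ, basis_apply, basis_apply, res_res]
  rw [hs, Module.Basis.repr_sum_self]

/-- Independence over every smaller open set makes the local coefficients of a section unique, hence
they agree on overlaps and glue to global coefficients. -/
lemma of_locally {F : Modules X} {e : ι → Sec (pre F) U}
    (hi : ∀ (V : Opens X) (h : V ≤ U), LinearIndependent (Fun V) (fun i => res (pre F) h (e i)))
    (hs : ∀ (V : Opens X) (h : V ≤ U) (s : Sec (pre F) V), ∀ p ∈ V,
      ∃ (W : Opens X) (h' : W ≤ V), p ∈ W ∧ res (pre F) h' s ∈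
        Submodule.span (Fun W) (Set.range (fun i => res (pre F) (h'.trans h) (e i)))) :
    IsBasisOn (pre F) U e := by
  refine fun V h => ⟨hi V h, fun s _ => ?_⟩
  have hglue : ∀ i, ∃ a : Fun V, ∀ (W : Opens X) (h' : W ≤ V) (b : Fun W),
      (∃ c : ι → Fun W, ∑ k, c k • res (pre F) (h'.trans h) (e k) = res (pre F) h' s ∧ c i = b) →
      resFun h' a = b := by
    intro i
    refine exists_glue_fun (fun W h' b => ∃ c : ι → Fun W,
      ∑ k, c k • res (pre F) (h'.trans h) (e k) = res (pre F) h' s ∧ c i = b)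
      (fun p hp => ?_) ?_
    · obtain ⟨W, h', hpW, hW⟩ := hs V h s p hp
      rw [Submodule.mem_span_range_iff_exists_fun] at hW
      obtain ⟨c, hc⟩ := hW
      exact ⟨W, h', hpW, c i, c, hc, rfl⟩
    · rintro W hW W' hW' _ _ ⟨c, hc, rfl⟩ ⟨c', hc', rfl⟩
      have hd : ∑ k, (resFun inf_le_left (c k) - resFun (inf_le_right : W ⊓ W' ≤ W') (c' k)) •
          res (pre F) (((inf_le_left : W ⊓ W' ≤ W).trans hW).trans h) (e k) = 0 := by
        simp only [sub_smul, Finset.sum_sub_distrib, sub_eq_zero]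
        have h1 := congrArg (res (pre F) (inf_le_left : W ⊓ W' ≤ W)) hc
        have h2 := congrArg (res (pre F) (inf_le_right : W ⊓ W' ≤ W')) hc'
        simp only [map_sum, LinearMap.map_smulₛₗ, res_res] at h1 h2
        exact h1.trans h2.symm
      exact sub_eq_zero.1 (Fintype.linearIndependent_iff.1 (hi _ _) _ hd i)
  choose a ha using hglue
  have hsum : s = ∑ i, a i • res (pre F) h (e i) := by
    refine eq_of_locally_eq F _ _ fun p hp => ?_
    obtain ⟨W, h', hpW, hW⟩ := hs V h s p hp
    rw [Submodule.mem_span_range_iff_exists_fun] at hW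
    obtain ⟨c, hc⟩ := hW
    refine ⟨W, h', hpW, ?_⟩
    simp only [map_sum, LinearMap.map_smulₛₗ, res_res]
    rw [← hc]
    exact Finset.sum_congr rfl fun i _ => by rw [ha i W h' _ ⟨c, hc, rfl⟩]
  rw [hsum]
  exact Submodule.sum_mem _ fun i _ => Submodule.smul_mem _ _ (Submodule.subset_span ⟨i, rfl⟩)

/-- The unit is locally injective, which gives independence since equality of functions is local,
and locally surjective, which gives local spanning. -/
lemma sheafification {P : PreModules X} {e : ι → Sec P U} (he : IsBasisOn P U e) :
    IsBasisOn (pre ((moduleSheafification X).obj P)) U (fun i => appSec (unitSh P) U (e i)) := by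
  refine of_locally (fun V h => ?_) fun V h s p hp => ?_
  · rw [Fintype.linearIndependent_iff]
    intro a ha i
    refine eq_of_locally_eq_fun _ _ fun p hp => ?_
    simp only [res_appSec, ← map_smul, ← map_sum] at ha
    obtain ⟨W, hW, hpW, h0⟩ := exists_res_eq_of_appSec_unitSh_eq _ 0 (ha.trans (map_zero _).symm)
      p hp
    refine ⟨W, hW, hpW, ?_⟩
    simp only [map_sum, LinearMap.map_smulₛₗ, res_res, map_zero] at h0 ⊢
    exact Fintype.linearIndependent_iff.1 (he W (hW.trans h)).1 _ h0 i
  · obtain ⟨W, hW, hpW, t, ht⟩ := exists_appSec_unitSh_eq s p hp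
    refine ⟨W, hW, hpW, ?_⟩
    rw [← ht]
    have h1 : t ∈ Submodule.span (Fun W) (Set.range (fun i => res P (hW.trans h) (e i))) :=
      (he W (hW.trans h)).2 trivial
    have h2 := Submodule.mem_map_of_mem (f := appSec (unitSh P) W) h1
    rw [Submodule.map_span, ← Set.range_comp] at h2
    simp only [res_appSec]
    exact h2

end IsBasisOn

section Dual

/-- A section of the dual evaluated on a section over a smaller open subset. -/
def evalDual {P : PreModules X} {U V : Opens X} (φ : Sec (PresheafOfModules.dual P) U) (h : V ≤ U) :
    Sec P V →ₗ[Fun V] Fun V :=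
  PresheafOfModules.DualFamily.app (M := P) (Subtype.val (p := fun x => x ∈
    PresheafOfModules.dualSections P (op U)) φ) (homOfLE h).op

variable {P : PreModules X} {U V W : Opens X}

lemma evalDual_add (φ ψ : Sec (PresheafOfModules.dual P) U) (h : V ≤ U) (x : Sec P V) :
    evalDual (φ + ψ) h x = evalDual φ h x + evalDual ψ h x := rfl

lemma evalDual_smul (a : Fun U) (φ : Sec (PresheafOfModules.dual P) U) (h : V ≤ U) (x : Sec P V) :
    evalDual (a • φ) h x = resFun h a * evalDual φ h x := rfl

lemma evalDual_zero (h : V ≤ U) (x : Sec P V) :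
    evalDual (0 : Sec (PresheafOfModules.dual P) U) h x = 0 := rfl

lemma evalDual_sum {ι : Type*} (s : Finset ι) (φ : ι → Sec (PresheafOfModules.dual P) U) (h : V ≤ U)
    (x : Sec P V) : evalDual (∑ i ∈ s, φ i) h x = ∑ i ∈ s, evalDual (φ i) h x := by
  classical
  induction s using Finset.induction_on with
  | empty => rfl
  | insert a s ha ih => rw [Finset.sum_insert ha, Finset.sum_insert ha, evalDual_add, ih]

lemma evalDual_res (φ : Sec (PresheafOfModules.dual P) U) (h : V ≤ U) (h' : W ≤ V) :
    evalDual (res _ h φ) h' = evalDual φ (h'.trans h) := rfl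

lemma resFun_evalDual (φ : Sec (PresheafOfModules.dual P) U) (h : V ≤ U) (h' : W ≤ V) (x : Sec P V) :
    resFun h' (evalDual φ h x) = evalDual φ (h'.trans h) (res P h' x) :=
  (φ.2 (op V) (op W) (homOfLE h).op (homOfLE h').op x).symm

lemma evalDual_ext {φ ψ : Sec (PresheafOfModules.dual P) U}
    (h : ∀ (V : Opens X) (h : V ≤ U) (x : Sec P V), evalDual φ h x = evalDual ψ h x) : φ = ψ :=
  Subtype.ext (PresheafOfModules.DualFamily.ext fun V i x => h V.unop i.unop.le x)

lemma exists_dual (l : ∀ (V : Opens X), V ≤ U → Sec P V →ₗ[Fun V] Fun V)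
    (hl : ∀ (V : Opens X) (h : V ≤ U) (W : Opens X) (h' : W ≤ V) (x : Sec P V),
      l W (h'.trans h) (res P h' x) = resFun h' (l V h x)) :
    ∃ φ : Sec (PresheafOfModules.dual P) U, ∀ (V : Opens X) (h : V ≤ U), evalDual φ h = l V h :=
  ⟨⟨fun V i => l V.unop i.unop.le, fun V W i g x => hl V.unop i.unop.le W.unop g.unop.le x⟩,
    fun _ _ => rfl⟩

variable [Fintype ι]

/-- The dual basis consists of the coordinate functions. They commute with restriction because the
restricted family is again a basis, so they are sections of the presheaf dual. -/
lemma IsBasisOn.exists_dual [DecidableEq ι] {e : ι → Sec P U} (he : IsBasisOn P U e) :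
    ∃ d : ι → Sec (PresheafOfModules.dual P) U, IsBasisOn (PresheafOfModules.dual P) U d ∧
      ∀ (V : Opens X) (h : V ≤ U) i k, evalDual (d i) h (res P h (e k)) = if k = i then 1 else 0 := by
  have h1 : ∀ i, ∃ φ : Sec (PresheafOfModules.dual P) U, ∀ (V : Opens X) (h : V ≤ U),
      evalDual φ h = (he.basis h).coord i := fun i =>
    LocallyRingedSpace.exists_dual (fun V h => (he.basis h).coord i) fun V h W h' x =>
      he.basis_repr_res h h' x i
  choose d hd using h1
  have h2 : ∀ (V : Opens X) (h : V ≤ U) i k,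
      evalDual (d i) h (res P h (e k)) = if k = i then 1 else 0 := by
    intro V h i k
    rw [hd, ← he.basis_apply h, Module.Basis.coord_apply, Module.Basis.repr_self,
      Finsupp.single_apply]
  refine ⟨d, fun V h => ⟨?_, fun φ _ => ?_⟩, h2⟩
  · rw [Fintype.linearIndependent_iff]
    intro a ha i
    have := congrArg (fun φ => evalDual φ le_rfl (res P h (e i))) ha
    simpa [evalDual_sum, evalDual_smul, evalDual_res, h2, evalDual_zero] using this
  · have : φ = ∑ i, evalDual φ le_rfl (res P h (e i)) • res _ h (d i) := by
      refine evalDual_ext fun W h' x => ?_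
      refine LinearMap.congr_fun (f := evalDual φ h') (g := evalDual _ h') ?_ x
      refine he.ext_basis (h'.trans h) fun k => ?_
      rw [evalDual_sum]
      simp [evalDual_smul, evalDual_res, h2, resFun_evalDual]
    rw [this]
    exact Submodule.sum_mem _ fun i _ => Submodule.smul_mem _ _ (Submodule.subset_span ⟨i, rfl⟩)

end Dual

section ExteriorPower

/-- Exterior products of sections. -/
def wedge (P : PreModules X) (q : ℕ) (U : Opens X) :
    Sec P U [⋀^Fin q]→ₗ[Fun U] Sec (PresheafOfModules.exteriorPower P q) U :=
  PresheafOfModules.wedge P q (op U)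

lemma res_wedge {P : PreModules X} {q : ℕ} {U V : Opens X} (h : V ≤ U) (x : Fin q → Sec P U) :
    res _ h (wedge P q U x) = wedge P q V (fun i => res P h (x i)) :=
  PresheafOfModules.restrict_wedge P q (homOfLE h).op x

/-- The exterior products of `q` distinct elements of a family, in increasing order. -/
def wedgeFamily [LinearOrder ι] {P : PreModules X} {U : Opens X} (q : ℕ) (e : ι → Sec P U)
    (s : Set.powersetCard ι q) : Sec (PresheafOfModules.exteriorPower P q) U :=
  wedge P q U (fun i => e (Set.powersetCard.ofFinEmbEquiv.symm s i))

lemma IsBasisOn.wedgeFamily [LinearOrder ι] {P : PreModules X} {U : Opens X} {e : ι → Sec P U}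
    (he : IsBasisOn P U e) (q : ℕ) :
    IsBasisOn (PresheafOfModules.exteriorPower P q) U (wedgeFamily q e) := by
  intro V h
  let b : Module.Basis (Set.powersetCard ι q) (Fun V) (Sec (PresheafOfModules.exteriorPower P q) V) :=
    PresheafOfModules.exteriorPowerBasis P q (op V) (he.basis h)
  have h1 : (fun i => res (PresheafOfModules.exteriorPower P q) h
      (LocallyRingedSpace.wedgeFamily q e i)) = b := by
    funext s
    refine (res_wedge h _).trans ?_
    refine Eq.trans ?_ (PresheafOfModules.exteriorPowerBasis_apply P q (op V) (he.basis h) s).symm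
    exact congrArg (wedge P q V) (funext fun i => (he.basis_apply h _).symm)
  rw [h1]
  exact ⟨b.linearIndependent, b.span_eq.ge⟩

end ExteriorPower

end Basis

end AlgebraicGeometry.LocallyRingedSpace

/-! ### Direct and inverse images, and restriction to an open subset -/

namespace AlgebraicGeometry.LocallyRingedSpace

variable {X Y : LocallyRingedSpace.{u}}

/-- A family of linear maps commuting with restrictions is a morphism of presheaves of modules. -/
def homOfSec {M N : PreModules X} (φ : ∀ U : Opens X, Sec M U →ₗ[Fun U] Sec N U)
    (hφ : ∀ (U V : Opens X) (h : V ≤ U) (x : Sec M U), φ V (res M h x) = res N h (φ U x)) :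
    M ⟶ N where
  app U := ModuleCat.ofHom (φ U.unop)
  naturality f := by
    ext x
    exact hφ _ _ f.unop.le x

/-- The underlying morphism of presheaves of modules. -/
abbrev preMap {F G : Modules X} (φ : F ⟶ G) : pre F ⟶ pre G := φ.val

section Direct

variable (f : X ⟶ Y)

/-- The inverse image of an open subset. -/
abbrev preim (U : Opens Y) : Opens X := (Opens.map (Hom.continuousMap f)).obj U

lemma preim_mono {U V : Opens Y} (h : V ≤ U) : preim f V ≤ preim f U := fun _ hx => h hx

/-- Composition of functions with a morphism. -/
def comor (U : Opens Y) : Fun U →+* Fun (preim f U) :=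
  ((Hom.toRingCatSheafHom f).hom.app (op U)).hom

lemma resFun_comor {U V : Opens Y} (h : V ≤ U) (a : Fun U) :
    resFun (preim_mono f h) (comor f U a) = comor f V (resFun h a) :=
  (ConcreteCategory.congr_hom ((Hom.toRingCatSheafHom f).hom.naturality (homOfLE h).op) a).symm

/-- Sections of a direct image. -/
def pushSec (M : Modules X) (U : Opens Y) :
    Sec (pre ((modulePushforward f).obj M)) U ≃+ Sec (pre M) (preim f U) := AddEquiv.refl _

end Direct

section Inverse

variable (f : X ⟶ Y) (E : Modules Y)

/-- The unit of the adjunction between inverse and direct image. -/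
def pullUnit : E ⟶ (modulePushforward f).obj ((modulePullback f).obj E) :=
  (SheafOfModules.pullbackPushforwardAdjunction (Hom.toRingCatSheafHom f)).unit.app E

/-- The inverse image of a section. -/
def pullSec (U : Opens Y) :
    Sec (pre E) U →ₛₗ[comor f U] Sec (pre ((modulePullback f).obj E)) (preim f U) where
  toFun x := appSec (preMap (pullUnit f E)) U x
  map_add' x y := map_add (appSec (preMap (pullUnit f E)) U) x y
  map_smul' a x := map_smul (appSec (preMap (pullUnit f E)) U) a x

lemma res_pullSec {U V : Opens Y} (h : V ≤ U) (x : Sec (pre E) U) :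
    res _ (preim_mono f h) (pullSec f E U x) = pullSec f E V (res _ h x) :=
  res_appSec (preMap (pullUnit f E)) h x

variable {E} {G : Modules X}

/-- The adjunction in terms of sections. Together with `pullback_hom_ext` it replaces any explicit
description of the sections of an inverse image. -/
lemma exists_appSec_pullSec (φ : E ⟶ (modulePushforward f).obj G) :
    ∃ ψ : (modulePullback f).obj E ⟶ G, ∀ (U : Opens Y) (x : Sec (pre E) U),
      appSec (preMap ψ) (preim f U) (pullSec f E U x) = pushSec f G U (appSec (preMap φ) U x) := by
  let adj := SheafOfModules.pullbackPushforwardAdjunction (Hom.toRingCatSheafHom f)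
  refine ⟨(adj.homEquiv E G).symm φ, fun U x => ?_⟩
  have h : φ = adj.unit.app E ≫ (modulePushforward f).map ((adj.homEquiv E G).symm φ) := 
    ((adj.homEquiv E G).apply_symm_apply φ).symm.trans (adj.homEquiv_unit _ _ _)
  conv_rhs => rw [h]
  rfl

lemma pullback_hom_ext {ψ ψ' : (modulePullback f).obj E ⟶ G}
    (h : ∀ (U : Opens Y) (x : Sec (pre E) U), appSec (preMap ψ) (preim f U) (pullSec f E U x) =
      appSec (preMap ψ') (preim f U) (pullSec f E U x)) : ψ = ψ' := by
  let adj := SheafOfModules.pullbackPushforwardAdjunction (Hom.toRingCatSheafHom f)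
  refine (adj.homEquiv E G).injective ?_
  refine (adj.homEquiv_unit _ _ _).trans (Eq.trans ?_ (adj.homEquiv_unit _ _ _).symm)
  apply SheafOfModules.hom_ext
  ext U x
  exact h U.unop x

end Inverse

section Cap

variable (U' : Opens X)

/-- Intersection with an open subset. -/
def capFunctor : Opens X ⥤ Opens X :=
  (show Monotone (fun W : Opens X => W ⊓ U') from fun _ _ h => inf_le_inf_right _ h).functor

/-- Intersecting with U' sends coverings to coverings and respects overlaps, so precomposition
preserves sheaves. It yields a sheaf on all of X that only sees U': a morphism defined over U' alone
becomes a global morphism into it, to which the adjunction applies. -/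
instance : (capFunctor U').IsContinuous (Opens.grothendieckTopology X)
    (Opens.grothendieckTopology X) := by
  apply Functor.isContinuous_of_coverPreserving
  · constructor
    intro ℱ Z T x hx Y₁ Y₂ W f₁ f₂ g₁ g₂ hg₁ hg₂ _
    have h := hx (Z := Y₁ ⊓ Y₂) (homOfLE inf_le_left) (homOfLE inf_le_right) hg₁ hg₂ rfl
    let k : W ⟶ (capFunctor U').obj (Y₁ ⊓ Y₂) :=
      homOfLE (le_inf (le_inf (f₁.le.trans inf_le_left) (f₂.le.trans inf_le_left))
        (f₁.le.trans inf_le_right))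
    have h' := congrArg (ℱ.obj.map k.op) h
    simp only [Functor.comp_map, ← Functor.map_comp_apply] at h'
    exact h'
  · constructor
    intro U S hS p hp
    obtain ⟨V, i, hi, hpV⟩ := hS p hp.1
    exact ⟨V ⊓ U', (capFunctor U').map i, ⟨V, i, 𝟙 _, hi, rfl⟩, hpV, hp.2⟩

/-- Restriction of functions as a morphism of sheaves of rings. -/
def capHom : ringCatSheaf X ⟶
    ((capFunctor U').sheafPushforwardContinuous _ _ _).obj (ringCatSheaf X) where
  hom :=
    { app := fun W => (ringCatSheaf X).obj.map (homOfLE (inf_le_left : W.unop ⊓ U' ≤ W.unop)).op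
      naturality := fun V W i => by
        refine ((ringCatSheaf X).obj.map_comp _ _).symm.trans ?_
        exact (ringCatSheaf X).obj.map_comp
          (homOfLE (inf_le_left : V.unop ⊓ U' ≤ V.unop)).op ((capFunctor U').op.map i) }

/-- The sheaf `W ↦ G(W ∩ U')`, the direct image of the restriction of `G` to `U'`. -/
def cap : Modules X ⥤ Modules X := SheafOfModules.pushforward (capHom U')

variable {U'}

/-- Sections of the direct image of the restriction to an open subset. -/
def capSec (G : Modules X) (W : Opens X) :
    Sec (pre ((cap U').obj G)) W ≃+ Sec (pre G) (W ⊓ U') := AddEquiv.refl _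

lemma capSec_smul (G : Modules X) {W : Opens X} (a : Fun W) (x : Sec (pre ((cap U').obj G)) W) :
    capSec G W (a • x) = resFun (inf_le_left : W ⊓ U' ≤ W) a • capSec G W x := rfl

lemma capSec_res (G : Modules X) {V W : Opens X} (h : V ≤ W) (x : Sec (pre ((cap U').obj G)) W) :
    capSec G V (res _ h x) = res (pre G) (inf_le_inf_right U' h) (capSec G W x) := rfl

end Cap

end AlgebraicGeometry.LocallyRingedSpace

namespace AlgebraicGeometry.LocallyRingedSpace

variable {X Y : LocallyRingedSpace.{u}}

/-- A morphism of sheaves of modules given by linear maps commuting with restrictions. -/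
def homOfSec' {M N : Modules X} (φ : ∀ U : Opens X, Sec (pre M) U →ₗ[Fun U] Sec (pre N) U)
    (hφ : ∀ (U V : Opens X) (h : V ≤ U) (x : Sec (pre M) U),
      φ V (res (pre M) h x) = res (pre N) h (φ U x)) : M ⟶ N where
  val := homOfSec φ hφ

/-- Sections of the structure sheaf are functions. -/
def funSec (U : Opens X) : Sec (pre (structureModule X)) U ≃ₗ[Fun U] Fun U := LinearEquiv.refl _ _

lemma funSec_res {U V : Opens X} (h : V ≤ U) (x : Sec (pre (structureModule X)) U) :
    funSec V (res _ h x) = resFun h (funSec U x) := rfl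

/-- Restriction to an open subset as a morphism of sheaves of modules. -/
def capUnit (U' : Opens X) (G : Modules X) : G ⟶ (cap U').obj G :=
  homOfSec' (fun W =>
    { toFun := fun x => (capSec G W).symm (res (pre G) inf_le_left x)
      map_add' := fun x y => map_add (res (pre G) inf_le_left) x y
      map_smul' := fun a x => (res (pre G) inf_le_left).map_smulₛₗ a x })
    fun W V h x => (capSec G V).injective (by
      rw [capSec_res]
      change res (pre G) _ (res (pre G) _ x) = res (pre G) _ (res (pre G) _ x)
      rw [res_res, res_res])

lemma capSec_capUnit (U' : Opens X) (G : Modules X) (W : Opens X) (x : Sec (pre G) W) :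
    capSec G W (appSec (preMap (capUnit U' G)) W x) = res (pre G) inf_le_left x := rfl

/-- Multiplication of functions with a section over an open subset. -/
def capMul {U' : Opens X} {G : Modules X} (m : Sec (pre G) U') :
    (cap U').obj (structureModule X) ⟶ (cap U').obj G :=
  homOfSec' (fun W =>
    { toFun := fun a => (capSec G W).symm
        (funSec _ (capSec (structureModule X) W a) • res (pre G) inf_le_right m)
      map_add' := fun a b => (capSec G W).injective (add_smul (funSec _ (capSec _ W a)) _ _)
      map_smul' := fun r a => (capSec G W).injective (mul_smul (resFun inf_le_left r)
        (funSec _ (capSec _ W a)) _) })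
    fun W V h a => (capSec G V).injective (by
      rw [capSec_res]
      refine Eq.trans ?_ ((res (pre G) (inf_le_inf_right U' h)).map_smulₛₗ
        (funSec _ (capSec _ W a)) (res (pre G) inf_le_right m)).symm
      rw [res_res]
      rfl)

lemma capSec_capMul {U' : Opens X} {G : Modules X} (m : Sec (pre G) U') (W : Opens X)
    (a : Sec (pre ((cap U').obj (structureModule X))) W) :
    capSec G W (appSec (preMap (capMul m)) W a) =
      funSec _ (capSec _ W a) • res (pre G) inf_le_right m := rfl

/-! ### Bases of inverse images -/

section Pullback

variable (f : X ⟶ Y) {E : Modules Y} {U : Opens Y} {ι : Type} [Fintype ι]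

/-- The sections `e i` over `U` generate `E` locally, and their relations vanish on `X`. -/
structure IsPullbackBasis (e : ι → Sec (pre E) U) : Prop where
  exists_span : ∀ (V : Opens Y) (h : V ≤ U) (s : Sec (pre E) V), ∀ p ∈ V,
    ∃ (W : Opens Y) (h' : W ≤ V), p ∈ W ∧ ∃ a : ι → Fun W,
      ∑ i, a i • res (pre E) (h'.trans h) (e i) = res (pre E) h' s
  comor_eq_zero : ∀ (V : Opens Y) (h : V ≤ U) (a : ι → Fun V),
    ∑ i, a i • res (pre E) h (e i) = 0 → ∀ i, comor f V (a i) = 0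

variable {f} {e : ι → Sec (pre E) U} (he : IsPullbackBasis f e)

include he

/-- Two local choices of coefficients differ by a relation among the e i, and relations vanish on X.
-/
lemma IsPullbackBasis.comor_eq {V W W' : Opens Y} (h : V ≤ U) (hW : W ≤ V) (hW' : W' ≤ V)
    (s : Sec (pre E) V) (a : ι → Fun W) (a' : ι → Fun W')
    (ha : ∑ i, a i • res (pre E) (hW.trans h) (e i) = res (pre E) hW s)
    (ha' : ∑ i, a' i • res (pre E) (hW'.trans h) (e i) = res (pre E) hW' s) (i : ι) :
    resFun (preim_mono f (inf_le_left : W ⊓ W' ≤ W)) (comor f W (a i)) =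
      resFun (preim_mono f (inf_le_right : W ⊓ W' ≤ W')) (comor f W' (a' i)) := by
  rw [resFun_comor _ inf_le_left, resFun_comor _ inf_le_right, ← sub_eq_zero, ← map_sub]
  refine he.comor_eq_zero (W ⊓ W') ((inf_le_left.trans hW).trans h) (fun i =>
    resFun (inf_le_left : W ⊓ W' ≤ W) (a i) - resFun (inf_le_right : W ⊓ W' ≤ W') (a' i)) ?_ i
  simp only [sub_smul, Finset.sum_sub_distrib, sub_eq_zero]
  have h1 := congrArg (res (pre E) (inf_le_left : W ⊓ W' ≤ W)) ha
  have h2 := congrArg (res (pre E) (inf_le_right : W ⊓ W' ≤ W')) ha'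
  simp only [map_sum, LinearMap.map_smulₛₗ, res_res] at h1 h2
  exact h1.trans h2.symm

lemma IsPullbackBasis.exists_coord {V : Opens Y} (h : V ≤ U) (s : Sec (pre E) V) (i : ι) :
    ∃ b : Fun (preim f V), ∀ (W : Opens Y) (hW : W ≤ V) (a : ι → Fun W),
      ∑ i, a i • res (pre E) (hW.trans h) (e i) = res (pre E) hW s →
      resFun (preim_mono f hW) b = comor f W (a i) := by
  -- Coefficients exist over open sets of Y, whereas gluing takes place on X; hence the predicate
  -- ranges over the open sets of X that are preimages.
  let P : ∀ V' : Opens X, V' ≤ preim f V → Fun V' → Prop := fun V' _ b =>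
    ∃ (W : Opens Y) (hW : W ≤ V) (hV' : V' = preim f W) (a : ι → Fun W),
      ∑ i, a i • res (pre E) (hW.trans h) (e i) = res (pre E) hW s ∧
        b = resFun hV'.le (comor f W (a i))
  have h1 : ∃ b : Fun (preim f V), ∀ V' hV' c, P V' hV' c → resFun hV' b = c := by
    refine exists_glue_fun P (fun p hp => ?_) ?_
    · obtain ⟨W, hW, hpW, a, ha⟩ := he.exists_span V h s _ hp
      exact ⟨preim f W, preim_mono f hW, hpW, _, W, hW, rfl, a, ha, rfl⟩
    · rintro _ - _ - _ _ ⟨W, hW, rfl, a, ha, rfl⟩ ⟨W', hW', rfl, a', ha', rfl⟩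
      simp only [resFun_self]
      exact he.comor_eq h hW hW' s a a' ha ha' i
  obtain ⟨b, hb⟩ := h1
  exact ⟨b, fun W hW a ha => hb (preim f W) (preim_mono f hW) _
    ⟨W, hW, rfl, a, ha, (resFun_self _ _).symm⟩⟩

/-- The `i`-th coordinate of the inverse image of a section. -/
def IsPullbackBasis.coord {V : Opens Y} (h : V ≤ U) (s : Sec (pre E) V) (i : ι) :
    Fun (preim f V) := (he.exists_coord h s i).choose

lemma IsPullbackBasis.coord_spec {V : Opens Y} (h : V ≤ U) (s : Sec (pre E) V) (i : ι)
    (W : Opens Y) (hW : W ≤ V) (a : ι → Fun W)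
    (ha : ∑ i, a i • res (pre E) (hW.trans h) (e i) = res (pre E) hW s) :
    resFun (preim_mono f hW) (he.coord h s i) = comor f W (a i) :=
  (he.exists_coord h s i).choose_spec W hW a ha

lemma IsPullbackBasis.coord_eq {V : Opens Y} (h : V ≤ U) (s : Sec (pre E) V) (i : ι)
    (a : ι → Fun V) (ha : ∑ i, a i • res (pre E) h (e i) = s) :
    he.coord h s i = comor f V (a i) := by
  rw [← he.coord_spec h s i V le_rfl a (by rwa [res_self]), resFun_self]

lemma IsPullbackBasis.resFun_coord {V V' : Opens Y} (h : V ≤ U) (h' : V' ≤ V) (s : Sec (pre E) V)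
    (i : ι) : resFun (preim_mono f h') (he.coord h s i) =
      he.coord (h'.trans h) (res (pre E) h' s) i := by
  refine eq_of_locally_eq_fun _ _ fun p hp => ?_
  obtain ⟨W, hW, hpW, a, ha⟩ := he.exists_span V' (h'.trans h) (res (pre E) h' s) _ hp
  refine ⟨preim f W, preim_mono f hW, hpW, ?_⟩
  rw [resFun_resFun, he.coord_spec _ _ i W hW a ha,
    he.coord_spec h s i W (hW.trans h') a (by rw [ha, res_res])]

lemma IsPullbackBasis.coord_add {V : Opens Y} (h : V ≤ U) (s t : Sec (pre E) V) (i : ι) :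
    he.coord h (s + t) i = he.coord h s i + he.coord h t i := by
  refine eq_of_locally_eq_fun _ _ fun p hp => ?_
  obtain ⟨W, hW, hpW, a, ha⟩ := he.exists_span V h s _ hp
  obtain ⟨W', hW', hpW', a', ha'⟩ := he.exists_span W (hW.trans h) (res (pre E) hW t) _ hpW
  refine ⟨preim f W', preim_mono f (hW'.trans hW), hpW', ?_⟩
  rw [map_add, he.resFun_coord h (hW'.trans hW), he.resFun_coord h (hW'.trans hW),
    he.resFun_coord h (hW'.trans hW)]
  rw [res_res] at ha'
  have ha2 := congrArg (res (pre E) hW') ha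
  simp only [map_sum, LinearMap.map_smulₛₗ, res_res] at ha2
  rw [he.coord_eq _ _ i _ ha', he.coord_eq _ _ i _ ha2, he.coord_eq _ _ i
    (fun i => resFun hW' (a i) + a' i), map_add]
  simp only [add_smul, Finset.sum_add_distrib, ha2, ha', map_add]

lemma IsPullbackBasis.coord_smul {V : Opens Y} (h : V ≤ U) (r : Fun V) (s : Sec (pre E) V) (i : ι) :
    he.coord h (r • s) i = comor f V r * he.coord h s i := by
  refine eq_of_locally_eq_fun _ _ fun p hp => ?_
  obtain ⟨W, hW, hpW, a, ha⟩ := he.exists_span V h s _ hp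
  refine ⟨preim f W, preim_mono f hW, hpW, ?_⟩
  rw [map_mul, he.resFun_coord h hW, he.resFun_coord h hW, he.coord_eq _ _ i _ ha, resFun_comor f hW,
    he.coord_eq _ _ i (fun i => resFun hW r * a i), map_mul]
  simp only [mul_smul, ← Finset.smul_sum, ha, LinearMap.map_smulₛₗ]

/-- The coordinates as a morphism of sheaves of modules. -/
def IsPullbackBasis.coordHom (i : ι) :
    E ⟶ (modulePushforward f).obj ((cap (preim f U)).obj (structureModule X)) :=
  homOfSec' (fun W =>
    { toFun := fun x => (pushSec f _ W).symm ((capSec (U' := preim f U) (structureModule X) _).symm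
        ((funSec (preim f (W ⊓ U))).symm (he.coord inf_le_right (res (pre E) inf_le_left x) i)))
      map_add' := fun x y => by
        rw [map_add, he.coord_add]
        rfl
      map_smul' := fun a x => by
        rw [LinearMap.map_smulₛₗ, he.coord_smul, ← resFun_comor f inf_le_left]
        rfl })
    fun W V h x => by
      refine (pushSec f _ V).injective ((capSec (U' := preim f U) (structureModule X) _).injective
        ?_)
      change he.coord inf_le_right (res (pre E) inf_le_left (res (pre E) h x)) i =
        resFun (preim_mono f (inf_le_inf_right U h))
          (he.coord inf_le_right (res (pre E) inf_le_left x) i)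
      rw [he.resFun_coord _ (inf_le_inf_right U h), res_res, res_res]

end Pullback

end AlgebraicGeometry.LocallyRingedSpace

/-! ### Kernels on sections, and the basis theorem for inverse images -/

namespace SheafOfModules

variable {C : Type u} [SmallCategory.{u} C] {J : GrothendieckTopology C} {R : Sheaf J RingCat.{u}}
  {M N : SheafOfModules.{u} R} (φ : M ⟶ N)

instance preservesZeroMorphisms_evaluation (U : Cᵒᵖ) :
    (evaluation.{u} R U).PreservesZeroMorphisms where
  map_zero _ _ := rfl

lemma kernel_ι_app_injective (U : Cᵒᵖ) : Function.Injective ((kernel.ι φ).val.app U) := by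
  have : Mono ((evaluation.{u} R U).map (kernel.ι φ)) := inferInstance
  exact (ModuleCat.mono_iff_injective _).1 this

lemma exists_kernel_ι_app_eq (U : Cᵒᵖ) (x : M.val.obj U) (hx : φ.val.app U x = 0) :
    ∃ y, (kernel.ι φ).val.app U y = x := by
  let G := evaluation.{u} R U
  have hl := isLimitForkMapOfIsLimit' G (kernel.condition φ) (kernelIsKernel φ)
  have := ShortComplex.exact_of_f_is_kernel (ShortComplex.mk (G.map (kernel.ι φ)) (G.map φ)
    (by rw [← G.map_comp, kernel.condition, G.map_zero])) hl
  rw [ShortComplex.moduleCat_exact_iff] at this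
  exact this x hx

end SheafOfModules

namespace AlgebraicGeometry.LocallyRingedSpace

variable {X Y : LocallyRingedSpace.{u}}

lemma appSec_preMap_comp {F G H : Modules X} (φ : F ⟶ G) (ψ : G ⟶ H) (U : Opens X)
    (x : Sec (pre F) U) :
    appSec (preMap (φ ≫ ψ)) U x = appSec (preMap ψ) U (appSec (preMap φ) U x) := rfl

lemma appSec_preMap_sum {ι : Type} [Fintype ι] {F G : Modules X} (φ : ι → (F ⟶ G)) (U : Opens X)
    (x : Sec (pre F) U) :
    appSec (preMap (∑ i, φ i)) U x = ∑ i, appSec (preMap (φ i)) U x := by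
  let l : (F ⟶ G) →+ Sec (pre G) U :=
    { toFun := fun φ => appSec (preMap φ) U x
      map_zero' := rfl
      map_add' := fun _ _ => rfl }
  exact map_sum l φ _

section Pullback

variable {f : X ⟶ Y} {E : Modules Y} {U : Opens Y} {ι : Type} [Fintype ι]
  {e : ι → Sec (pre E) U} (he : IsPullbackBasis f e)

include he

lemma IsPullbackBasis.pullSec_eq_sum {V : Opens Y} (h : V ≤ U) (s : Sec (pre E) V) :
    pullSec f E V s = ∑ i, he.coord h s i • res _ (preim_mono f h) (pullSec f E U (e i)) := by
  refine eq_of_locally_eq _ _ _ fun p hp => ?_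
  obtain ⟨W, hW, hpW, a, ha⟩ := he.exists_span V h s _ hp
  refine ⟨preim f W, preim_mono f hW, hpW, ?_⟩
  simp only [map_sum, LinearMap.map_smulₛₗ, res_res, he.coord_spec h s _ W hW a ha]
  rw [res_pullSec f E hW, ← ha]
  simp only [map_sum, LinearMap.map_smulₛₗ, res_pullSec f E (hW.trans h)]

lemma IsPullbackBasis.exists_coordinates (i : ι) :
    ∃ ψ : (modulePullback f).obj E ⟶ (cap (preim f U)).obj (structureModule X),
      ∀ (W : Opens Y) (x : Sec (pre E) W),
        funSec (preim f (W ⊓ U)) (capSec (U' := preim f U) (structureModule X) (preim f W)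
          (appSec (preMap ψ) (preim f W) (pullSec f E W x))) =
        he.coord inf_le_right (res (pre E) inf_le_left x) i := by
  obtain ⟨ψ, hψ⟩ := exists_appSec_pullSec f (he.coordHom i)
  refine ⟨ψ, fun W x => ?_⟩
  rw [hψ]
  rfl

/-- The coordinates of pulled-back sections extend by adjunction to morphisms on the whole inverse
image. The expansion of a section in the pulled-back e i is then an equality of two morphisms, which
only has to be checked on pulled-back sections. -/
lemma IsPullbackBasis.exists_linear_coordinates [DecidableEq ι] :
    ∃ c : ι → ∀ W : Opens X, W ≤ preim f U → (Sec (pre ((modulePullback f).obj E)) W →ₗ[Fun W] Fun W),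
      (∀ (W : Opens X) (h : W ≤ preim f U) i k,
        c i W h (res _ h (pullSec f E U (e k))) = if k = i then 1 else 0) ∧
      ∀ (W : Opens X) (h : W ≤ preim f U) (s : Sec (pre ((modulePullback f).obj E)) W),
        s = ∑ i, c i W h s • res _ h (pullSec f E U (e i)) := by
  choose ψ hψ using he.exists_coordinates
  -- Restriction to the preimage of U, decomposed into coordinate times basis section.
  have hsum : capUnit (preim f U) ((modulePullback f).obj E) =
      ∑ i, ψ i ≫ capMul (pullSec f E U (e i)) := by
    refine pullback_hom_ext f fun W x => ?_
    rw [appSec_preMap_sum]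
    refine (capSec (U' := preim f U) _ (preim f W)).injective ?_
    rw [map_sum, capSec_capUnit]
    simp only [appSec_preMap_comp, capSec_capMul]
    refine (res_pullSec f E (inf_le_left : W ⊓ U ≤ W) x).trans ?_
    refine (he.pullSec_eq_sum inf_le_right _).trans (Finset.sum_congr rfl fun i _ => ?_)
    rw [← hψ]
    rfl
  refine ⟨fun i W h =>
    { toFun := fun s => resFun (le_inf le_rfl h)
        (funSec _ (capSec (U' := preim f U) (structureModule X) W (appSec (preMap (ψ i)) W s)))
      map_add' := fun s t => by simp only [map_add]
      map_smul' := fun a s => by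
        rw [map_smul, capSec_smul, map_smul, smul_eq_mul, map_mul, resFun_resFun, resFun_self]
        rfl }, fun W h i k => ?_, fun W h s => ?_⟩
  · change resFun _ (funSec _ (capSec (U' := preim f U) (structureModule X) W
      (appSec (preMap (ψ i)) W (res _ h (pullSec f E U (e k)))))) = _
    have h1 : he.coord (inf_le_right : U ⊓ U ≤ U) (res (pre E) inf_le_left (e k)) i =
        comor f (U ⊓ U) (if k = i then 1 else 0) := by
      rw [he.coord_eq _ _ i (fun i => if k = i then 1 else 0) (by simp)]
    have h2 := congrArg (resFun (le_inf h h : W ≤ preim f (U ⊓ U))) ((hψ i U (e k)).trans h1)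
    rw [← res_appSec, capSec_res, funSec_res, resFun_resFun]
    refine h2.trans ?_
    split_ifs
    · exact (congrArg _ (map_one _)).trans (map_one _)
    · exact (congrArg _ (map_zero _)).trans (map_zero _)
  · have h1 := congrArg (fun φ => res (pre ((modulePullback f).obj E)) (le_inf le_rfl h)
      (capSec (U' := preim f U) _ W (appSec (preMap φ) W s))) hsum
    simp only [appSec_preMap_sum, capSec_capUnit, res_res, res_self, map_sum, appSec_preMap_comp,
      capSec_capMul, LinearMap.map_smulₛₗ] at h1
    exact h1

theorem IsPullbackBasis.isBasisOn [DecidableEq ι] :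
    IsBasisOn (pre ((modulePullback f).obj E)) (preim f U) (fun i => pullSec f E U (e i)) := by
  obtain ⟨c, hc, hs⟩ := he.exists_linear_coordinates
  refine fun W h => ⟨?_, fun s _ => ?_⟩
  · rw [Fintype.linearIndependent_iff]
    intro a ha i
    have := congrArg (c i W h) ha
    simpa [hc] using this
  · rw [hs W h s]
    exact Submodule.sum_mem _ fun i _ => Submodule.smul_mem _ _ (Submodule.subset_span ⟨i, rfl⟩)

end Pullback

/-! ### The ideal sheaf as functions vanishing on the subspace -/

section Ideal

variable (j : X ⟶ Y)

/-- The inclusion of the ideal sheaf on sections. -/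
def idealIncl (U : Opens Y) : Sec (pre (idealSheaf j)) U →ₗ[Fun U] Fun U :=
  (funSec U).toLinearMap ∘ₗ appSec (preMap (kernel.ι
    (SheafOfModules.unitToPushforwardObjUnit (Hom.toRingCatSheafHom j)))) U

lemma resFun_idealIncl {U V : Opens Y} (h : V ≤ U) (x : Sec (pre (idealSheaf j)) U) :
    resFun h (idealIncl j U x) = idealIncl j V (res _ h x) :=
  res_appSec (preMap (kernel.ι
    (SheafOfModules.unitToPushforwardObjUnit (Hom.toRingCatSheafHom j)))) h x

lemma idealIncl_injective (U : Opens Y) : Function.Injective (idealIncl j U) :=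
  SheafOfModules.kernel_ι_app_injective
    (SheafOfModules.unitToPushforwardObjUnit (Hom.toRingCatSheafHom j)) (op U)

lemma comor_idealIncl (U : Opens Y) (x : Sec (pre (idealSheaf j)) U) :
    comor j U (idealIncl j U x) = 0 :=
  congrArg (fun φ => φ.val.app (op U) x) (kernel.condition
    (SheafOfModules.unitToPushforwardObjUnit (Hom.toRingCatSheafHom j)))

lemma exists_idealIncl_eq {U : Opens Y} {a : Fun U} (ha : comor j U a = 0) :
    ∃ x, idealIncl j U x = a :=
  SheafOfModules.exists_kernel_ι_app_eq
    (SheafOfModules.unitToPushforwardObjUnit (Hom.toRingCatSheafHom j)) (op U) a ha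

end Ideal

end AlgebraicGeometry.LocallyRingedSpace

/-! ### Relations in a weakly regular sequence -/

namespace Koszul

variable {A : Type*} [CommRing A] {c : ℕ} {f : Fin c → A}

/-- This is the freeness of I/I². In a relation among the first k + 1 elements, regularity puts the
last coefficient in the ideal of the earlier ones; substituting this expression turns the relation
into a shorter one, and induction applies. -/
lemma IsWeaklyRegular.mem_span_of_form_eq_zero (hf : IsWeaklyRegular f) (k : ℕ) (hk : k ≤ c)
    (a : Fin c → A) (ha : form f k a = 0) (l : Fin c) (hl : (l : ℕ) < k) :
    a l ∈ Ideal.span (Set.range f) := by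
  induction k generalizing a with
  | zero => exact absurd hl (Nat.not_lt_zero _)
  | succ k ih =>
    let k' : Fin c := ⟨k, hk⟩
    have h1 : form f (k + 1) a = form f k a + f k' * a k' := by
      rw [form_succ f k']
      rfl
    have h2 : a k' ∈ Ideal.span (f '' Set.Iio k') := by
      refine hf k' _ ?_
      rw [h1] at ha
      rw [← neg_eq_iff_add_eq_zero.2 ha, neg_mem_iff]
      exact form_mem f k a
    obtain ⟨b, -, hb⟩ := (exists_form_eq_iff f k (a k')).2 h2
    rcases Nat.lt_succ_iff_lt_or_eq.1 hl with hl | rfl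
    -- Here b expresses the last coefficient through the earlier elements, so `a + f k' • b` is a
    -- relation among the first k; it changes a only by multiples of `f k'`.
    · have h3 := ih (Nat.le_of_succ_le hk) (a + f k' • b) (by
        rw [map_add, map_smul, hb, smul_eq_mul, ← h1, ha]) hl
      have h4 : a l = (a + f k' • b) l - b l * f k' := by
        simp [mul_comm]
      rw [h4]
      exact sub_mem h3 (Ideal.mul_mem_left _ _ (Ideal.subset_span ⟨k', rfl⟩))
    · exact Ideal.span_mono (Set.image_subset_range _ _) h2

lemma IsWeaklyRegular.mem_span_of_sum_eq_zero (hf : IsWeaklyRegular f) (a : Fin c → A)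
    (ha : ∑ l, a l * f l = 0) (l : Fin c) : a l ∈ Ideal.span (Set.range f) := by
  refine hf.mem_span_of_form_eq_zero c le_rfl a ?_ l l.2
  rw [form_apply, ← ha]
  exact Finset.sum_congr rfl fun l _ => by rw [if_pos l.2, mul_comm]

end Koszul

/-! ### Subspaces cut out by weakly regular sequences; the conormal sheaf -/

namespace AlgebraicGeometry.LocallyRingedSpace

variable {X Y : LocallyRingedSpace.{u}}

/-- Over `W`, the subspace is cut out by the weakly regular sequence `f`. -/
structure IsKoszulOn (j : X ⟶ Y) (W : Opens Y) {c : ℕ} (f : Fin c → Fun W) : Prop where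
  surjective : Function.Surjective (comor j W)
  comor_eq_zero_iff (a : Fun W) : comor j W a = 0 ↔ a ∈ Ideal.span (Set.range f)
  isWeaklyRegular : Koszul.IsWeaklyRegular f

/-- Over arbitrarily small open subsets of `V`, the subspace is cut out by the weakly regular
sequence `f`. -/
def IsKoszulNear (j : X ⟶ Y) (V : Opens Y) {c : ℕ} (f : Fin c → Fun V) : Prop :=
  ∀ W ≤ V, ∀ p ∈ W, ∃ (W' : Opens Y) (h : W' ≤ V), W' ≤ W ∧ p ∈ W' ∧
    IsKoszulOn j W' (fun k => resFun h (f k))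

/-- The subspace is locally cut out by a weakly regular sequence. -/
def IsLocallyKoszul (j : X ⟶ Y) : Prop :=
  ∀ p : Y, ∃ (V : Opens Y) (c : ℕ) (f : Fin c → Fun V), p ∈ V ∧ IsKoszulNear j V f

section Conormal

variable {j : X ⟶ Y} {V : Opens Y} {c : ℕ} {f : Fin c → Fun V}

lemma IsKoszulNear.comor_eq_zero (hf : IsKoszulNear j V f) (k : Fin c) : comor j V (f k) = 0 := by
  refine eq_of_locally_eq_fun _ _ fun p hp => ?_
  obtain ⟨W, h, -, hpW, hW⟩ := hf V le_rfl _ hp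
  refine ⟨preim j W, preim_mono j h, hpW, ?_⟩
  rw [resFun_comor j h, map_zero, hW.comor_eq_zero_iff]
  exact Ideal.subset_span ⟨k, rfl⟩

/-- The sequence generates the ideal locally, and coefficients of its relations lie in the ideal, so
they vanish on the subspace. Hence the classes of the sequence form a basis of the conormal sheaf
`j^* I`. -/
lemma IsKoszulNear.isPullbackBasis (hf : IsKoszulNear j V f)
    (g : Fin c → Sec (pre (idealSheaf j)) V) (hg : ∀ k, idealIncl j V (g k) = f k) :
    IsPullbackBasis j g where
  exists_span W h s p hp := by
    obtain ⟨W', h', hW', hpW', hk⟩ := hf W h p hp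
    refine ⟨W', hW', hpW', ?_⟩
    have h1 := (hk.comor_eq_zero_iff _).1 (comor_idealIncl j W' (res _ hW' s))
    rw [Ideal.mem_span_range_iff_exists_fun] at h1
    obtain ⟨a, ha⟩ := h1
    refine ⟨a, idealIncl_injective j W' ?_⟩
    rw [map_sum, ← ha]
    refine Finset.sum_congr rfl fun k _ => ?_
    rw [map_smul, smul_eq_mul, ← resFun_idealIncl, hg]
  comor_eq_zero W h a ha k := by
    refine eq_of_locally_eq_fun _ _ fun p hp => ?_
    obtain ⟨W', h', hW', hpW', hk⟩ := hf W h _ hp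
    refine ⟨preim j W', preim_mono j hW', hpW', ?_⟩
    rw [resFun_comor j hW', map_zero, hk.comor_eq_zero_iff]
    refine hk.isWeaklyRegular.mem_span_of_sum_eq_zero (fun k => resFun hW' (a k)) ?_ k
    have h1 := congrArg (fun x => resFun hW' (idealIncl j W x)) ha
    simp only [map_sum, map_smul, ← resFun_idealIncl, hg, smul_eq_mul, map_mul, resFun_resFun,
      map_zero] at h1
    exact h1

end Conormal

/-! ### The bidual of a locally free sheaf -/

section Biduality

variable (C : Modules X) {U V : Opens X}

/-- The map from the presheaf dual to the dual. -/
def dualUnit : PresheafOfModules.dual (pre C) ⟶ pre (moduleDual C) :=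
  unitSh (PresheafOfModules.dual (pre C))

variable {C} in
lemma exists_appSec_dualUnit_eq (s : Sec (pre (moduleDual C)) U) (p : X) (hp : p ∈ U) :
    ∃ (V : Opens X) (hV : V ≤ U), p ∈ V ∧ ∃ t : Sec (PresheafOfModules.dual (pre C)) V,
      appSec (dualUnit C) V t = res _ hV s :=
  exists_appSec_unitSh_eq s p hp

variable {C} in
lemma IsBasisOn.basis_dualUnit {ι : Type} [Fintype ι] {e : ι → Sec (PresheafOfModules.dual (pre C)) U}
    (he : IsBasisOn (PresheafOfModules.dual (pre C)) U e) :
    IsBasisOn (pre (moduleDual C)) U (fun i => appSec (dualUnit C) U (e i)) :=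
  he.sheafification

/-- `ξ` is the evaluation at `c`. -/
def IsEval {C : Modules X} {U : Opens X} (c : Sec (pre C) U)
    (ξ : Sec (PresheafOfModules.dual (pre (moduleDual C))) U) : Prop :=
  ∀ (V : Opens X) (h : V ≤ U) (l : Sec (PresheafOfModules.dual (pre C)) V),
    evalDual ξ h (appSec (dualUnit C) V l) =
      evalDual l le_rfl (res (pre C) h c)

variable {C} {c c' : Sec (pre C) U} {ξ ξ' : Sec (PresheafOfModules.dual (pre (moduleDual C))) U}

lemma IsEval.restrict (hξ : IsEval c ξ) (h : V ≤ U) : IsEval (res _ h c) (res _ h ξ) := by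
  intro W h' l
  rw [evalDual_res, hξ, res_res]

lemma IsEval.add (hξ : IsEval c ξ) (hξ' : IsEval c' ξ') : IsEval (c + c') (ξ + ξ') := by
  intro W h l
  rw [evalDual_add, hξ, hξ', map_add, map_add]

lemma IsEval.zero : IsEval (0 : Sec (pre C) U) 0 := by
  intro W h l
  rw [evalDual_zero, map_zero, map_zero]

lemma IsEval.smul (hξ : IsEval c ξ) (a : Fun U) : IsEval (a • c) (a • ξ) := by
  intro W h l
  rw [evalDual_smul, hξ, LinearMap.map_smulₛₗ, map_smul, smul_eq_mul]

lemma IsEval.sum {ι : Type} (s : Finset ι) {c : ι → Sec (pre C) U}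
    {ξ : ι → Sec (PresheafOfModules.dual (pre (moduleDual C))) U} (h : ∀ i, IsEval (c i) (ξ i)) :
    IsEval (∑ i ∈ s, c i) (∑ i ∈ s, ξ i) := by
  classical
  induction s using Finset.induction_on with
  | empty => exact IsEval.zero
  | insert a s ha ih =>
    rw [Finset.sum_insert ha, Finset.sum_insert ha]
    exact (h a).add ih

/-- Sections of the dual sheaf come locally from the presheaf dual, where the evaluations are
prescribed. -/
lemma IsEval.unique (hξ : IsEval c ξ) (hξ' : IsEval c ξ') : ξ = ξ' := by
  refine evalDual_ext fun V h x => eq_of_locally_eq_fun _ _ fun p hp => ?_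
  obtain ⟨W, hW, hpW, l, hl⟩ := exists_appSec_dualUnit_eq x p hp
  refine ⟨W, hW, hpW, ?_⟩
  rw [resFun_evalDual, resFun_evalDual, ← hl, hξ, hξ']

/-- The dual basis of the dual basis is evaluation at the original basis; by linearity this is
tested on the dual basis. -/
lemma IsBasisOn.exists_isEval {ι : Type} [Fintype ι] [DecidableEq ι] {e : ι → Sec (pre C) U}
    (he : IsBasisOn (pre C) U e) :
    ∃ ξ : ι → Sec (PresheafOfModules.dual (pre (moduleDual C))) U,
      IsBasisOn (PresheafOfModules.dual (pre (moduleDual C))) U ξ ∧ ∀ i, IsEval (e i) (ξ i) := by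
  obtain ⟨d, hd, hd'⟩ := he.exists_dual
  obtain ⟨ξ, hξ, hξ'⟩ := hd.basis_dualUnit.exists_dual
  refine ⟨ξ, hξ, fun i V h l => ?_⟩
  refine LinearMap.congr_fun (f := evalDual (ξ i) h ∘ₗ appSec (dualUnit C) V)
    (g := { toFun := fun l => evalDual l le_rfl (res (pre C) h (e i))
            map_add' := fun _ _ => rfl
            map_smul' := fun a l => by rw [evalDual_smul, resFun_self]; rfl }) ?_ l
  refine hd.ext_basis h fun k => ?_
  change evalDual (ξ i) h (appSec (dualUnit C) V (res _ h (d k))) =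
    evalDual (res _ h (d k)) le_rfl (res (pre C) h (e i))
  rw [← res_appSec, evalDual_res, hd']
  refine (hξ' V h i k).trans ?_
  simp only [eq_comm]

end Biduality

end AlgebraicGeometry.LocallyRingedSpace

/-! ### Exterior products, and tensors on direct and inverse images -/

section Algebra

open scoped TensorProduct

/-- Composition of an alternating map with semilinear maps. -/
def AlternatingMap.compSemilinear {A B M M' P Q : Type*} [CommRing A] [CommRing B] {σ : A →+* B}
    [AddCommGroup M] [Module A M] [AddCommGroup M'] [Module B M'] [AddCommGroup P] [Module B P]
    [AddCommGroup Q] [Module A Q] {q : ℕ} (g : M' [⋀^Fin q]→ₗ[B] P) (θ : M →ₛₗ[σ] M') (ρ : P →+ Q)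
    (hρ : ∀ a x, ρ (σ a • x) = a • ρ x) : M [⋀^Fin q]→ₗ[A] Q where
  toFun x := ρ (g (fun k => θ (x k)))
  map_update_add' := by
    intro _ x i a b
    have h : ∀ c, (fun k => θ (Function.update x i c k)) =
        Function.update (fun k => θ (x k)) i (θ c) := fun c =>
      funext fun k => Function.apply_update (fun _ => θ) x i c k
    rw [h, h, h, map_add, g.map_update_add, map_add]
  map_update_smul' := by
    intro _ x i r a
    have h : ∀ c, (fun k => θ (Function.update x i c k)) =
        Function.update (fun k => θ (x k)) i (θ c) := fun c =>
      funext fun k => Function.apply_update (fun _ => θ) x i c k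
    rw [h, h, LinearMap.map_smulₛₗ, g.map_update_smul, hρ]
  map_eq_zero_of_eq' x i j hx hij := by
    rw [g.map_eq_zero_of_eq _ (by simp only [hx]) hij]
    exact _root_.map_zero ρ

/-- Every tensor has the form `∑ t i ⊗ β i`, so uniqueness of t for the value 0 gives injectivity
and its existence gives surjectivity. -/
lemma TensorProduct.bijective_of_basis {A F M N ι : Type*} [CommRing A] [AddCommGroup F] [Module A F]
    [AddCommGroup M] [Module A M] [AddCommGroup N] [Module A N] [Fintype ι]
    (β : Module.Basis ι A M) (Θ : F ⊗[A] M →ₗ[A] N)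
    (h : ∀ n : N, ∃! t : ι → F, ∑ i, Θ (t i ⊗ₜ β i) = n) : Function.Bijective Θ := by
  classical
  have hrep : ∀ z : F ⊗[A] M, ∃ t : ι → F, ∑ i, t i ⊗ₜ[A] β i = z := by
    intro z
    induction z using TensorProduct.induction_on with
    | zero => exact ⟨0, by simp⟩
    | tmul x m =>
      refine ⟨fun i => β.repr m i • x, ?_⟩
      conv_rhs => rw [← β.sum_repr m]
      simp only [TensorProduct.tmul_sum, TensorProduct.tmul_smul, TensorProduct.smul_tmul']
    | add z w hz hw =>
      obtain ⟨t, rfl⟩ := hz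
      obtain ⟨t', rfl⟩ := hw
      exact ⟨t + t', by simp [TensorProduct.add_tmul, Finset.sum_add_distrib]⟩
  refine ⟨(injective_iff_map_eq_zero Θ).2 fun z hz => ?_, fun n => ?_⟩
  · obtain ⟨t, rfl⟩ := hrep z
    have := (h 0).unique (y₁ := t) (y₂ := 0) (by rw [← hz, map_sum]) (by simp)
    simp [this]
  · obtain ⟨t, ht, -⟩ := h n
    exact ⟨∑ i, t i ⊗ₜ[A] β i, by rw [map_sum]; exact ht⟩

end Algebra

namespace AlgebraicGeometry.LocallyRingedSpace

variable {X S T : LocallyRingedSpace.{u}}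

lemma IsBasisOn.existsUnique {ι : Type} [Fintype ι] {M : PreModules X} {U : Opens X}
    {e : ι → Sec M U} (he : IsBasisOn M U e) (s : Sec M U) :
    ∃! a : ι → Fun U, ∑ i, a i • e i = s := by
  have h1 : ∀ i, he.basis le_rfl i = e i := fun i => by rw [basis_apply, res_self]
  refine ⟨(he.basis le_rfl).equivFun s, ?_, fun a ha => ?_⟩
  · have := (he.basis le_rfl).sum_equivFun s
    simpa only [h1] using this
  · rw [← ha]
    have := (he.basis le_rfl).equivFun.apply_symm_apply a
    rw [Module.Basis.equivFun_symm_apply] at this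
    simpa only [h1] using this.symm

lemma IsBasisOn.isPullbackBasis {ι : Type} [Fintype ι] {E : Modules T} {U : Opens T}
    {e : ι → Sec (pre E) U} (he : IsBasisOn (pre E) U e) (h : S ⟶ T) : IsPullbackBasis h e where
  exists_span V hV s p hp := by
    refine ⟨V, le_rfl, hp, ?_⟩
    obtain ⟨a, ha, -⟩ := (he.restrict hV).existsUnique s
    exact ⟨a, by rw [res_self]; exact ha⟩
  comor_eq_zero V hV a ha i := by
    rw [Fintype.linearIndependent_iff.1 (he V hV).1 a ha i, map_zero]

section Wedge

variable (K : Modules X) (q : ℕ) (U : Opens X)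

/-- The map from the presheaf exterior power to the exterior power. -/
def wedgeUnit : PresheafOfModules.exteriorPower (pre K) q ⟶ pre (moduleExteriorPower q K) :=
  unitSh (PresheafOfModules.exteriorPower (pre K) q)

/-- Exterior products of sections of a sheaf of modules. -/
def wedgeSec : Sec (pre K) U [⋀^Fin q]→ₗ[Fun U] Sec (pre (moduleExteriorPower q K)) U :=
  (appSec (wedgeUnit K q) U).compAlternatingMap (wedge (pre K) q U)

variable {K q U}

lemma res_wedgeSec {V : Opens X} (h : V ≤ U) (x : Fin q → Sec (pre K) U) :
    res _ h (wedgeSec K q U x) = wedgeSec K q V (fun i => res _ h (x i)) :=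
  (res_appSec (wedgeUnit K q) h _).trans (congrArg (appSec (wedgeUnit K q) V) (res_wedge h x))

lemma IsBasisOn.wedgeSec {ι : Type} [Fintype ι] [LinearOrder ι] {e : ι → Sec (pre K) U}
    (he : IsBasisOn (pre K) U e) (q : ℕ) :
    IsBasisOn (pre (moduleExteriorPower q K)) U (fun s : Set.powersetCard ι q =>
      wedgeSec K q U (e ∘ Set.powersetCard.ofFinEmbEquiv.symm s)) :=
  (he.wedgeFamily q).sheafification

end Wedge

section Push

variable (i : S ⟶ X) (M : Modules S) (W : Opens X)

/-- Functions on the inverse image act on the sections of a direct image. -/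
def pushSmul : Sec (pre ((modulePushforward i).obj (structureModule S))) W →ₗ[Fun W]
    Sec (pre ((modulePushforward i).obj M)) W →ₗ[Fun W] Sec (pre ((modulePushforward i).obj M)) W :=
  LinearMap.mk₂ (Fun W)
    (fun x b => (pushSec i M W).symm (funSec _ (pushSec i _ W x) • pushSec i M W b))
    (fun x _ _ => (pushSec i M W).injective (add_smul (funSec _ (pushSec i _ W x)) _ _))
    (fun a x _ => (pushSec i M W).injective
      (mul_smul (comor i W a) (funSec _ (pushSec i _ W x)) _))
    (fun x _ _ => (pushSec i M W).injective (smul_add (funSec _ (pushSec i _ W x)) _ _))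
    (fun a x b => (pushSec i M W).injective
      (smul_comm (funSec _ (pushSec i _ W x)) (comor i W a) (pushSec i M W b)))

variable {W} in
lemma res_pushSmul {V : Opens X} (h : V ≤ W)
    (x : Sec (pre ((modulePushforward i).obj (structureModule S))) W)
    (b : Sec (pre ((modulePushforward i).obj M)) W) :
    res _ h (pushSmul i M W x b) = pushSmul i M V (res _ h x) (res _ h b) :=
  (pushSec i M V).injective ((res (pre M) (preim_mono i h)).map_smulₛₗ
    (funSec _ (pushSec i _ W x)) (pushSec i M W b))

end Push

section PushPull

variable (h : S ⟶ T) (j : T ⟶ X) (E : Modules T) (W : Opens X)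

/-- Inverse image of sections followed by direct image. -/
def pushPullSec : Sec (pre E) (preim j W) →+
    Sec (pre ((modulePushforward (h ≫ j)).obj ((modulePullback h).obj E))) W :=
  (pushSec (h ≫ j) ((modulePullback h).obj E) W).symm.toAddMonoidHom.comp
    (pullSec h E (preim j W)).toAddMonoidHom

lemma pushPullSec_smul (a : Fun W) (x : Sec (pre E) (preim j W)) :
    pushPullSec h j E W (comor j W a • x) = a • pushPullSec h j E W x :=
  (pushSec (h ≫ j) _ W).injective ((pullSec h E (preim j W)).map_smulₛₗ (comor j W a) x)

variable {W} in
lemma res_pushPullSec {V : Opens X} (hV : V ≤ W) (x : Sec (pre E) (preim j W)) :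
    res _ hV (pushPullSec h j E W x) = pushPullSec h j E V (res _ (preim_mono j hV) x) :=
  (pushSec (h ≫ j) _ V).injective (res_pullSec h E (preim_mono j hV) x)

end PushPull

end AlgebraicGeometry.LocallyRingedSpace

/-! ### Isomorphisms of sheaves from local correspondences -/

namespace AlgebraicGeometry.LocallyRingedSpace

variable {X : LocallyRingedSpace.{u}}

lemma isIso_sheafification_map {M N : PreModules X} (φ : M ⟶ N)
    (hi : ∀ (U : Opens X) (x y : Sec M U), appSec φ U x = appSec φ U y → ∀ p ∈ U,
      ∃ (V : Opens X) (h : V ≤ U), p ∈ V ∧ res M h x = res M h y)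
    (hs : ∀ (U : Opens X) (y : Sec N U), ∀ p ∈ U,
      ∃ (V : Opens X) (h : V ≤ U), p ∈ V ∧ ∃ x, appSec φ V x = res N h y) :
    IsIso ((moduleSheafification X).map φ) := by
  let J := Opens.grothendieckTopology X
  have h1 : Presheaf.IsLocallyInjective J ((PresheafOfModules.toPresheaf _).map φ) :=
    ⟨fun {U} x y hxy p hp => by
      obtain ⟨V, h, hpV, hV⟩ := hi U.unop x y hxy p hp
      exact ⟨V, homOfLE h, hV, hpV⟩⟩
  have h2 : Presheaf.IsLocallySurjective J ((PresheafOfModules.toPresheaf _).map φ) :=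
    ⟨fun {U} y p hp => by
      obtain ⟨V, h, hpV, x, hx⟩ := hs U y p hp
      exact ⟨V, homOfLE h, ⟨x, hx⟩, hpV⟩⟩
  have h3 : (J.W.inverseImage (PresheafOfModules.toPresheaf _)) φ :=
    J.W_of_isLocallyBijective _
  have h4 := PresheafOfModules.inverseImage_W_toPresheaf_eq_inverseImage_isomorphisms (J := J)
    (𝟙 (ringCatSheaf X).obj)
  have h5 : ((MorphismProperty.isomorphisms _).inverseImage (moduleSheafification X)) φ := by
    rw [← h4]
    exact h3
  exact h5

section Relation

variable (M N : PreModules X) (R : ∀ U : Opens X, Submodule (Fun U) (Sec M U × Sec N U))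
  (hres : ∀ (U V : Opens X) (h : V ≤ U) (p : Sec M U × Sec N U), p ∈ R U →
    (res M h p.1, res N h p.2) ∈ R V)

/-- The presheaf of pairs of sections in relation. -/
def relationPresheaf : PreModules X :=
  PresheafOfModules.ofSemilinear (fun U => ModuleCat.of (Fun U.unop) (R U.unop))
    (fun {U V} f =>
      { toFun := fun p => ⟨_, hres U.unop V.unop f.unop.le p.1 p.2⟩
        map_add' := fun _ _ => Subtype.ext (Prod.ext (map_add (res M _) _ _)
          (map_add (res N _) _ _))
        map_smul' := fun _ _ => Subtype.ext (Prod.ext ((res M _).map_smulₛₗ _ _)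
          ((res N _).map_smulₛₗ _ _)) })
    (fun _ _ => Subtype.ext (Prod.ext (res_self M _ _) (res_self N _ _)))
    (fun f g _ => Subtype.ext (Prod.ext (res_res M f.unop.le g.unop.le _).symm
      (res_res N f.unop.le g.unop.le _).symm))

/-- The pairs in relation as sections. -/
def relationSec (U : Opens X) : R U ≃+ Sec (relationPresheaf M N R hres) U := AddEquiv.refl _

lemma res_relationSec {U V : Opens X} (h : V ≤ U) (p : R U) :
    res _ h (relationSec M N R hres U p) =
      relationSec M N R hres V ⟨_, hres U V h p.1 p.2⟩ := rfl

/-- The first projection. -/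
def relationFst : relationPresheaf M N R hres ⟶ M :=
  homOfSec (fun U =>
    { toFun := fun p => ((relationSec M N R hres U).symm p).1.1
      map_add' := fun _ _ => rfl
      map_smul' := fun _ _ => rfl })
    (fun _ _ _ _ => rfl)

/-- The second projection. -/
def relationSnd : relationPresheaf M N R hres ⟶ N :=
  homOfSec (fun U =>
    { toFun := fun p => ((relationSec M N R hres U).symm p).1.2
      map_add' := fun _ _ => rfl
      map_smul' := fun _ _ => rfl })
    (fun _ _ _ _ => rfl)

include hres in
/-- Presheaves that are related by a correspondence which is locally the graph of a bijection
have isomorphic sheafifications. -/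
lemma nonempty_iso_of_relation
    (hloc : ∀ (U : Opens X), ∀ p ∈ U, ∃ V ≤ U, p ∈ V ∧ (∀ a, ∃! b, (a, b) ∈ R V) ∧
      ∀ b, ∃! a, (a, b) ∈ R V) :
    Nonempty ((moduleSheafification X).obj M ≅ (moduleSheafification X).obj N) := by
  -- Locally the relation is a graph over either factor, so both projections from the presheaf of
  -- related pairs are locally bijective and become isomorphisms after sheafification.
  have h1 : IsIso ((moduleSheafification X).map (relationFst M N R hres)) := by
    refine isIso_sheafification_map _ (fun U x y hxy p hp => ?_) fun U a p hp => ?_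
    · obtain ⟨V, hV, hpV, h1, -⟩ := hloc U p hp
      refine ⟨V, hV, hpV, ?_⟩
      obtain ⟨⟨⟨a, b⟩, hab⟩, rfl⟩ := (relationSec M N R hres U).surjective x
      obtain ⟨⟨⟨a', b'⟩, hab'⟩, rfl⟩ := (relationSec M N R hres U).surjective y
      obtain rfl : a = a' := hxy
      rw [res_relationSec, res_relationSec]
      refine congrArg _ (Subtype.ext (Prod.ext rfl ?_))
      exact (h1 _).unique (hres _ _ hV _ hab) (hres _ _ hV _ hab')
    · obtain ⟨V, hV, hpV, h1, -⟩ := hloc U p hp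
      obtain ⟨b, hb, -⟩ := h1 (res M hV a)
      exact ⟨V, hV, hpV, relationSec M N R hres V ⟨_, hb⟩, rfl⟩
  have h2 : IsIso ((moduleSheafification X).map (relationSnd M N R hres)) := by
    refine isIso_sheafification_map _ (fun U x y hxy p hp => ?_) fun U a p hp => ?_
    · obtain ⟨V, hV, hpV, -, h1⟩ := hloc U p hp
      refine ⟨V, hV, hpV, ?_⟩
      obtain ⟨⟨⟨a, b⟩, hab⟩, rfl⟩ := (relationSec M N R hres U).surjective x
      obtain ⟨⟨⟨a', b'⟩, hab'⟩, rfl⟩ := (relationSec M N R hres U).surjective y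
      obtain rfl : b = b' := hxy
      rw [res_relationSec, res_relationSec]
      refine congrArg _ (Subtype.ext (Prod.ext ?_ rfl))
      exact (h1 _).unique (hres _ _ hV _ hab) (hres _ _ hV _ hab')
    · obtain ⟨V, hV, hpV, -, h1⟩ := hloc U p hp
      obtain ⟨b, hb, -⟩ := h1 (res N hV a)
      exact ⟨V, hV, hpV, relationSec M N R hres V ⟨_, hb⟩, rfl⟩
  exact ⟨(asIso ((moduleSheafification X).map (relationFst M N R hres))).symm ≪≫
    asIso ((moduleSheafification X).map (relationSnd M N R hres))⟩

/-- The sheafification of a sheaf. -/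
def sheafificationIso (F : Modules X) : (moduleSheafification X).obj (pre F) ≅ F :=
  (asIso (PresheafOfModules.sheafificationAdjunction (𝟙 (ringCatSheaf X).obj)).counit).app F

end Relation

end AlgebraicGeometry.LocallyRingedSpace

/-! ### Representing Tor classes by tensors -/

namespace PresheafOfModules

open scoped TensorProduct

variable {C : Type u} [SmallCategory.{u} C] {R : Cᵒᵖ ⥤ CommRingCat.{u}}
  (F : PresheafOfModules.{u} (R ⋙ forget₂ CommRingCat RingCat))
  {G : PresheafOfModules.{u} (R ⋙ forget₂ CommRingCat RingCat)} (P : ProjectiveResolution G)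

lemma Represents.smul_commRing
    {T : ChainComplex (PresheafOfModules.{u} (R ⋙ forget₂ CommRingCat RingCat)) ℕ} {q : ℕ} {U : Cᵒᵖ}
    {z : (T.X q).obj U} {a : (T.homology q).obj U} (r : R.obj U) (hz : Represents T q U z a) :
    Represents T q U (r • z) (r • a) :=
  Represents.smul (R := R ⋙ forget₂ CommRingCat RingCat) r hz

/-- The sections of the complex `F ⊗ P`. -/
def tensorSec (q : ℕ) (U : Cᵒᵖ) :
    TensorProduct (R.obj U) (F.obj U) ((resolutionApp P U).complex.X q) →ₗ[R.obj U]
      ((torComplex F P).X q).obj U where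
  toFun z := z
  map_add' _ _ := rfl
  map_smul' _ _ := rfl

/-- Restriction of the sections of the resolution. -/
def restrictResolution (q : ℕ) {U V : Cᵒᵖ} (f : U ⟶ V) :
    (resolutionApp P U).complex.X q →ₛₗ[(R.map f).hom] (resolutionApp P V).complex.X q :=
  (P.complex.X q).restrictₛₗ f

/-- The tensor `z` over `U` is a cycle that represents the class `a`. -/
def RepresentsTensor (q : ℕ) (U : Cᵒᵖ)
    (z : TensorProduct (R.obj U) (F.obj U) ((resolutionApp P U).complex.X q))
    (a : ((torComplex F P).homology q).obj U) : Prop :=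
  Represents (torComplex F P) q U (tensorSec F P q U z) a

variable {F P} {q : ℕ} {U V : Cᵒᵖ}

lemma RepresentsTensor.add {z w} {a b} (hz : RepresentsTensor F P q U z a)
    (hw : RepresentsTensor F P q U w b) : RepresentsTensor F P q U (z + w) (a + b) :=
  Represents.add hz hw

lemma RepresentsTensor.smul {z} {a} (r : R.obj U) (hz : RepresentsTensor F P q U z a) :
    RepresentsTensor F P q U (r • z) (r • a) := by
  unfold RepresentsTensor
  rw [map_smul]
  exact Represents.smul_commRing r hz

lemma RepresentsTensor.zero : RepresentsTensor F P q U 0 0 := Represents.zero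

lemma RepresentsTensor.map (f : U ⟶ V) {x : F.obj U} {y : (resolutionApp P U).complex.X q} {a}
    (hz : RepresentsTensor F P q U (x ⊗ₜ y) a) :
    RepresentsTensor F P q V
      (F.restrictₛₗ f x ⊗ₜ[R.obj V] restrictResolution P q f y)
      (((torComplex F P).homology q).restrictₛₗ f a) :=
  Represents.map f hz

lemma exists_representsTensor
    (z : TensorProduct (R.obj U) (F.obj U) ((resolutionApp P U).complex.X q))
    (hz : ∀ j, LinearMap.lTensor (F.obj U) ((resolutionApp P U).complex.d q j).hom z = 0) :
    ∃ a, RepresentsTensor F P q U z a :=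
  exists_represents (T := torComplex F P) z hz

lemma exists_representsTensor' (a : ((torComplex F P).homology q).obj U) :
    ∃ z : TensorProduct (R.obj U) (F.obj U) ((resolutionApp P U).complex.X q),
      (∀ j, LinearMap.lTensor (F.obj U) ((resolutionApp P U).complex.d q j).hom z = 0) ∧
        RepresentsTensor F P q U z a :=
  exists_represents' (T := torComplex F P) a

lemma RepresentsTensor.eq_zero_iff {z a} (hz : RepresentsTensor F P q U z a) :
    a = 0 ↔ ∃ w, LinearMap.lTensor (F.obj U) ((resolutionApp P U).complex.d (q + 1) q).hom w = z :=
  Represents.eq_zero_iff hz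

lemma lTensor_d_lTensor_d (k : ℕ)
    (t : TensorProduct (R.obj U) (F.obj U) ((resolutionApp P U).complex.X (q + 1))) :
    LinearMap.lTensor (F.obj U) ((resolutionApp P U).complex.d q k).hom
      (LinearMap.lTensor (F.obj U) ((resolutionApp P U).complex.d (q + 1) q).hom t) = 0 :=
  (LinearMap.comp_apply _ _ _).symm.trans (by
    rw [← LinearMap.lTensor_comp, ← ModuleCat.hom_comp, HomologicalComplex.d_comp_d]
    exact LinearMap.congr_fun (LinearMap.lTensor_zero _) t)

lemma RepresentsTensor.sub {z w} {a b} (hz : RepresentsTensor F P q U z a)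
    (hw : RepresentsTensor F P q U w b) : RepresentsTensor F P q U (z - w) (a - b) := by
  have := hz.add (hw.smul (-1))
  rwa [neg_one_smul, neg_one_smul, ← sub_eq_add_neg, ← sub_eq_add_neg] at this

lemma RepresentsTensor.congr {z w a} (hz : RepresentsTensor F P q U z a)
    {t} (hw : z - w = LinearMap.lTensor (F.obj U)
      ((resolutionApp P U).complex.d (q + 1) q).hom t) :
    RepresentsTensor F P q U w a := by
  obtain ⟨b, hb⟩ := exists_representsTensor (F := F) (P := P) (z - w) (fun k => by
    rw [hw]
    exact lTensor_d_lTensor_d k t)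
  obtain rfl := hb.eq_zero_iff.2 ⟨t, hw.symm⟩
  have := hz.sub hb
  rwa [sub_sub_cancel, sub_zero] at this

/-- Differentials and augmentation of P are morphisms of presheaves, so they commute with
restriction. This makes the correspondence defined by systems a presheaf. -/
lemma isSystem_restrict {X : Type*} {a : X → R.obj U} {g : G.obj U}
    {φ : ∀ n, (Fin n → X) → (resolutionApp P U).complex.X n} (f : U ⟶ V)
    (h : Koszul.IsSystem (resolutionApp P U).complex
      (Koszul.augmentation (resolutionApp P U)) a g φ) :
    Koszul.IsSystem (resolutionApp P V).complex (Koszul.augmentation (resolutionApp P V))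
      (fun x => R.map f (a x)) (G.restrictₛₗ f g)
      (fun n v => restrictResolution P n f (φ n v)) where
  aug v := by
    rw [← h.aug v]
    exact naturality_apply (P.π.f 0) f (φ 0 v)
  diff n v := by
    refine (naturality_apply (P.complex.d (n + 1) n) f (φ (n + 1) v)).trans ?_
    refine (congrArg (restrictResolution P n f) (h.diff n v)).trans ?_
    rw [map_sum]
    refine Finset.sum_congr rfl fun i _ => ?_
    rw [LinearMap.map_smulₛₗ, LinearMap.map_smulₛₗ, map_pow, map_neg, map_one]

end PresheafOfModules

/-! ### Correspondences and their generators; the bidual correspondence -/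

open scoped TensorProduct

/-- The relation r is the graph of an isomorphism between Z and M, and Θ identifies Z with N. The
pairs in G lie on the graph of the composite, and G contains the pairs coming from a spanning set of
Z, so the span of G is exactly that graph. -/
lemma existsUnique_of_correspondence {A Z M N : Type*} [CommRing A] [AddCommGroup Z] [Module A Z]
    [AddCommGroup M] [Module A M] [AddCommGroup N] [Module A N] (G : Set (M × N))
    (r : Z → M → Prop) (Θ : Z →ₗ[A] N) (hΘ : Function.Bijective Θ)
    (hadd : ∀ z w a b, r z a → r w b → r (z + w) (a + b))
    (hsmul : ∀ (t : A) z a, r z a → r (t • z) (t • a)) (h0 : r 0 0)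
    (hex : ∀ z, ∃ a, r z a) (hex' : ∀ a, ∃ z, r z a)
    (hi : ∀ z, r z 0 → z = 0) (hi' : ∀ a, r 0 a → a = 0)
    (hG : ∀ p ∈ G, ∃ z, r z p.1 ∧ Θ z = p.2)
    (Z₀ : Set Z) (hZ₀ : Submodule.span A Z₀ = ⊤) (hG' : ∀ z ∈ Z₀, ∀ a, r z a → (a, Θ z) ∈ G) :
    (∀ a, ∃! b, (a, b) ∈ Submodule.span A G) ∧ ∀ b, ∃! a, (a, b) ∈ Submodule.span A G := by
  have h1 : ∀ p ∈ Submodule.span A G, ∃ z, r z p.1 ∧ Θ z = p.2 := by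
    intro p hp
    induction hp using Submodule.span_induction with
    | mem p hp => exact hG p hp
    | zero => exact ⟨0, h0, map_zero _⟩
    | add p p' _ _ h h' =>
      obtain ⟨z, hz, hz'⟩ := h
      obtain ⟨w, hw, hw'⟩ := h'
      exact ⟨z + w, hadd _ _ _ _ hz hw, by rw [map_add, hz', hw']; rfl⟩
    | smul t p _ h =>
      obtain ⟨z, hz, hz'⟩ := h
      exact ⟨t • z, hsmul _ _ _ hz, by rw [map_smul, hz']; rfl⟩
  have hsub : ∀ z a b, r z a → r z b → a = b := fun z a b ha hb => by
    rw [← sub_eq_zero]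
    refine hi' _ ?_
    have := hadd _ _ _ _ ha (hsmul (-1) _ _ hb)
    rwa [neg_one_smul, neg_one_smul, add_neg_cancel, ← sub_eq_add_neg] at this
  have h2 : ∀ z, ∃ a, r z a ∧ (a, Θ z) ∈ Submodule.span A G := by
    intro z
    have hz : z ∈ Submodule.span A Z₀ := hZ₀ ▸ trivial
    induction hz using Submodule.span_induction with
    | mem z hz =>
      obtain ⟨a, ha⟩ := hex z
      exact ⟨a, ha, Submodule.subset_span (hG' z hz a ha)⟩
    | zero => exact ⟨0, h0, by rw [map_zero]; exact Submodule.zero_mem _⟩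
    | add z w _ _ h h' =>
      obtain ⟨a, ha, ha'⟩ := h
      obtain ⟨b, hb, hb'⟩ := h'
      exact ⟨a + b, hadd _ _ _ _ ha hb, by rw [map_add]; exact Submodule.add_mem _ ha' hb'⟩
    | smul t z _ h =>
      obtain ⟨a, ha, ha'⟩ := h
      exact ⟨t • a, hsmul _ _ _ ha, by rw [map_smul]; exact Submodule.smul_mem _ t ha'⟩
  have h3 : ∀ z a, r z a → (a, Θ z) ∈ Submodule.span A G := fun z a ha => by
    obtain ⟨b, hb, hb'⟩ := h2 z
    rwa [hsub _ _ _ ha hb]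
  refine ⟨fun a => ?_, fun b => ?_⟩
  · obtain ⟨z, hz⟩ := hex' a
    refine ⟨Θ z, h3 z a hz, fun b hb => ?_⟩
    obtain ⟨w, hw, hw'⟩ := h1 _ (Submodule.sub_mem _ hb (h3 z a hz))
    change r w (a - a) at hw
    change Θ w = b - Θ z at hw'
    rw [sub_self] at hw
    rw [hi w hw, map_zero] at hw'
    exact sub_eq_zero.1 hw'.symm
  · obtain ⟨z, rfl⟩ := hΘ.2 b
    obtain ⟨a, ha, ha'⟩ := h2 z
    refine ⟨a, ha', fun b hb => ?_⟩
    obtain ⟨w, hw, hw'⟩ := h1 _ hb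
    obtain rfl := hΘ.1 hw'
    exact hsub _ _ _ hw ha

lemma exteriorPower.span_ιMulti_single {A : Type*} [CommRing A] (c q : ℕ) :
    Submodule.span A (Set.range fun v : Fin q → Fin c =>
      exteriorPower.ιMulti A q (fun k => (Pi.single (v k) 1 : Fin c → A))) = ⊤ := by
  refine eq_top_iff.2 ?_
  rw [← ((Pi.basisFun A (Fin c)).exteriorPower q).span_eq, Submodule.span_le]
  rintro _ ⟨s, rfl⟩
  refine Submodule.subset_span ⟨Set.powersetCard.ofFinEmbEquiv.symm s, ?_⟩
  rw [exteriorPower.basis_apply, exteriorPower.ιMulti_family]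
  refine congrArg (exteriorPower.ιMulti A q) (funext fun k => ?_)
  simp

lemma TensorProduct.span_tmul_of_span {A F M : Type*} [CommRing A] [AddCommGroup F] [Module A F]
    [AddCommGroup M] [Module A M] {s : Set M} (hs : Submodule.span A s = ⊤) :
    Submodule.span A {z : F ⊗[A] M | ∃ x, ∃ m ∈ s, x ⊗ₜ m = z} = ⊤ := by
  refine eq_top_iff.2 ?_
  rw [← TensorProduct.span_tmul_eq_top, Submodule.span_le]
  rintro _ ⟨x, m, rfl⟩
  have hm : m ∈ Submodule.span A s := hs ▸ trivial
  change x ⊗ₜ m ∈ Submodule.span A _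
  induction hm using Submodule.span_induction with
  | mem m hm => exact Submodule.subset_span ⟨x, m, hm, rfl⟩
  | zero => rw [TensorProduct.tmul_zero]; exact Submodule.zero_mem _
  | add m n _ _ h h' => rw [TensorProduct.tmul_add]; exact Submodule.add_mem _ h h'
  | smul a m _ h => rw [TensorProduct.tmul_smul]; exact Submodule.smul_mem _ _ h

namespace AlgebraicGeometry.LocallyRingedSpace

open PresheafOfModules

variable {X S T : LocallyRingedSpace.{u}}

section Represents

variable {F G : PreModules X} {P : ProjectiveResolution G}

/-- The sections of a resolution over an open subset. -/
abbrev resSec (P : ProjectiveResolution G) (U : Opens X) :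
    ProjectiveResolution (C := ModuleCat.{u} (Fun U)) (G.obj (op U)) := resolutionApp P (op U)

/-- The tensor `z` over `U` is a cycle that represents the class `a`. -/
def RepresentsSec (q : ℕ) (U : Opens X) (z : Sec F U ⊗[Fun U] (resSec P U).complex.X q)
    (a : Sec ((torComplex F P).homology q) U) : Prop :=
  RepresentsTensor F P q (op U) z a

variable {q : ℕ} {U V : Opens X} {z w : Sec F U ⊗[Fun U] (resSec P U).complex.X q}
    {a b : Sec ((torComplex F P).homology q) U}

lemma RepresentsSec.add (hz : RepresentsSec q U z a)
    (hw : RepresentsSec q U w b) : RepresentsSec q U (z + w) (a + b) :=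
  RepresentsTensor.add hz hw

lemma RepresentsSec.smul (t : Fun U) (hz : RepresentsSec q U z a) :
    RepresentsSec q U (t • z) (t • a) :=
  RepresentsTensor.smul (R := X.presheaf) t hz

lemma RepresentsSec.zero :
    RepresentsSec q U (0 : Sec F U ⊗[Fun U] (resSec P U).complex.X q) 0 :=
  RepresentsTensor.zero

/-- Restriction of the sections of a resolution. -/
def resRes (P : ProjectiveResolution G) (q : ℕ) (h : V ≤ U) :
    (resSec P U).complex.X q →ₛₗ[resFun h] (resSec P V).complex.X q :=
  restrictResolution P q (homOfLE h).op

lemma RepresentsSec.restrict (h : V ≤ U) {x : Sec F U} {y : (resSec P U).complex.X q}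
    (hz : RepresentsSec q U (x ⊗ₜ y) a) :
    RepresentsSec q V (res F h x ⊗ₜ resRes P q h y) (res _ h a) :=
  RepresentsTensor.map (homOfLE h).op hz

lemma exists_representsSec (z : Sec F U ⊗[Fun U] (resSec P U).complex.X q)
    (hz : ∀ j, LinearMap.lTensor (Sec F U) ((resSec P U).complex.d q j).hom z = 0) :
    ∃ a, RepresentsSec q U z a :=
  exists_representsTensor z hz

lemma exists_representsSec' (a : Sec ((torComplex F P).homology q) U) :
    ∃ z : Sec F U ⊗[Fun U] (resSec P U).complex.X q,
      (∀ j, LinearMap.lTensor (Sec F U) ((resSec P U).complex.d q j).hom z = 0) ∧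
        RepresentsSec q U z a :=
  exists_representsTensor' a

lemma RepresentsSec.eq_zero_iff (hz : RepresentsSec q U z a) :
    a = 0 ↔ ∃ w, LinearMap.lTensor (Sec F U) ((resSec P U).complex.d (q + 1) q).hom w = z :=
  RepresentsTensor.eq_zero_iff hz

lemma RepresentsSec.congr (hz : RepresentsSec q U z a) {t}
    (hw : z - w = LinearMap.lTensor (Sec F U) ((resSec P U).complex.d (q + 1) q).hom t) :
    RepresentsSec q U w a :=
  RepresentsTensor.congr hz hw

lemma isSystem_resRes {I : Type*} {a : I → Fun U} {g : Sec G U}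
    {φ : ∀ n, (Fin n → I) → (resSec P U).complex.X n} (h : V ≤ U)
    (hφ : Koszul.IsSystem (resSec P U).complex (Koszul.augmentation (resSec P U)) a g φ) :
    Koszul.IsSystem (resSec P V).complex (Koszul.augmentation (resSec P V))
      (fun x => resFun h (a x)) (res G h g) (fun n v => resRes P n h (φ n v)) :=
  isSystem_restrict (homOfLE h).op hφ

end Represents

section Bidual

variable {C : Modules X} {U V : Opens X}

/-- The section `ν` of the bidual is the evaluation at `c`. -/
def IsBidual (c : Sec (pre C) U) (ν : Sec (pre (moduleDual (moduleDual C))) U) : Prop :=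
  ∃ ξ, IsEval c ξ ∧ ν = appSec (dualUnit (moduleDual C)) U ξ

lemma IsBidual.restrict {c : Sec (pre C) U} {ν} (h : IsBidual c ν) (hV : V ≤ U) :
    IsBidual (res _ hV c) (res _ hV ν) := by
  obtain ⟨ξ, hξ, rfl⟩ := h
  exact ⟨_, hξ.restrict hV, res_appSec (dualUnit (moduleDual C)) hV ξ⟩

lemma IsBidual.unique {c : Sec (pre C) U} {ν ν'} (h : IsBidual c ν) (h' : IsBidual c ν') :
    ν = ν' := by
  obtain ⟨ξ, hξ, rfl⟩ := h
  obtain ⟨ξ', hξ', rfl⟩ := h'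
  rw [hξ.unique hξ']

lemma IsBidual.smul {c : Sec (pre C) U} {ν} (h : IsBidual c ν) (a : Fun U) :
    IsBidual (a • c) (a • ν) := by
  obtain ⟨ξ, hξ, rfl⟩ := h
  exact ⟨_, hξ.smul a, (map_smul (appSec (dualUnit (moduleDual C)) U) a ξ).symm⟩

lemma IsBidual.sum {ι : Type} (s : Finset ι) {c : ι → Sec (pre C) U}
    {ν : ι → Sec (pre (moduleDual (moduleDual C))) U} (h : ∀ i, IsBidual (c i) (ν i)) : IsBidual (∑ i ∈ s, c i) (∑ i ∈ s, ν i) := by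
  choose ξ hξ hν using h
  refine ⟨_, IsEval.sum s hξ, ?_⟩
  rw [funext hν]
  exact (map_sum (appSec (dualUnit (moduleDual C)) U) ξ s).symm

lemma IsBasisOn.exists_isBidual {ι : Type} [Fintype ι] [DecidableEq ι] {e : ι → Sec (pre C) U}
    (he : IsBasisOn (pre C) U e) : ∃ ν : ι → Sec (pre (moduleDual (moduleDual C))) U,
      IsBasisOn (pre (moduleDual (moduleDual C))) U ν ∧ ∀ i, IsBidual (e i) (ν i) := by
  obtain ⟨ξ, hξ, hξ'⟩ := he.exists_isEval
  exact ⟨_, hξ.basis_dualUnit, fun i => ⟨_, hξ' i, rfl⟩⟩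

end Bidual

end AlgebraicGeometry.LocallyRingedSpace

/-! ### The correspondence between Tor and the exterior power -/

open scoped TensorProduct

namespace AlgebraicGeometry.LocallyRingedSpace

open PresheafOfModules

variable {X S T : LocallyRingedSpace.{u}} (h : S ⟶ T) (j : T ⟶ X)
  (P : ProjectiveResolution (pre ((modulePushforward j).obj (structureModule T)))) (q : ℕ)

/-- The image of the function `1`. -/
def oneSec (U : Opens X) : Sec (pre ((modulePushforward j).obj (structureModule T))) U :=
  (pushSec j _ U).symm ((funSec _).symm 1)

lemma res_oneSec {U V : Opens X} (hV : V ≤ U) : res _ hV (oneSec j U) = oneSec j V :=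
  (pushSec j _ V).injective (map_one (resFun (preim_mono j hV)))

/-- The presheaf Tor, computed by the resolution. -/
abbrev preTor : PreModules X :=
  (torComplex (pre ((modulePushforward (h ≫ j)).obj (structureModule S))) P).homology q

/-- The bidual of the conormal sheaf. -/
abbrev bidualConormal : Modules T := moduleDual (normalSheaf j)

/-- The direct image of the inverse image of the exterior power of the bidual of the conormal
sheaf. -/
abbrev pushExteriorPower : Modules X := (modulePushforward (h ≫ j)).obj
  ((modulePullback h).obj (moduleExteriorPower q (bidualConormal j)))

/-- The product of a function on `S` with an exterior product of sections of the bidual. -/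
def smulWedge (U : Opens X)
    (x : Sec (pre ((modulePushforward (h ≫ j)).obj (structureModule S))) U)
    (ν : Fin q → Sec (pre (bidualConormal j)) (preim j U)) : Sec (pre (pushExteriorPower h j q)) U :=
  pushSmul (h ≫ j) _ U x (pushPullSec h j _ U (wedgeSec (bidualConormal j) q (preim j U) ν))

lemma res_smulWedge {U V : Opens X} (hV : V ≤ U)
    (x : Sec (pre ((modulePushforward (h ≫ j)).obj (structureModule S))) U)
    (ν : Fin q → Sec (pre (bidualConormal j)) (preim j U)) :
    res _ hV (smulWedge h j q U x ν) =
      smulWedge h j q V (res _ hV x) (fun k => res _ (preim_mono j hV) (ν k)) := by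
  unfold smulWedge
  rw [← res_wedgeSec, ← res_pushPullSec h j _ hV, ← res_pushSmul]

/-- The basic corresponding pairs: the class of `x ⊗ φ(v)`, where `φ` is a system of chains for
elements of the ideal, and the product of `x` with the exterior product of the classes of these
elements in the conormal sheaf. -/
def IsCorresponding (U : Opens X) :
    Set (Sec (preTor h j P q) U × Sec (pre (pushExteriorPower h j q)) U) :=
  { p | ∃ (m : ℕ) (g : Fin m → Sec (pre (idealSheaf j)) U)
      (φ : ∀ n, (Fin n → Fin m) → (resSec P U).complex.X n) (v : Fin q → Fin m)
      (x : Sec (pre ((modulePushforward (h ≫ j)).obj (structureModule S))) U)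
      (ν : Fin q → Sec (pre (bidualConormal j)) (preim j U)),
      Koszul.IsSystem (resSec P U).complex (Koszul.augmentation (resSec P U))
        (fun k => idealIncl j U (g k)) (oneSec j U) φ ∧
      (∀ k, IsBidual (C := conormalSheaf j) (pullSec j (idealSheaf j) U (g (v k))) (ν k)) ∧
      RepresentsSec q U (x ⊗ₜ φ q v) p.1 ∧ p.2 = smulWedge h j q U x ν }

lemma IsCorresponding.restrict {U V : Opens X} (hV : V ≤ U)
    {p : Sec (preTor h j P q) U × Sec (pre (pushExteriorPower h j q)) U}
    (hp : p ∈ IsCorresponding h j P q U) :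
    (res _ hV p.1, res _ hV p.2) ∈ IsCorresponding h j P q V := by
  obtain ⟨m, g, φ, v, x, ν, hφ, hν, hr, hw⟩ := hp
  refine ⟨m, fun k => res _ hV (g k), fun n v => resRes P n hV (φ n v), v, res _ hV x,
    fun k => res _ (preim_mono j hV) (ν k), ?_, fun k => ?_, hr.restrict hV, ?_⟩
  · have := isSystem_resRes hV hφ
    simp only [resFun_idealIncl, res_oneSec] at this
    exact this
  · have := (hν k).restrict (preim_mono j hV)
    rwa [show res (pre (conormalSheaf j)) (preim_mono j hV) (pullSec j (idealSheaf j) U (g (v k))) =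
      pullSec j (idealSheaf j) V (res _ hV (g (v k))) from res_pullSec j (idealSheaf j) hV _] at this
  · rw [hw, res_smulWedge]

lemma span_isCorresponding_restrict (U V : Opens X) (hV : V ≤ U)
    (p : Sec (preTor h j P q) U × Sec (pre (pushExteriorPower h j q)) U)
    (hp : p ∈ Submodule.span (Fun U) (IsCorresponding h j P q U)) :
    (res _ hV p.1, res _ hV p.2) ∈ Submodule.span (Fun V) (IsCorresponding h j P q V) := by
  induction hp using Submodule.span_induction with
  | mem p hp => exact Submodule.subset_span (IsCorresponding.restrict h j P q hV hp)
  | zero =>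
    simp only [Prod.fst_zero, Prod.snd_zero, map_zero]
    exact Submodule.zero_mem _
  | add p p' _ _ h h' =>
    simp only [Prod.fst_add, Prod.snd_add, map_add]
    exact Submodule.add_mem _ h h'
  | smul a p _ h =>
    simp only [Prod.smul_fst, Prod.smul_snd, LinearMap.map_smulₛₗ]
    exact Submodule.smul_mem _ _ h

end AlgebraicGeometry.LocallyRingedSpace

/-! ### The correspondence over a small open set, and the Tor isomorphism -/

open scoped TensorProduct

namespace AlgebraicGeometry.LocallyRingedSpace

open PresheafOfModules

variable {X S T : LocallyRingedSpace.{u}} (h : S ⟶ T) (j : T ⟶ X)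
  (P : ProjectiveResolution (pre ((modulePushforward j).obj (structureModule T)))) (q : ℕ)

/-- Restriction of functions to the closed subspace as a linear map. -/
def closedFun (W : Opens X) :
    Fun W →ₗ[Fun W] Sec (pre ((modulePushforward j).obj (structureModule T))) W where
  toFun a := (pushSec j _ W).symm ((funSec _).symm (comor j W a))
  map_add' a b := map_add (comor j W) a b
  map_smul' a b := map_mul (comor j W) a b

/-- Restriction of functions to the closed subspace. -/
def restrictToClosed (W : Opens X) : ModuleCat.of (Fun W) (Fun W) ⟶
    (pre ((modulePushforward j).obj (structureModule T))).obj (op W) :=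
  show ModuleCat.of (Fun W) (Fun W) ⟶
    ModuleCat.of (Fun W) (Sec (pre ((modulePushforward j).obj (structureModule T))) W) from
  ModuleCat.ofHom (closedFun j W)

lemma restrictToClosed_apply (W : Opens X) (a : Fun W) :
    (restrictToClosed j W).hom a = closedFun j W a := rfl

/-- Sections of the direct image along a composition. -/
def pushSecComp (M : Modules S) (W : Opens X) :
    Sec (pre ((modulePushforward (h ≫ j)).obj M)) W ≃+ Sec (pre M) (preim h (preim j W)) :=
  pushSec (h ≫ j) M W

lemma pushSecComp_smul (M : Modules S) (W : Opens X) (a : Fun W)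
    (x : Sec (pre ((modulePushforward (h ≫ j)).obj M)) W) :
    pushSecComp h j M W (a • x) = comor h _ (comor j W a) • pushSecComp h j M W x := rfl

lemma pushSecComp_smulWedge (W : Opens X)
    (x : Sec (pre ((modulePushforward (h ≫ j)).obj (structureModule S))) W)
    (ν : Fin q → Sec (pre (bidualConormal j)) (preim j W)) :
    pushSecComp h j _ W (smulWedge h j q W x ν) = funSec _ (pushSecComp h j _ W x) •
      pullSec h _ (preim j W) (wedgeSec (bidualConormal j) q (preim j W) ν) := rfl

variable {W : Opens X} {c : ℕ}

/-- The linear map given by a family of sections. -/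
def combination (ν : Fin c → Sec (pre (bidualConormal j)) (preim j W)) :
    (Fin c → Fun W) →ₛₗ[comor j W] Sec (pre (bidualConormal j)) (preim j W) where
  toFun B := ∑ l, comor j W (B l) • ν l
  map_add' B B' := by simp only [Pi.add_apply, map_add, add_smul, Finset.sum_add_distrib]
  map_smul' a B := by
    simp only [Pi.smul_apply, smul_eq_mul, map_mul, mul_smul, Finset.smul_sum]

lemma combination_single (ν : Fin c → Sec (pre (bidualConormal j)) (preim j W)) (l : Fin c) :
    combination j ν (Pi.single l 1) = ν l := by
  change ∑ l', comor j W ((Pi.single l 1 : Fin c → Fun W) l') • ν l' = ν l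
  rw [Finset.sum_eq_single l]
  · rw [Pi.single_eq_same, map_one, one_smul]
  · intro l' _ hl
    rw [Pi.single_eq_of_ne hl, map_zero, zero_smul]
  · simp

/-- The map from the exterior powers of the free module to the exterior powers of the bidual of
the conormal sheaf. -/
def wedgeComparison (ν : Fin c → Sec (pre (bidualConormal j)) (preim j W)) :
    Sec (pre ((modulePushforward (h ≫ j)).obj (structureModule S))) W ⊗[Fun W]
      ⋀[Fun W]^q (Fin c → Fun W) →ₗ[Fun W] Sec (pre (pushExteriorPower h j q)) W :=
  TensorProduct.lift ((pushSmul (h ≫ j) _ W).compl₂ (exteriorPower.alternatingMapLinearEquiv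
    (AlternatingMap.compSemilinear (wedgeSec (bidualConormal j) q (preim j W)) (combination j ν)
      (pushPullSec h j _ W) (pushPullSec_smul h j _ W))))

lemma wedgeComparison_tmul (ν : Fin c → Sec (pre (bidualConormal j)) (preim j W))
    (x : Sec (pre ((modulePushforward (h ≫ j)).obj (structureModule S))) W)
    (B : Fin q → Fin c → Fun W) :
    wedgeComparison h j q ν (x ⊗ₜ exteriorPower.ιMulti (Fun W) q B) =
      smulWedge h j q W x (fun k => combination j ν (B k)) := by
  unfold wedgeComparison smulWedge
  rw [TensorProduct.lift.tmul, LinearMap.compl₂_apply,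
    exteriorPower.alternatingMapLinearEquiv_apply_ιMulti]
  rfl

/-- The exterior products of a basis form a basis, and its inverse image on S is again a basis.
Coefficients with respect to it are functions on S, as are the coefficients in the tensor product
with `⋀^q`. -/
lemma wedgeComparison_bijective {ν : Fin c → Sec (pre (bidualConormal j)) (preim j W)}
    (hν : IsBasisOn (pre (bidualConormal j)) (preim j W) ν) :
    Function.Bijective (wedgeComparison h j q ν) := by
  have hb := ((hν.wedgeSec q).isPullbackBasis h).isBasisOn
  refine TensorProduct.bijective_of_basis ((Pi.basisFun (Fun W) (Fin c)).exteriorPower q) _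
    fun b => ?_
  obtain ⟨t, ht, ht'⟩ := hb.existsUnique (pushSecComp h j _ W b)
  have key : ∀ t : Set.powersetCard (Fin c) q →
      Sec (pre ((modulePushforward (h ≫ j)).obj (structureModule S))) W,
      pushSecComp h j _ W (∑ s, wedgeComparison h j q ν
        (t s ⊗ₜ ((Pi.basisFun (Fun W) (Fin c)).exteriorPower q) s)) =
      ∑ s, funSec _ (pushSecComp h j _ W (t s)) • pullSec h _ (preim j W)
        (wedgeSec (bidualConormal j) q (preim j W) (ν ∘ Set.powersetCard.ofFinEmbEquiv.symm s)) := by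
    intro t
    rw [map_sum]
    refine Finset.sum_congr rfl fun s _ => ?_
    rw [exteriorPower.basis_apply, exteriorPower.ιMulti_family, wedgeComparison_tmul]
    have : (fun k => combination j ν ((⇑(Pi.basisFun (Fun W) (Fin c)) ∘
        ⇑(Set.powersetCard.ofFinEmbEquiv.symm s)) k)) =
        ν ∘ Set.powersetCard.ofFinEmbEquiv.symm s := by
      funext k
      rw [Function.comp_apply, Pi.basisFun_apply, combination_single]
      rfl
    rw [this, pushSecComp_smulWedge]
  refine ⟨fun s => (pushSecComp h j _ W).symm ((funSec _).symm (t s)),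
    (pushSecComp h j _ W).injective ?_, fun t₁ ht₁ => ?_⟩
  · exact (key _).trans ht
  · have h1 := ht' (fun s => funSec _ (pushSecComp h j _ W (t₁ s))) ((key t₁).symm.trans
      (congrArg _ ht₁))
    funext s
    exact congrFun h1 s

variable {f : Fin c → Fun W}

/-- Both sides are identified with `O_S ⊗ ⋀^q A^c`: presheaf Tor through the comparison of the
Koszul complex with P, the exterior power through `wedgeComparison`. It remains to see that the
corresponding pairs match under these identifications and that they include a spanning set. -/
lemma IsKoszulOn.existsUnique (hf : IsKoszulOn j W f) (g : Fin c → Sec (pre (idealSheaf j)) W)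
    (hg : ∀ k, idealIncl j W (g k) = f k) (ν : Fin c → Sec (pre (bidualConormal j)) (preim j W))
    (hν : IsBasisOn (pre (bidualConormal j)) (preim j W) ν)
    (hgν : ∀ k, IsBidual (C := conormalSheaf j) (pullSec j (idealSheaf j) W (g k)) (ν k)) :
    (∀ a, ∃! b, (a, b) ∈ Submodule.span (Fun W) (IsCorresponding h j P q W)) ∧
      ∀ b, ∃! a, (a, b) ∈ Submodule.span (Fun W) (IsCorresponding h j P q W) := by
  obtain ⟨φ, hφ, hcomp⟩ := Koszul.exists_comparison f (restrictToClosed j W) (resSec P W)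
    hf.isWeaklyRegular (fun y => by
      obtain ⟨a, ha⟩ := hf.surjective (funSec _ (pushSec j _ W y))
      exact ⟨a, (restrictToClosed_apply j W a).trans
        ((pushSec j _ W).injective ((funSec _).injective ha))⟩) (by
      ext a
      rw [← hf.comor_eq_zero_iff a]
      rfl)
  -- Functions vanishing on T act as zero on functions on S, since these factor through T.
  have hkill : ∀ (a : Fun W), comor j W a = 0 →
      ∀ x : Sec (pre ((modulePushforward (h ≫ j)).obj (structureModule S))) W, a • x = 0 := by
    intro a ha x
    refine (pushSecComp h j _ W).injective ?_
    rw [pushSecComp_smul, ha, map_zero, map_zero, zero_smul]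
  obtain ⟨h1, h2, h3⟩ := hcomp
    (Sec (pre ((modulePushforward (h ≫ j)).obj (structureModule S))) W) (fun x l =>
      hkill _ ((hf.comor_eq_zero_iff _).2 (Ideal.subset_span ⟨l, rfl⟩)) x) q
  refine existsUnique_of_correspondence (IsCorresponding h j P q W)
    (fun z a => RepresentsSec q W (LinearMap.lTensor _ (φ q) z) a) (wedgeComparison h j q ν)
    (wedgeComparison_bijective h j q hν) ?_ ?_ ?_ ?_ ?_ ?_ ?_ ?_ _
    (TensorProduct.span_tmul_of_span (exteriorPower.span_ιMulti_single c q)) ?_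
  · intro z w a b hz hw
    rw [map_add]
    exact hz.add hw
  · intro t z a hz
    rw [map_smul]
    exact hz.smul t
  · rw [map_zero]
    exact RepresentsSec.zero
  · exact fun z => exists_representsSec _ (fun k => h1 k z)
  · intro a
    obtain ⟨z, hz, hza⟩ := exists_representsSec' a
    obtain ⟨y, w, hy⟩ := h3 z hz
    exact ⟨y, hza.congr (sub_eq_iff_eq_add'.2 hy)⟩
  · intro z hz
    obtain ⟨w, hw⟩ := hz.eq_zero_iff.1 rfl
    exact h2 z w hw.symm
  · intro a ha
    exact ha.eq_zero_iff.2 ⟨0, by rw [map_zero, map_zero]⟩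
  -- For an arbitrary pair, write its sections of the ideal as combinations B of the f l. The Koszul
  -- complex gives a second system for the same sections, and by independence of the system the Tor
  -- class is that of the tensor of x with the exterior product of the B.
  · rintro p ⟨m, g', φ', v, x, ν', hφ', hν', hr, hw⟩
    have hB : ∀ k, ∃ B : Fin c → Fun W, ∑ l, B l * f l = idealIncl j W (g' k) := fun k =>
      Ideal.mem_span_range_iff_exists_fun.1 ((hf.comor_eq_zero_iff _).1 (comor_idealIncl j W _))
    choose B hB using hB
    refine ⟨x ⊗ₜ exteriorPower.ιMulti (Fun W) q (fun k => B (v k)), ?_, ?_⟩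
    · have hs := hφ (Fin m) B
      have hform : (fun k => Koszul.form f c (B k)) = fun k => idealIncl j W (g' k) := by
        funext k
        rw [← hB, Koszul.form_apply]
        exact Finset.sum_congr rfl fun l _ => by rw [if_pos l.2, mul_comm]
      rw [hform] at hs
      have hone : (restrictToClosed j W).hom (1 : Fun W) = oneSec j W :=
        (restrictToClosed_apply j W 1).trans ((pushSec j _ W).injective (map_one (comor j W)))
      rw [hone] at hs
      obtain ⟨y, hy⟩ := Koszul.IsSystem.exists_tmul_sub_eq (A := Fun W) (resSec P W) hφ' hs
        (F := Sec (pre ((modulePushforward (h ≫ j)).obj (structureModule S))) W) x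
        (fun k => hkill _ (comor_idealIncl j W _) x) q v
      exact hr.congr (t := x ⊗ₜ y) hy
    · rw [wedgeComparison_tmul, hw]
      congr 1
      funext k
      refine IsBidual.unique ?_ (hν' k)
      -- The same coefficients B express the conormal classes, so the exterior product on the other
      -- side matches.
      have hg' : g' (v k) = ∑ l, B (v k) l • g l := by
        refine idealIncl_injective j W ?_
        rw [map_sum, ← hB]
        exact Finset.sum_congr rfl fun l _ => by rw [map_smul, hg, smul_eq_mul]
      rw [hg', map_sum]
      refine IsBidual.sum _ fun l => ?_
      rw [LinearMap.map_smulₛₗ]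
      exact (hgν l).smul _
  -- Tensors with exterior products of standard basis vectors span; they arise from the system
  -- attached to f itself.
  · rintro _ ⟨x, _, ⟨v, rfl⟩, rfl⟩ a ha
    refine ⟨c, g, fun n v => φ n (exteriorPower.ιMulti _ n (fun k => Pi.single (v k) 1)), v, x,
      fun k => ν (v k), ?_, fun k => hgν _, ha, ?_⟩
    · have hs := hφ (Fin c) (fun k => Pi.single k 1)
      have hform : (fun k => Koszul.form f c (Pi.single k 1)) = fun k => idealIncl j W (g k) := by
        funext k
        rw [Koszul.form_single, if_pos k.2, hg]
      rw [hform] at hs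
      have hone : (restrictToClosed j W).hom (1 : Fun W) = oneSec j W :=
        (restrictToClosed_apply j W 1).trans ((pushSec j _ W).injective (map_one (comor j W)))
      rw [hone] at hs
      exact hs
    · change wedgeComparison h j q ν _ = _
      rw [wedgeComparison_tmul]
      simp only [combination_single]

/-- If `T` is locally cut out by weakly regular sequences in `X`, then the sheaf Tor of the direct
images of the structure sheaves of `S ⟶ T ⟶ X` and of `T ⟶ X` is the direct image of the inverse
image of the exterior power of the conormal sheaf. -/
theorem nonempty_tor_iso (hj : IsLocallyKoszul j) :
    Nonempty (tor q ((modulePushforward (h ≫ j)).obj (structureModule S))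
      ((modulePushforward j).obj (structureModule T)) ≅ pushExteriorPower h j q) := by
  let G := pre ((modulePushforward j).obj (structureModule T))
  let P : ProjectiveResolution G := projectiveResolution G
  obtain ⟨e⟩ := nonempty_iso_of_relation (preTor h j P q) (pre (pushExteriorPower h j q))
    (fun U => Submodule.span (Fun U) (IsCorresponding h j P q U))
    (span_isCorresponding_restrict h j P q) (fun U p hp => by
      obtain ⟨V, c, f, hpV, hf⟩ := hj p
      -- The conormal basis exists over all of V, but the Koszul computation needs a neighbourhood
      -- inside U on which the sequence resolves, so one passes to W and restricts the basis.
      obtain ⟨W, hWV, hW, hpW, hk⟩ := hf (U ⊓ V) inf_le_right p ⟨hp, hpV⟩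
      choose g hg using fun k => exists_idealIncl_eq j (hf.comor_eq_zero k)
      obtain ⟨ν, hν, hν'⟩ := (hf.isPullbackBasis g hg).isBasisOn.exists_isBidual
        (C := conormalSheaf j)
      refine ⟨W, hW.trans inf_le_left, hpW, hk.existsUnique h j P q (fun k => res _ hWV (g k))
        (fun k => by rw [← resFun_idealIncl, hg]) _ (hν.restrict (preim_mono j hWV)) fun k => ?_⟩
      have := (hν' k).restrict (preim_mono j hWV)
      rwa [show res (pre (conormalSheaf j)) (preim_mono j hWV) (pullSec j (idealSheaf j) V (g k)) =
        pullSec j (idealSheaf j) W (res _ hWV (g k)) from res_pullSec j (idealSheaf j) hWV _] at this)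
  exact ⟨(moduleSheafification X).mapIso (torIso _ G P q) ≪≫ e ≪≫ sheafificationIso _⟩

end AlgebraicGeometry.LocallyRingedSpace

/-! ### Commutative algebra: regular generators of the ideal of a smooth quotient -/

open scoped TensorProduct
open KaehlerDifferential

/-- A finitely presented module whose localization at a prime is free is, up to an element outside
the prime, isomorphic to a free module. -/
lemma Module.FinitePresentation.exists_comp_eq_smul_id {B M : Type*} [CommRing B] [AddCommGroup M]
    [Module B M] [Module.FinitePresentation B M] [Module.Projective B M] (Q : Ideal B) [Q.IsPrime] :
    ∃ (c : ℕ) (h : (Fin c → B) →ₗ[B] M) (φ : M →ₗ[B] (Fin c → B)) (s : B), s ∉ Q ∧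
      φ ∘ₗ h = s • LinearMap.id ∧ h ∘ₗ φ = s • LinearMap.id := by
  let S := Q.primeCompl
  let L := Localization.AtPrime Q
  let MQ := LocalizedModule S M
  let lM : M →ₗ[B] MQ := LocalizedModule.mkLinearMap S M
  have : Module.Projective L MQ := Module.projective_of_isLocalizedModule S lM
  have : Module.Finite L MQ := Module.Finite.of_isLocalizedModule S (Rₚ := L) lM
  -- Freeness at Q gives mutually inverse maps over the local ring; these and their composition
  -- identities are then cleared of denominators.
  have : Module.Free L MQ := Module.free_of_flat_of_isLocalRing
  let b := Module.finBasis L MQ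
  let c := Module.finrank L MQ
  let lN : (Fin c → B) →ₗ[B] (Fin c → L) := LinearMap.pi fun i =>
    Algebra.linearMap B L ∘ₗ LinearMap.proj i
  have : IsLocalizedModule S lN := inferInstance
  let e : MQ ≃ₗ[L] (Fin c → L) := b.equivFun
  obtain ⟨h, s, hs⟩ := Module.FinitePresentation.exists_lift_of_isLocalizedModule S lM
    ((e.symm.toLinearMap.restrictScalars B) ∘ₗ lN)
  obtain ⟨φ, t, ht⟩ := Module.FinitePresentation.exists_lift_of_isLocalizedModule S lN
    ((e.toLinearMap.restrictScalars B) ∘ₗ lM)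
  have hs' (x) : lM (h x) = (s : B) • e.symm (lN x) := LinearMap.congr_fun hs x
  have ht' (x) : lN (φ x) = (t : B) • e (lM x) := LinearMap.congr_fun ht x
  have smul_e (a : B) (x : MQ) : e (a • x) = a • e x := (e.toLinearMap.restrictScalars B).map_smul a x
  have smul_e' (a : B) (x) : e.symm (a • x) = a • e.symm x :=
    (e.symm.toLinearMap.restrictScalars B).map_smul a x
  obtain ⟨a, ha⟩ := Module.Finite.exists_smul_of_comp_eq_of_isLocalizedModule S lN
    (φ ∘ₗ h) (((t : B) * s) • LinearMap.id) (by
      refine LinearMap.ext fun x => ?_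
      simp [ht', hs', smul_e, mul_smul])
  obtain ⟨a', ha'⟩ := Module.Finite.exists_smul_of_comp_eq_of_isLocalizedModule S lM
    (h ∘ₗ φ) (((t : B) * s) • LinearMap.id) (by
      refine LinearMap.ext fun x => ?_
      simp [ht', hs', smul_e', mul_smul, smul_comm (s : B) (t : B)])
  have ha₁ (x) : (a : B) • φ (h x) = (a : B) • ((t : B) * s) • x := LinearMap.congr_fun ha x
  have ha₂ (x) : (a' : B) • h (φ x) = (a' : B) • ((t : B) * s) • x := LinearMap.congr_fun ha' x
  -- The factors s and t are the denominators of the two maps; a and a' make the two composition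
  -- identities hold over B.
  refine ⟨c, h, ((a : B) * a') • φ, (a * a' * (t * s) : S), (a * a' * (t * s) : S).2, ?_, ?_⟩
  · refine LinearMap.ext fun x => ?_
    simp only [LinearMap.comp_apply, LinearMap.smul_apply, Submonoid.coe_mul, LinearMap.id_apply]
    rw [mul_comm (a : B), mul_smul, ha₁, smul_smul, smul_smul]
  · refine LinearMap.ext fun x => ?_
    simp only [LinearMap.comp_apply, LinearMap.smul_apply, Submonoid.coe_mul, LinearMap.id_apply,
      map_smul]
    rw [mul_smul, ha₂, smul_smul, smul_smul, mul_assoc]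

/-- A form of Nakayama's lemma: if `s` maps a finitely generated ideal `J` into `I + J²`, then some
element congruent to a power of `s` modulo `J` maps `J` into `I`. -/
lemma Ideal.exists_sub_pow_mem_and_mul_mem {A : Type*} [CommRing A] {I J : Ideal A} (hJ : J.FG)
    (s : A) (h : ∀ x ∈ J, s * x ∈ I ⊔ J ^ 2) :
    ∃ (n : ℕ) (g : A), g - s ^ n ∈ J ∧ ∀ x ∈ J, g * x ∈ I := by
  -- On `J / (J ∩ I)` the hypothesis says that multiplication by s has image in J times the module.
  let N := J ⧸ Submodule.comap J.subtype I
  have : Module.Finite A J := Module.Finite.iff_fg.2 hJ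
  let E : Module.End A N := s • LinearMap.id
  have hE : LinearMap.range E ≤ J • (⊤ : Submodule A N) := by
    rintro _ ⟨x, rfl⟩
    obtain ⟨x, rfl⟩ := Submodule.mkQ_surjective (Submodule.comap J.subtype I) x
    obtain ⟨a, ha, b, hb, hab⟩ := Submodule.mem_sup.1 (h x x.2)
    have hbJ : b ∈ J := Ideal.pow_le_self two_ne_zero hb
    have haJ : a ∈ J := by
      rw [← add_sub_cancel_right a b, hab]
      exact J.sub_mem (J.mul_mem_left _ x.2) hbJ
    have e1 : E (Submodule.mkQ _ x) = Submodule.mkQ (Submodule.comap J.subtype I) ⟨b, hbJ⟩ := by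
      change s • Submodule.mkQ (Submodule.comap J.subtype I) x = _
      rw [← map_smul, ← sub_eq_zero, ← map_sub, Submodule.mkQ_apply, Submodule.Quotient.mk_eq_zero]
      change s * (x : A) - b ∈ I
      rw [← hab, add_sub_cancel_right]
      exact ha
    rw [e1]
    have hb' : b ∈ (J • ⊤ : Submodule A J).map J.subtype := by
      rw [Submodule.map_smul'', Submodule.map_top, Submodule.range_subtype, smul_eq_mul, ← pow_two]
      exact hb
    obtain ⟨y, hy, rfl⟩ := hb'
    have : (Submodule.mkQ (Submodule.comap J.subtype I)) y ∈
        (J • ⊤ : Submodule A J).map (Submodule.mkQ (Submodule.comap J.subtype I)) :=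
      Submodule.mem_map_of_mem hy
    rw [Submodule.map_smul''] at this
    exact Submodule.smul_mono le_rfl le_top this
  -- Cayley–Hamilton gives a monic p, with lower coefficients in J, that annihilates multiplication
  -- by s; then `g = p(s)` kills the quotient and is a power of s modulo J.
  obtain ⟨p, hp, -, hpc, hp0⟩ :=
    LinearMap.exists_monic_and_natDegree_eq_and_coeff_mem_pow_and_aeval_eq_zero A E J hE
  refine ⟨p.natDegree, p.eval s, ?_, fun x hx => ?_⟩
  · rw [Polynomial.eval_eq_sum_range, Finset.sum_range_succ, hp.coeff_natDegree, one_mul,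
      add_sub_cancel_right]
    refine J.sum_mem fun k hk => J.mul_mem_right _ ?_
    exact Ideal.pow_le_self (Nat.sub_ne_zero_of_lt (Finset.mem_range.1 hk)) (hpc k)
  · have hE' : Polynomial.aeval E p = p.eval s • LinearMap.id := by
      have : E = algebraMap A (Module.End A N) s := rfl
      rw [this, Polynomial.aeval_algebraMap_apply, Polynomial.coe_aeval_eq_eval]
      rfl
    have := LinearMap.congr_fun (hE'.symm.trans hp0)
      (Submodule.mkQ (Submodule.comap J.subtype I) ⟨x, hx⟩)
    change p.eval s • Submodule.mkQ (Submodule.comap J.subtype I) _ = 0 at this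
    rw [← map_smul, Submodule.mkQ_apply, Submodule.Quotient.mk_eq_zero] at this
    exact this

/-- The ideal of a smooth closed subscheme of a smooth affine scheme is locally generated by
functions with linearly independent differentials. -/
theorem Algebra.Smooth.exists_generators_ker {R A B : Type u} [CommRing R] [CommRing A]
    [CommRing B] [Algebra R A] [Algebra A B] [Algebra R B] [IsScalarTower R A B]
    [Algebra.Smooth R A] [Algebra.Smooth R B]
    (hAB : Function.Surjective (algebraMap A B)) (Q : Ideal B) [Q.IsPrime] :
    ∃ (c : ℕ) (f : Fin c → A) (g : A) (r : Ω[A⁄R] →ₗ[A] (Fin c → A)),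
      algebraMap A B g ∉ Q ∧ (∀ i, algebraMap A B (f i) = 0) ∧
      (∀ a, algebraMap A B a = 0 → g * a ∈ Ideal.span (Set.range f)) ∧
      ∀ i, r (D R A (f i)) = g • Pi.single i 1 := by
  classical
  -- The conormal module, seen inside the restricted differentials. The projectivity of the
  -- differentials of B splits it off as a direct summand, so it is finite projective.
  let M := LinearMap.ker (mapBaseChange R A B)
  obtain ⟨σ, hσ⟩ := Module.projective_lifting_property (mapBaseChange R A B) LinearMap.id
    (mapBaseChange_surjective R A B hAB)
  have hσ' (x) : mapBaseChange R A B (σ x) = x := LinearMap.congr_fun hσ x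
  let π : (B ⊗[A] Ω[A⁄R]) →ₗ[B] M := LinearMap.codRestrict M
    (LinearMap.id - σ ∘ₗ mapBaseChange R A B) fun x => by
      simp [M, LinearMap.mem_ker, hσ']
  have hπ (x : M) : π x = x := by
    refine Subtype.ext ?_
    have : mapBaseChange R A B x = 0 := x.2
    simp [π, this]
  have : Module.Projective B (B ⊗[A] Ω[A⁄R]) := inferInstance
  have : Module.Finite B (B ⊗[A] Ω[A⁄R]) := inferInstance
  have : Module.Projective B M := Module.Projective.of_split M.subtype π (LinearMap.ext hπ)
  have : Module.Finite B M := Module.Finite.of_surjective π fun x => ⟨x, hπ x⟩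
  have : Module.FinitePresentation B M := Module.finitePresentation_of_projective B M
  obtain ⟨c, h, φ, s, hs, hφh, hhφ⟩ := Module.FinitePresentation.exists_comp_eq_smul_id (M := M) Q
  let J := RingHom.ker (algebraMap A B)
  have hJfg : J.FG := by
    have : Algebra.FinitePresentation A B :=
      .of_restrict_scalars_finitePresentation R A B
    exact Algebra.FinitePresentation.ker_fG_of_surjective (Algebra.ofId A B) hAB
  have key (x : M) : ∃ a, algebraMap A B a = 0 ∧ (1 : B) ⊗ₜ[A] D R A a = (x : B ⊗[A] Ω[A⁄R]) := by
    have hx : (x : B ⊗[A] Ω[A⁄R]) ∈ LinearMap.range (kerCotangentToTensor R A B) := by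
      rw [range_kerCotangentToTensor R A B hAB]
      exact x.2
    obtain ⟨y, hy⟩ := hx
    obtain ⟨y, rfl⟩ := Ideal.toCotangent_surjective _ y
    exact ⟨y, y.2, hy⟩
  have hmem (a : A) (ha : algebraMap A B a = 0) : (1 : B) ⊗ₜ[A] D R A a ∈ M := by
    simp [M, LinearMap.mem_ker, ha]
  choose f hf hfh using fun i : Fin c => key (h (Pi.single i 1))
  obtain ⟨s', rfl⟩ := hAB s
  -- Smoothness of B over R makes J/J² inject into the differentials, so two elements of J with the
  -- same differential agree modulo J².
  have hinj : Function.Injective (kerCotangentToTensor R A B) :=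
    (Algebra.FormallySmooth.kerCotangentToTensor_injective_iff hAB).2 inferInstance
  have hspan (x) (hx : x ∈ J) : s' * x ∈ Ideal.span (Set.range f) ⊔ J ^ 2 := by
    choose b hb using fun i => hAB (φ ⟨_, hmem x hx⟩ i)
    have e1 : (1 : B) ⊗ₜ[A] D R A (s' * x) = (1 : B) ⊗ₜ[A] D R A (∑ i, b i * f i) := by
      have e2 := congrArg Subtype.val (LinearMap.congr_fun hhφ ⟨_, hmem x hx⟩)
      have e3 : (φ ⟨_, hmem x hx⟩) = ∑ i, algebraMap A B (b i) • (Pi.single i 1 : Fin c → B) := by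
        rw [pi_eq_sum_univ' (φ _)]
        refine Finset.sum_congr rfl fun i _ => ?_
        rw [hb]
      rw [LinearMap.comp_apply, e3] at e2
      simp only [map_sum, map_smul, Submodule.coe_sum, Submodule.coe_smul, ← hfh,
        LinearMap.smul_apply, LinearMap.id_apply] at e2
      simp only [Derivation.leibniz, map_sum, TensorProduct.tmul_add, TensorProduct.tmul_sum,
        TensorProduct.tmul_smul, TensorProduct.smul_tmul']
      have hx0 : algebraMap A B x = 0 := hx
      simp only [Algebra.smul_def, hx0, hf, mul_one, TensorProduct.zero_tmul, add_zero]
      simp only [TensorProduct.smul_tmul', smul_eq_mul, mul_one] at e2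
      exact e2.symm
    have hsJ : ∑ i, b i * f i ∈ J := J.sum_mem fun i _ => J.mul_mem_left _ (hf i)
    have e4 : J.toCotangent ⟨s' * x, J.mul_mem_left _ hx⟩ = J.toCotangent ⟨_, hsJ⟩ := hinj e1
    rw [Ideal.toCotangent_eq] at e4
    rw [← sub_add_cancel (s' * x) (∑ i, b i * f i)]
    refine Submodule.add_mem _ (Ideal.mem_sup_right e4) (Ideal.mem_sup_left ?_)
    exact Ideal.sum_mem _ fun i _ => Ideal.mul_mem_left _ _ (Ideal.subset_span ⟨i, rfl⟩)
  -- The f i generate J up to s' modulo J²; the Nakayama argument removes J².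
  obtain ⟨n, g, hg, hgJ⟩ := Ideal.exists_sub_pow_mem_and_mul_mem hJfg s' hspan
  let qq : (Fin c → A) →ₗ[A] (Fin c → B) := LinearMap.pi fun i =>
    Algebra.linearMap A B ∘ₗ LinearMap.proj i
  have hqq : Function.Surjective qq := fun x => by
    choose y hy using fun i => hAB (x i)
    exact ⟨y, funext hy⟩
  obtain ⟨r, hr⟩ := Module.projective_lifting_property qq
    (((φ ∘ₗ π).restrictScalars A) ∘ₗ (TensorProduct.mk A B Ω[A⁄R] 1)) hqq
  -- The coordinates of the differentials form s' times the identity, but only modulo J. Composing r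
  -- with the adjugate of N makes the matrix exactly scalar, at the cost of the factor `N.det`,
  -- which is a power of s' modulo J.
  let N : Matrix (Fin c) (Fin c) A := Matrix.of fun i j => r (D R A (f j)) i
  have hN : (algebraMap A B).mapMatrix N = (algebraMap A B s') • (1 : Matrix (Fin c) (Fin c) B) := by
    ext i j
    have e1 := congrFun (LinearMap.congr_fun hr (D R A (f j))) i
    have e2 : π (1 ⊗ₜ[A] D R A (f j)) = h (Pi.single j 1) := by
      rw [hfh, hπ]
    have e3 := congrFun (LinearMap.congr_fun hφh (Pi.single j 1)) i
    change algebraMap A B (r (D R A (f j)) i) = φ (π (1 ⊗ₜ[A] D R A (f j))) i at e1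
    change algebraMap A B (r (D R A (f j)) i) = _
    rw [e1, e2]
    refine Eq.trans e3 ?_
    simp [Matrix.one_apply, Pi.single_apply, Algebra.smul_def]
  have hdet : algebraMap A B N.det = algebraMap A B s' ^ c := by
    rw [RingHom.map_det, hN, Matrix.det_smul, Matrix.det_one, mul_one, Fintype.card_fin]
  refine ⟨c, f, g * N.det, g • (N.adjugate.mulVecLin ∘ₗ r), ?_, hf, ?_, ?_⟩
  · have hg' : algebraMap A B g = algebraMap A B s' ^ n := by
      have : algebraMap A B (g - s' ^ n) = 0 := hg
      rwa [map_sub, map_pow, sub_eq_zero] at this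
    rw [map_mul, hdet, hg', ← pow_add]
    exact fun hQ => hs (Ideal.IsPrime.mem_of_pow_mem ‹_› _ hQ)
  · intro a ha
    rw [mul_comm g, mul_assoc]
    exact Ideal.mul_mem_left _ _ (hgJ a ha)
  · intro i
    have e1 : r (D R A (f i)) = N.mulVec (Pi.single i 1) := by
      ext j
      simp [N]
    rw [LinearMap.smul_apply, LinearMap.comp_apply, Matrix.mulVecLin_apply, e1,
      Matrix.mulVec_mulVec, Matrix.adjugate_mul, Matrix.smul_mulVec, Matrix.one_mulVec, mul_smul]

/-- Functions with linearly independent differentials on a smooth scheme are smooth coordinates. -/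
theorem Algebra.FormallySmooth.of_kaehlerDifferential_retraction {R A : Type u} [CommRing R]
    [CommRing A] [Algebra R A] [Algebra.FormallySmooth R A] {c : ℕ}
    [Algebra (MvPolynomial (Fin c) R) A] [IsScalarTower R (MvPolynomial (Fin c) R) A]
    (r : Ω[A⁄R] →ₗ[A] (Fin c → A))
    (hr : ∀ i, r (D R A (algebraMap (MvPolynomial (Fin c) R) A (MvPolynomial.X i))) =
      Pi.single i 1) :
    Algebra.FormallySmooth (MvPolynomial (Fin c) R) A := by
  classical
  let P := MvPolynomial (Fin c) R
  let b : Module.Basis (Fin c) A (A ⊗[P] Ω[P⁄R]) :=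
    (KaehlerDifferential.mvPolynomialBasis R (Fin c)).baseChange A
  let ρ : Ω[A⁄R] →ₗ[A] (A ⊗[P] Ω[P⁄R]) := b.equivFun.symm.toLinearMap ∘ₗ r
  have hρ : ρ ∘ₗ mapBaseChange R P A = LinearMap.id := by
    refine b.ext fun i => ?_
    have : b i = 1 ⊗ₜ[P] D R P (MvPolynomial.X i) := by
      simp [b, KaehlerDifferential.mvPolynomialBasis_apply]
      rfl
    rw [LinearMap.comp_apply, LinearMap.id_apply]
    nth_rewrite 1 [this]
    rw [mapBaseChange_tmul, one_smul, KaehlerDifferential.map_D, LinearMap.comp_apply, hr]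
    simp
  have hinj : Function.Injective (mapBaseChange R P A) :=
    Function.LeftInverse.injective (g := ρ) fun x => LinearMap.congr_fun hρ x
  refine ⟨?_, ?_⟩
  · have tfae := (exact_mapBaseChange_map R P A).split_tfae hinj
      (KaehlerDifferential.map_surjective R P A)
    have h01 : (∃ l, KaehlerDifferential.map R P A A ∘ₗ l = LinearMap.id) ↔
      ∃ l, l ∘ₗ mapBaseChange R P A = LinearMap.id := tfae.out 0 1
    -- The retraction splits the sequence of differentials, so the relative differentials are a
    -- summand of the projective module Ω[A⁄R].
    obtain ⟨l, hl⟩ := h01.2 ⟨ρ, hρ⟩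
    exact Module.Projective.of_split l _ hl
  -- Since the base-changed differentials inject, the connecting map vanishes; every class then
  -- comes from the first cotangent homology of A over R, which is zero.
  · refine subsingleton_of_forall_eq 0 fun x => ?_
    have h1 : Algebra.H1Cotangent.δ R P A x = 0 :=
      hinj ((Algebra.H1Cotangent.exact_δ_mapBaseChange R P A _).2 ⟨x, rfl⟩ |>.trans (map_zero _).symm)
    obtain ⟨y, rfl⟩ := (Algebra.H1Cotangent.exact_map_δ R P A x).1 h1
    rw [Subsingleton.elim y 0, map_zero]

/-- The equational criterion: a relation in a flat module comes from relations in the base ring. -/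
lemma Module.Flat.exists_of_sum_smul_eq_zero {P A ι : Type*} [CommRing P] [CommRing A]
    [Algebra P A] [Module.Flat P A] [Fintype ι] (f : ι → P) (x : ι → A)
    (hx : ∑ o, f o • x o = 0) :
    ∃ (n : ℕ) (p : ι → Fin n → P) (y : Fin n → A),
      (∀ o, x o = ∑ j, p o j • y j) ∧ ∀ j, ∑ o, f o * p o j = 0 := by
  have h : Module.IsTrivialRelation f x := Module.Flat.isTrivialRelation_of_sum_smul_eq_zero hx
  exact h

/-- Membership in an ideal of variables is decided monomial by monomial, and multiplication by X_k
does not change the exponents of the smaller variables. -/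
lemma MvPolynomial.mem_span_X_of_X_mul_mem {R σ : Type*} [CommRing R] [Preorder σ] {k : σ}
    {p : MvPolynomial σ R}
    (hp : MvPolynomial.X k * p ∈ Ideal.span (MvPolynomial.X '' Set.Iio k)) :
    p ∈ Ideal.span (MvPolynomial.X '' Set.Iio k : Set (MvPolynomial σ R)) := by
  rw [MvPolynomial.mem_ideal_span_X_image] at hp ⊢
  intro m hm
  obtain ⟨i, hi, hmi⟩ := hp (Finsupp.single k 1 + m) (by
    rw [MvPolynomial.mem_support_iff, MvPolynomial.coeff_X_mul]
    exact MvPolynomial.mem_support_iff.1 hm)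
  refine ⟨i, hi, fun h0 => hmi ?_⟩
  rw [Finsupp.add_apply, h0, Finsupp.single_eq_of_ne (ne_of_lt hi)]

/-- The images of the variables in a flat algebra over a polynomial ring form a weakly regular
sequence. -/
theorem Koszul.isWeaklyRegular_of_flat {R A : Type u} [CommRing R] [CommRing A] {c : ℕ}
    [Algebra (MvPolynomial (Fin c) R) A] [Module.Flat (MvPolynomial (Fin c) R) A] :
    Koszul.IsWeaklyRegular fun i => algebraMap (MvPolynomial (Fin c) R) A (MvPolynomial.X i) := by
  intro k a ha
  simp only [Set.image_eq_range] at ha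
  obtain ⟨b, hb⟩ := Ideal.mem_span_range_iff_exists_fun.1 ha
  -- The relation `X_k a = ∑ X_i b_i`, with `none` standing for k. Flatness writes a as a
  -- combination of polynomials p satisfying such a relation, and these lie in the ideal of the
  -- smaller variables.
  let X : Option (Set.Iio k) → MvPolynomial (Fin c) R :=
    fun o => o.elim (MvPolynomial.X k) fun i => MvPolynomial.X i.1
  have hx : ∑ o, X o • (o.elim a fun i => -b i : A) = 0 := by
    rw [Fintype.sum_option]
    simp only [X, Option.elim_none, Option.elim_some, Algebra.smul_def, mul_neg,
      Finset.sum_neg_distrib]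
    rw [← hb, add_neg_eq_zero]
    exact Finset.sum_congr rfl fun i _ => mul_comm _ _
  obtain ⟨n, p, y, hy, hp⟩ := Module.Flat.exists_of_sum_smul_eq_zero X _ hx
  have hmem (j) : p none j ∈ Ideal.span (MvPolynomial.X '' Set.Iio k) := by
    have h1 := hp j
    rw [Fintype.sum_option] at h1
    have h2 : MvPolynomial.X k * p none j ∈ Ideal.span (MvPolynomial.X '' Set.Iio k) := by
      refine (eq_neg_of_add_eq_zero_left h1).symm ▸ neg_mem ?_
      exact Ideal.sum_mem _ fun i _ => Ideal.mul_mem_right _ _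
        (Ideal.subset_span ⟨i.1, i.2, rfl⟩)
    exact MvPolynomial.mem_span_X_of_X_mul_mem h2
  have h3 : a = ∑ j, p none j • y j := hy none
  rw [h3]
  refine Ideal.sum_mem _ fun j _ => ?_
  rw [Algebra.smul_def]
  refine Ideal.mul_mem_right _ _ ?_
  have := Ideal.mem_map_of_mem (algebraMap (MvPolynomial (Fin c) R) A) (hmem j)
  rwa [Ideal.map_span, Set.image_image] at this

/-- Functions with linearly independent differentials on a smooth affine scheme form a weakly
regular sequence. -/
theorem Koszul.isWeaklyRegular_of_kaehlerDifferential_retraction {R A : Type u} [CommRing R]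
    [CommRing A] [Algebra R A] [Algebra.Smooth R A] {c : ℕ} (f : Fin c → A)
    (r : Ω[A⁄R] →ₗ[A] (Fin c → A)) (hr : ∀ i, r (D R A (f i)) = Pi.single i 1) :
    Koszul.IsWeaklyRegular f := by
  let _ : Algebra (MvPolynomial (Fin c) R) A := (MvPolynomial.aeval f).toAlgebra
  have : IsScalarTower R (MvPolynomial (Fin c) R) A :=
    IsScalarTower.of_algebraMap_eq' (MvPolynomial.aeval f).comp_algebraMap.symm
  have hX (i) : algebraMap (MvPolynomial (Fin c) R) A (MvPolynomial.X i) = f i :=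
    MvPolynomial.aeval_X f i
  have : Algebra.FormallySmooth (MvPolynomial (Fin c) R) A :=
    .of_kaehlerDifferential_retraction r fun i => by rw [hX, hr]
  have : Algebra.FinitePresentation (MvPolynomial (Fin c) R) A :=
    .of_restrict_scalars_finitePresentation R _ A
  have : Algebra.Smooth (MvPolynomial (Fin c) R) A := { }
  have := Koszul.isWeaklyRegular_of_flat (R := R) (A := A) (c := c)
  simpa only [hX] using this

/-- Functions with linearly independent differentials on a basic open subset of a smooth affine
scheme form a weakly regular sequence there. -/
theorem Koszul.isWeaklyRegular_of_isLocalizationAway {R A A' : Type u} [CommRing R] [CommRing A]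
    [CommRing A'] [Algebra R A] [Algebra A A'] [Algebra R A'] [IsScalarTower R A A']
    [Algebra.Smooth R A] {c : ℕ} (f : Fin c → A) (g a : A) (r : Ω[A⁄R] →ₗ[A] (Fin c → A))
    (hr : ∀ i, r (D R A (f i)) = g • Pi.single i 1) [IsLocalization.Away a A']
    (hg : IsUnit (algebraMap A A' g)) :
    Koszul.IsWeaklyRegular fun i => algebraMap A A' (f i) := by
  have : Algebra.Smooth A A' := .of_isLocalization_Away a
  have : Algebra.FormallyEtale A A' := .of_isLocalization (.powers a)
  have : Algebra.Smooth R A' := .comp R A A'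
  obtain ⟨u, hu⟩ := hg
  let q : (Fin c → A) →ₗ[A] (Fin c → A') := LinearMap.pi fun i =>
    Algebra.linearMap A A' ∘ₗ LinearMap.proj i
  -- Localization is étale, so the differentials of A' are the base change of those of A and r
  -- extends; dividing by the unit g turns it into a retraction.
  let r₁ : Ω[A'⁄R] →ₗ[A'] (Fin c → A') :=
    (IsBaseChange.lift (KaehlerDifferential.isBaseChange_of_formallyEtale R A A') (q ∘ₗ r))
  refine Koszul.isWeaklyRegular_of_kaehlerDifferential_retraction (R := R) _
    ((↑u⁻¹ : A') • r₁) fun i => ?_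
  have h1 : r₁ (D R A' (algebraMap A A' (f i))) = q (r (D R A (f i))) := by
    rw [← KaehlerDifferential.map_D R R A A']
    exact IsBaseChange.lift_eq _ _ _
  rw [LinearMap.smul_apply, h1, hr, map_smul]
  ext j
  have h2 : algebraMap A A' ((Pi.single i 1 : Fin c → A) j) = (Pi.single i 1 : Fin c → A') j := by
    rw [Pi.single_apply, Pi.single_apply]
    split_ifs <;> simp
  change (↑u⁻¹ : A') * (g • algebraMap A A' ((Pi.single i 1 : Fin c → A) j)) = _
  rw [h2, Algebra.smul_def, ← hu, Units.inv_mul_cancel_left]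

/-! ### Smooth closed subschemes are locally cut out by weakly regular sequences -/

namespace AlgebraicGeometry

open LocallyRingedSpace

/-- Outside the image of a morphism with closed image, the unit ideal cuts out the empty
subspace. -/
lemma LocallyRingedSpace.exists_isKoszulNear_of_notMem_range {X Y : LocallyRingedSpace.{u}}
    (j : X ⟶ Y) (hj : IsClosed (Set.range j.base)) {p : Y} (hp : p ∉ Set.range j.base) :
    ∃ (V : Opens Y) (c : ℕ) (f : Fin c → Fun V), p ∈ V ∧ IsKoszulNear j V f := by
  refine ⟨⟨(Set.range j.base)ᶜ, hj.isOpen_compl⟩, 1, fun _ => 1, hp, fun W hW q hq =>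
    ⟨W, hW, le_rfl, hq, ?_⟩⟩
  have hbot : preim j W = ⊥ := by
    refine eq_bot_iff.2 fun x hx => ?_
    exact hW hx ⟨x, rfl⟩
  have : Subsingleton (Fun (preim j W)) := by
    rw [hbot]
    exact CommRingCat.subsingleton_of_isTerminal X.sheaf.isTerminalOfEmpty
  have hspan : Ideal.span (Set.range fun _ : Fin 1 => resFun hW (1 : Fun _)) = ⊤ := by
    rw [Ideal.eq_top_iff_one]
    exact Ideal.subset_span ⟨0, map_one _⟩
  refine ⟨fun x => ⟨0, Subsingleton.elim _ _⟩, fun a => ?_, fun k a ha => ?_⟩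
  · rw [hspan]
    exact ⟨fun _ => trivial, fun _ => Subsingleton.elim _ _⟩
  · rwa [map_one, one_mul] at ha

/-- On an affine neighbourhood U of a point of T, choose f and g by
`Algebra.Smooth.exists_generators_ker`. Over the basic open set of g the differentials of the f i
are independent and the f i generate the ideal of T; both persist on the smaller basic open sets of
U, which form a basis there. -/
lemma isLocallyKoszul_of_smooth {k : Type u} [Field k] {X T : Scheme.{u}}
    (p : X ⟶ Spec (CommRingCat.of k)) (j : T ⟶ X) [Smooth p] [IsClosedImmersion j]
    [Smooth (j ≫ p)] : LocallyRingedSpace.IsLocallyKoszul j.toLRSHom := by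
  intro x
  by_cases hx : x ∈ Set.range j.toLRSHom.base
  swap
  · exact exists_isKoszulNear_of_notMem_range _ j.isClosedEmbedding.isClosed_range hx
  obtain ⟨t, rfl⟩ := hx
  obtain ⟨U, hU, hxU, -⟩ := exists_isAffineOpen_mem_and_subset (X := X) (x := j t) (U := ⊤) trivial
  have htU : t ∈ j ⁻¹ᵁ U := hxU
  have hjU : IsAffineOpen (j ⁻¹ᵁ U) := hU.preimage j
  have hS : IsAffineOpen (⊤ : (Spec (CommRingCat.of k)).Opens) := isAffineOpen_top _
  have sA := p.smooth_appLE hS hU le_top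
  have sB := (j ≫ p).smooth_appLE hS hjU le_top
  have hcomp : (j ≫ p).appLE ⊤ (j ⁻¹ᵁ U) le_top = p.appLE ⊤ U le_top ≫ j.app U := by
    simp only [Scheme.Hom.appLE, Scheme.Hom.comp_app]
    exact congrArg (p.app ⊤ ≫ ·) (j.naturality _).symm
  let _ : Algebra Γ(Spec (CommRingCat.of k), ⊤) Γ(X, U) := (p.appLE ⊤ U le_top).hom.toAlgebra
  let _ : Algebra Γ(X, U) Γ(T, j ⁻¹ᵁ U) := (j.app U).hom.toAlgebra
  let _ : Algebra Γ(Spec (CommRingCat.of k), ⊤) Γ(T, j ⁻¹ᵁ U) :=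
    ((j ≫ p).appLE ⊤ (j ⁻¹ᵁ U) le_top).hom.toAlgebra
  have : IsScalarTower Γ(Spec (CommRingCat.of k), ⊤) Γ(X, U) Γ(T, j ⁻¹ᵁ U) :=
    IsScalarTower.of_algebraMap_eq' (congrArg CommRingCat.Hom.hom hcomp)
  have : Algebra.Smooth Γ(Spec (CommRingCat.of k), ⊤) Γ(X, U) := sA
  have : Algebra.Smooth Γ(Spec (CommRingCat.of k), ⊤) Γ(T, j ⁻¹ᵁ U) := sB
  -- The prime of the point t, so that `g ∉ Q` means that g does not vanish at t.
  let Q : Ideal Γ(T, j ⁻¹ᵁ U) := (IsLocalRing.maximalIdeal (T.presheaf.stalk t)).comap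
    (T.presheaf.germ (j ⁻¹ᵁ U) t htU).hom
  have hQ : Q.IsPrime := Ideal.IsPrime.comap _
  obtain ⟨c, f, g, r, hgQ, hf, hfs, hr⟩ :=
    Algebra.Smooth.exists_generators_ker (R := Γ(Spec (CommRingCat.of k), ⊤))
      (j.app_surjective U hU) Q
  have htg : t ∈ T.basicOpen (j.app U g) := by
    rw [Scheme.mem_basicOpen _ _ _ htU]
    by_contra h
    exact hgQ h
  have hVU : X.basicOpen g ≤ U := X.basicOpen_le g
  refine ⟨X.basicOpen g, c, fun i => resFun hVU (f i), ?_, fun W hW y hy => ?_⟩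
  · rw [← Scheme.preimage_basicOpen] at htg
    exact htg
  obtain ⟨a, haW, hya⟩ := hU.exists_basicOpen_le ⟨y, hy⟩ (hVU (hW hy))
  have haU : X.basicOpen a ≤ U := X.basicOpen_le a
  refine ⟨X.basicOpen a, haW.trans hW, haW, hya, ?_⟩
  have hloc := hU.isLocalization_basicOpen a
  have hsurj := j.app_surjective (X.basicOpen a) (hU.basicOpen a)
  have hga : IsUnit (resFun (X := X.toLocallyRingedSpace) haU g) := by
    have := RingedSpace.isUnit_res_basicOpen _ g
    rw [← resFun_resFun (hVU) (haW.trans hW)]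
    exact this.map (resFun (X := X.toLocallyRingedSpace) (haW.trans hW))
  have haa : IsUnit (resFun (X := X.toLocallyRingedSpace) haU a) :=
    RingedSpace.isUnit_res_basicOpen _ a
  have hres (i : Fin c) : resFun (X := X.toLocallyRingedSpace) (haW.trans hW)
      (resFun hVU (f i)) = resFun haU (f i) := resFun_resFun ..
  simp only [hres]
  refine ⟨hsurj, fun b => ⟨fun hb => ?_, fun hb => ?_⟩, ?_⟩
  -- Write b as x divided by a power of a. If b vanishes on T, then some `a ^ m * x` does so over
  -- all of U, hence `g * (a ^ m * x)` lies in the ideal of the f i; over the basic open set of a,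
  -- both a and g are units.
  · obtain ⟨n, x, hx⟩ := IsLocalization.Away.surj a b
    have hx' : b * resFun (X := X.toLocallyRingedSpace) haU a ^ n =
      resFun (X := X.toLocallyRingedSpace) haU x := hx
    have h0 : resFun (X := T.toLocallyRingedSpace) (preim_mono j.toLRSHom haU)
        (comor j.toLRSHom U x) = 0 := by
      rw [resFun_comor j.toLRSHom haU, ← hx', map_mul, hb, zero_mul]
    obtain ⟨m, hm⟩ : ∃ m, comor j.toLRSHom U (a ^ m * x) = 0 := by
      have hle : T.basicOpen (j.app U a) ≤ preim j.toLRSHom (X.basicOpen a) :=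
        (Scheme.preimage_basicOpen j a).ge
      have h0' : resFun (X := T.toLocallyRingedSpace) (T.basicOpen_le (j.app U a))
          (comor j.toLRSHom U x) = 0 :=
        (resFun_resFun (preim_mono j.toLRSHom haU) hle (comor j.toLRSHom U x)).symm.trans
          ((congrArg _ h0).trans (map_zero _))
      obtain ⟨m, hm⟩ := exists_pow_mul_eq_zero_of_res_basicOpen_eq_zero_of_isAffineOpen T hjU
        (j.app U x) (j.app U a) h0'
      exact ⟨m, by rw [map_mul, map_pow]; exact hm⟩
    have h1 := Ideal.mem_map_of_mem (resFun (X := X.toLocallyRingedSpace) haU) (hfs _ hm)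
    rw [Ideal.map_span, ← Set.range_comp, map_mul, map_mul, map_pow, ← hx'] at h1
    refine (Ideal.unit_mul_mem_iff_mem _ ((hga.mul (haa.pow m)).mul (haa.pow n))).1 ?_
    convert! h1 using 1
    ring
  · have : Ideal.span (Set.range fun i => resFun (X := X.toLocallyRingedSpace) haU (f i)) ≤
        RingHom.ker (comor j.toLRSHom (X.basicOpen a)) := by
      rw [Ideal.span_le]
      rintro _ ⟨i, rfl⟩
      change comor j.toLRSHom _ (resFun haU (f i)) = 0
      rw [← resFun_comor j.toLRSHom haU]
      exact (congrArg _ (hf i)).trans (map_zero _)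
    exact this hb
  · let _ : Algebra Γ(X, U) Γ(X, X.basicOpen a) := 
      (resFun (X := X.toLocallyRingedSpace) haU).toAlgebra
    let _ : Algebra Γ(Spec (CommRingCat.of k), ⊤) Γ(X, X.basicOpen a) :=
      ((algebraMap Γ(X, U) Γ(X, X.basicOpen a)).comp
        (algebraMap Γ(Spec (CommRingCat.of k), ⊤) Γ(X, U))).toAlgebra
    have : IsScalarTower Γ(Spec (CommRingCat.of k), ⊤) Γ(X, U) Γ(X, X.basicOpen a) :=
      IsScalarTower.of_algebraMap_eq' rfl
    have : IsLocalization.Away a Γ(X, X.basicOpen a) := hloc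
    exact Koszul.isWeaklyRegular_of_isLocalizationAway f g a r hr hga

end AlgebraicGeometry

/-! ### Hadamard's lemma for holomorphic functions -/

namespace HadamardLemma

open Set

variable {Z : Type} [NormedAddCommGroup Z] [NormedSpace ℂ Z]
  {H : Type} [NormedAddCommGroup H] [NormedSpace ℂ H]

/-- Differentiation under the integral sign for integrands which are continuously differentiable
in the parameter. -/
lemma hasFDerivAt_integral [ProperSpace Z] {D : Set Z} (hD : IsOpen D) {K : Z → ℝ → H}
    {K' : Z → ℝ → Z →L[ℂ] H} (hK : ∀ x ∈ D, ContinuousOn (K x) (Icc 0 1))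
    (hK' : ContinuousOn (fun p : Z × ℝ => K' p.1 p.2) (D ×ˢ Icc 0 1))
    (hd : ∀ x ∈ D, ∀ t ∈ Icc (0 : ℝ) 1, HasFDerivAt (K · t) (K' x t) x) {x : Z} (hx : x ∈ D) :
    HasFDerivAt (fun x => ∫ t in (0 : ℝ)..1, K x t) (∫ t in (0 : ℝ)..1, K' x t) x := by
  obtain ⟨r, hr, hrD⟩ := Metric.nhds_basis_closedBall.mem_iff.1 (hD.mem_nhds hx)
  have hcomp : IsCompact (Metric.closedBall x r ×ˢ Icc (0 : ℝ) 1) :=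
    (isCompact_closedBall x r).prod isCompact_Icc
  obtain ⟨C, hC⟩ := hcomp.exists_bound_of_continuousOn
    (hK'.mono (prod_mono hrD subset_rfl))
  have hI : uIoc (0 : ℝ) 1 ⊆ Icc 0 1 := by
    rw [uIoc_of_le zero_le_one]
    exact Ioc_subset_Icc_self
  have hK'x : ContinuousOn (K' x) (Icc 0 1) :=
    hK'.comp (continuousOn_const.prodMk continuousOn_id) fun t ht => ⟨hx, ht⟩
  refine intervalIntegral.hasFDerivAt_integral_of_dominated_of_fderiv_le
    (Metric.closedBall_mem_nhds x hr) ?_ ?_ ?_ (bound := fun _ => C) ?_ ?_ ?_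
  · filter_upwards [hD.mem_nhds hx] with y hy
    exact ((hK y hy).mono hI).aestronglyMeasurable measurableSet_uIoc
  · exact ContinuousOn.intervalIntegrable (by rw [uIcc_of_le zero_le_one]; exact hK x hx)
  · exact (hK'x.mono hI).aestronglyMeasurable measurableSet_uIoc
  · exact Filter.Eventually.of_forall fun t ht y hy => hC (y, t) ⟨hy, hI ht⟩
  · exact intervalIntegrable_const
  · exact Filter.Eventually.of_forall fun t ht y hy => hd y (hrD hy) t (hI ht)

/-- The endomorphism `1 - R + t R`, which contracts the image of a projection `R` by the
factor `t`. -/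
def contraction (R : Z →L[ℂ] Z) (t : ℝ) : Z →L[ℂ] Z :=
  ContinuousLinearMap.id ℂ Z - R + (t : ℂ) • R

lemma continuous_contraction (R : Z →L[ℂ] Z) : Continuous (contraction R) := by
  unfold contraction
  fun_prop

/-- Differentiating under the integral gives two integrals of the same form, with F replaced by its
derivative and the weight w by w and by w t, composed with fixed linear maps. Arbitrary weights and
target spaces are therefore needed for the induction on n. -/
lemma contDiffOn_integral [CompleteSpace H] [ProperSpace Z] {D : Set Z} (hD : IsOpen D) (R : Z →L[ℂ] Z)
    (hR : ∀ x ∈ D, ∀ t ∈ Icc (0 : ℝ) 1, contraction R t x ∈ D) (n : ℕ) (F : Z → H)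
    (hF : ContDiffOn ℂ ∞ F D) (w : ℝ → ℂ) (hw : Continuous w) :
    ContDiffOn ℂ n (fun x => ∫ t in (0 : ℝ)..1, w t • F (contraction R t x)) D := by
  have hcont {H : Type} [NormedAddCommGroup H] [NormedSpace ℂ H] [CompleteSpace H] (F : Z → H)
      (hF : ContDiffOn ℂ ∞ F D) (w : ℝ → ℂ) (hw : Continuous w) :
      ContinuousOn (fun p : Z × ℝ => w p.2 • F (contraction R p.2 p.1)) (D ×ˢ Icc 0 1) := by
    refine (hw.comp continuous_snd).continuousOn.smul (hF.continuousOn.comp ?_ ?_)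
    · exact (((continuous_contraction R).comp continuous_snd).clm_apply
        continuous_fst).continuousOn
    · exact fun p hp => hR p.1 hp.1 p.2 hp.2
  have hcontx {H : Type} [NormedAddCommGroup H] [NormedSpace ℂ H] [CompleteSpace H] (F : Z → H)
      (hF : ContDiffOn ℂ ∞ F D) (w : ℝ → ℂ) (hw : Continuous w) (x : Z) (hx : x ∈ D) :
      ContinuousOn (fun t : ℝ => w t • F (contraction R t x)) (Icc 0 1) :=
    (hcont F hF w hw).comp (continuousOn_const.prodMk continuousOn_id) fun t ht => ⟨hx, ht⟩
  have hderiv {H : Type} [NormedAddCommGroup H] [NormedSpace ℂ H] [CompleteSpace H] (F : Z → H)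
      (hF : ContDiffOn ℂ ∞ F D) (w : ℝ → ℂ) (hw : Continuous w) (x : Z) (hx : x ∈ D) :
      HasFDerivAt (fun x => ∫ t in (0 : ℝ)..1, w t • F (contraction R t x))
        ((∫ t in (0 : ℝ)..1, w t • fderiv ℂ F (contraction R t x)).comp
          (ContinuousLinearMap.id ℂ Z - R) +
        (∫ t in (0 : ℝ)..1, (w t * t) • fderiv ℂ F (contraction R t x)).comp R) x := by
    have hF' : ContDiffOn ℂ ∞ (fderiv ℂ F) D := hF.fderiv_of_isOpen hD (by simp)
    have hw' : Continuous fun t : ℝ => w t * t := by fun_prop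
    have h1 := hasFDerivAt_integral hD (K := fun x t => w t • F (contraction R t x))
      (K' := fun x t => (w t • fderiv ℂ F (contraction R t x)).comp (contraction R t))
      (hcontx F hF w hw) ?_ ?_ hx
    · convert! h1 using 1
      have e1 : ∀ t : ℝ, (w t • fderiv ℂ F (contraction R t x)).comp (contraction R t) =
          (ContinuousLinearMap.compL ℂ Z Z H).flip (ContinuousLinearMap.id ℂ Z - R)
            (w t • fderiv ℂ F (contraction R t x)) +
          (ContinuousLinearMap.compL ℂ Z Z H).flip R
            ((w t * t) • fderiv ℂ F (contraction R t x)) := by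
        intro t
        ext y
        simp [contraction, mul_smul, smul_sub, smul_comm (w t) t]
      have hii {H' : Type} [NormedAddCommGroup H'] [NormedSpace ℂ H'] [CompleteSpace H'] (G : Z → H')
          (hG : ContDiffOn ℂ ∞ G D) (v : ℝ → ℂ) (hv : Continuous v) :
          IntervalIntegrable (fun t : ℝ => v t • G (contraction R t x)) MeasureTheory.volume 0 1 :=
        ContinuousOn.intervalIntegrable (by
          rw [uIcc_of_le zero_le_one]
          exact hcontx G hG v hv x hx)
      have i1 := ContinuousLinearMap.intervalIntegral_comp_comm
        ((ContinuousLinearMap.compL ℂ Z Z H).flip (ContinuousLinearMap.id ℂ Z - R))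
        (hii _ hF' w hw)
      have i2 := ContinuousLinearMap.intervalIntegral_comp_comm
        ((ContinuousLinearMap.compL ℂ Z Z H).flip R) (hii _ hF' _ hw')
      rw [intervalIntegral.integral_congr fun t _ => e1 t, intervalIntegral.integral_add, i1, i2]
      · rfl
      · exact ContinuousOn.intervalIntegrable (ContinuousLinearMap.continuous _
          |>.comp_continuousOn (by rw [uIcc_of_le zero_le_one]; exact hcontx _ hF' w hw x hx))
      · exact ContinuousOn.intervalIntegrable (ContinuousLinearMap.continuous _
          |>.comp_continuousOn (by rw [uIcc_of_le zero_le_one]; exact hcontx _ hF' _ hw' x hx))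
    · exact (hcont _ hF' w hw).clm_comp
        ((continuous_contraction R).comp continuous_snd).continuousOn
    · intro y hy t ht
      have h2 : HasFDerivAt F (fderiv ℂ F (contraction R t y)) (contraction R t y) :=
        ((hF.differentiableOn (by simp)).differentiableAt
          (hD.mem_nhds (hR y hy t ht))).hasFDerivAt
      exact (h2.comp y (contraction R t).hasFDerivAt).const_smul (w t)
  induction n generalizing H w with
  | zero =>
    exact contDiffOn_zero.2 fun x hx =>
      (hderiv F hF w hw x hx).continuousAt.continuousWithinAt
  | succ n ih =>
    rw [Nat.cast_succ, contDiffOn_succ_iff_fderiv_of_isOpen hD]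
    refine ⟨fun x hx => (hderiv F hF w hw x hx).differentiableAt.differentiableWithinAt,
      by simp, ?_⟩
    refine ContDiffOn.congr ?_ fun x hx => (hderiv F hF w hw x hx).fderiv
    have hF' : ContDiffOn ℂ ∞ (fderiv ℂ F) D := hF.fderiv_of_isOpen hD (by simp)
    exact ((ih _ hF' w hw).clm_comp contDiffOn_const).add
      ((ih _ hF' (fun t => w t * t) (by fun_prop)).clm_comp contDiffOn_const)

/-- Hadamard's lemma: a smooth function is the sum of its restriction to a coordinate subspace and
of multiples of the coordinates. -/
theorem exists_eq_add_sum [ProperSpace Z] {ι : Type} (s : Finset ι) (v : ι → Z →L[ℂ] ℂ) (e : ι → Z)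
    {D : Set Z} (hD : IsOpen D) (R : Z →L[ℂ] Z) (hRv : ∀ x, R x = ∑ i ∈ s, v i x • e i)
    (hR : ∀ x ∈ D, ∀ t ∈ Icc (0 : ℝ) 1, contraction R t x ∈ D) (g : Z → ℂ)
    (hg : ContDiffOn ℂ ∞ g D) :
    ∃ q : ι → Z → ℂ, (∀ i, ContDiffOn ℂ ∞ (q i) D) ∧
      ∀ x ∈ D, g x = g (x - R x) + ∑ i ∈ s, v i x * q i x := by
  have hg' : ContDiffOn ℂ ∞ (fderiv ℂ g) D := hg.fderiv_of_isOpen hD (by simp)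
  have hgi (i) : ContDiffOn ℂ ∞ (fun x => fderiv ℂ g x (e i)) D := hg'.clm_apply contDiffOn_const
  have hc (i) (x) (hx : x ∈ D) : IntervalIntegrable
      (fun t : ℝ => fderiv ℂ g (contraction R t x) (e i)) MeasureTheory.volume 0 1 := by
    refine ContinuousOn.intervalIntegrable ?_
    rw [uIcc_of_le zero_le_one]
    exact (hgi i).continuousOn.comp (((continuous_contraction R).clm_apply
      continuous_const).continuousOn) fun t ht => hR x hx t ht
  -- The fundamental theorem of calculus along the segment from `x - R x` (t = 0) to x (t = 1),
  -- whose velocity is R x.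
  refine ⟨fun i x => ∫ t in (0 : ℝ)..1, fderiv ℂ g (contraction R t x) (e i), fun i => ?_,
    fun x hx => ?_⟩
  · refine contDiffOn_infty.2 fun n => ?_
    simpa using contDiffOn_integral hD R hR n _ (hgi i) (fun _ => 1) continuous_const
  · have hder (t : ℝ) (ht : t ∈ Icc (0 : ℝ) 1) : HasDerivAt (fun t : ℝ => g (contraction R t x))
        (∑ i ∈ s, v i x • fderiv ℂ g (contraction R t x) (e i)) t := by
      have h1 : HasFDerivAt g (fderiv ℂ g (contraction R t x)) (contraction R t x) :=
        ((hg.differentiableOn (by simp)).differentiableAt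
          (hD.mem_nhds (hR x hx t ht))).hasFDerivAt
      have h2 : HasDerivAt (fun t : ℝ => contraction R t x) (R x) t := by
        have h3 : HasDerivAt (fun t : ℝ => (t : ℂ) • R x) ((1 : ℂ) • R x) t :=
          (Complex.ofRealCLM.hasDerivAt (x := t)).smul_const (R x)
        rw [one_smul] at h3
        exact h3.const_add (x - R x)
      have h4 := (h1.restrictScalars ℝ).comp_hasDerivAt t h2
      convert! h4 using 1
      simp [hRv x]
    have hcv (i) : IntervalIntegrable (fun t : ℝ => v i x • fderiv ℂ g (contraction R t x) (e i))
        MeasureTheory.volume 0 1 := (hc i x hx).smul (v i x)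
    have hsum : IntervalIntegrable
        (fun t : ℝ => ∑ i ∈ s, v i x • fderiv ℂ g (contraction R t x) (e i))
        MeasureTheory.volume 0 1 := by
      simpa only [Finset.sum_fn] using IntervalIntegrable.sum s fun i _ => hcv i
    have hint := intervalIntegral.integral_eq_sub_of_hasDerivAt
      (f := fun t : ℝ => g (contraction R t x))
      (f' := fun t : ℝ => ∑ i ∈ s, v i x • fderiv ℂ g (contraction R t x) (e i))
      (a := 0) (b := 1) (fun t ht => hder t (by rwa [uIcc_of_le zero_le_one] at ht))
      hsum
    rw [intervalIntegral.integral_finsetSum fun i _ => hcv i] at hint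
    have h0 : contraction R 0 x = x - R x := by simp [contraction]
    have h1 : contraction R 1 x = x := by simp [contraction]
    rw [h0, h1] at hint
    rw [eq_comm, ← eq_sub_iff_add_eq', ← hint]
    refine Finset.sum_congr rfl fun i _ => ?_
    rw [intervalIntegral.integral_smul, smul_eq_mul]

end HadamardLemma

/-! ### Closed complex submanifolds are locally cut out by coordinates -/

namespace ComplexManifold

open LocallyRingedSpace

section Functions

variable {E F : Type} [NormedAddCommGroup E] [NormedSpace ℂ E]
  [NormedAddCommGroup F] [NormedSpace ℂ F]
  {M N : Type} [TopologicalSpace M] [ChartedSpace E M] [TopologicalSpace N] [ChartedSpace F N]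

/-- The value of a function at a point. -/
def eval {U : Opens (ringedSpace E M)} (y : M) (hy : y ∈ U) :
    Fun (X := ringedSpace E M) U →+* ℂ :=
  (smoothSheafCommRing.evalAt 𝓘(ℂ, E) 𝓘(ℂ) M ℂ y ⟨U, hy⟩).hom

lemma fun_ext {U : Opens (ringedSpace E M)} {a b : Fun (X := ringedSpace E M) U}
    (h : ∀ (y : M) (hy : y ∈ U), eval y hy a = eval y hy b) : a = b :=
  Subtype.ext (funext fun y => h y.1 y.2)

lemma eval_resFun {U V : Opens (ringedSpace E M)} (h : V ≤ U) (a : Fun (X := ringedSpace E M) U)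
    (y : M) (hy : y ∈ V) : eval y hy (resFun h a) = eval y (h hy) a :=
  rfl

lemma eval_comor {f : M → N} (hf : IsHolomorphic E F f) (U : Opens (ringedSpace F N))
    (a : Fun (X := ringedSpace F N) U) (y : M) (hy : f y ∈ U) :
    eval y hy (comor (ComplexManifold.map f hf) U a) = eval (f y) hy a :=
  rfl

lemma exists_eval_eq {U : Opens (ringedSpace E M)} (g : M → ℂ)
    (hg : ∀ y ∈ U, ContMDiffAt 𝓘(ℂ, E) 𝓘(ℂ) ∞ g y) :
    ∃ a : Fun (X := ringedSpace E M) U, ∀ (y : M) (hy : y ∈ U), eval y hy a = g y :=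
  ⟨⟨fun y => g y.1, fun y => contMDiffAt_subtype_iff.2 (hg y.1 y.2)⟩, fun _ _ => rfl⟩

-- Extension by zero outside U; smoothness is claimed only at the points of U, where it is
-- unaffected by the values elsewhere.
open Classical in
lemma exists_contMDiffAt_eval_eq {U : Opens (ringedSpace E M)}
    (a : Fun (X := ringedSpace E M) U) :
    ∃ g : M → ℂ, (∀ y ∈ U, ContMDiffAt 𝓘(ℂ, E) 𝓘(ℂ) ∞ g y) ∧
      ∀ (y : M) (hy : y ∈ U), eval y hy a = g y := by
  have h (y : M) (hy : y ∈ U) : eval y hy a = if hy : y ∈ U then eval y hy a else 0 :=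
    (dif_pos (c := y ∈ U) (t := fun hy => eval y hy a) hy).symm
  refine ⟨fun y => if hy : y ∈ U then eval y hy a else 0, fun y hy => ?_, h⟩
  refine (contMDiffAt_subtype_iff (I := 𝓘(ℂ, E)) (M := M) (U := U) (x := ⟨y, hy⟩)).1 ?_
  have h2 : ContMDiff 𝓘(ℂ, E) 𝓘(ℂ) ∞ a.1 := a.2
  exact (h2 ⟨y, hy⟩).congr_of_eventuallyEq (Filter.Eventually.of_forall fun z => (h z.1 z.2).symm)

end Functions

section BallChart

variable {E F : Type} [NormedAddCommGroup E] [NormedSpace ℂ E]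
  [NormedAddCommGroup F] [NormedSpace ℂ F]
  {N : Type} [TopologicalSpace N] [ChartedSpace F N] {c : ℕ}

/-- The map `Ψ` identifies `W` with the ball of radius `r` around `z`. -/
structure IsBallChart (W : Opens (ringedSpace F N)) (Ψ : N → E × (Fin c → ℂ))
    (z : E × (Fin c → ℂ)) (r : ℝ) : Prop where
  exists_eval_eq (g : E × (Fin c → ℂ) → ℂ) : ContDiffOn ℂ ∞ g (Metric.ball z r) →
    ∃ a : Fun (X := ringedSpace F N) W, ∀ (y : N) (hy : y ∈ W), eval y hy a = g (Ψ y)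
  exists_contDiffOn (a : Fun (X := ringedSpace F N) W) : ∃ g : E × (Fin c → ℂ) → ℂ,
    ContDiffOn ℂ ∞ g (Metric.ball z r) ∧ ∀ (y : N) (hy : y ∈ W), eval y hy a = g (Ψ y)
  mapsTo (y : N) : y ∈ W → Ψ y ∈ Metric.ball z r
  surjOn (x : E × (Fin c → ℂ)) : x ∈ Metric.ball z r → ∃ y ∈ W, Ψ y = x

/-- The projection to the coordinates in `s`. -/
def coordProj (E : Type) [NormedAddCommGroup E] [NormedSpace ℂ E] (s : Finset (Fin c)) :
    (E × (Fin c → ℂ)) →L[ℂ] E × (Fin c → ℂ) :=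
  ∑ i ∈ s, ((ContinuousLinearMap.proj i).comp (ContinuousLinearMap.snd ℂ E (Fin c → ℂ))).smulRight
    ((0, Pi.single i 1) : E × (Fin c → ℂ))

lemma coordProj_apply (s : Finset (Fin c)) (x : E × (Fin c → ℂ)) :
    coordProj E s x = ∑ i ∈ s, x.2 i • ((0, Pi.single i 1) : E × (Fin c → ℂ)) := by
  simp [coordProj]

lemma coordProj_fst (s : Finset (Fin c)) (x : E × (Fin c → ℂ)) : (coordProj E s x).1 = 0 := by
  simp [coordProj_apply, Prod.fst_sum]

lemma coordProj_snd (s : Finset (Fin c)) (x : E × (Fin c → ℂ)) (i : Fin c) :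
    (coordProj E s x).2 i = if i ∈ s then x.2 i else 0 := by
  simp [coordProj_apply, Prod.snd_sum, Finset.sum_apply, Pi.single_apply]

/-- For the maximum norm a ball is a product, so coordinates may be replaced by 0 one by one as long
as 0 lies in the corresponding disc. -/
lemma sub_coordProj_mem_ball {s : Finset (Fin c)} {z x : E × (Fin c → ℂ)} {r : ℝ}
    (hs : ∀ i ∈ s, ‖z.2 i‖ < r) (hx : x ∈ Metric.ball z r) :
    x - coordProj E s x ∈ Metric.ball z r := by
  have hr : 0 < r := dist_nonneg.trans_lt hx
  rw [Metric.mem_ball, Prod.dist_eq, max_lt_iff, dist_pi_lt_iff hr] at hx ⊢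
  refine ⟨by simpa [coordProj_fst] using hx.1, fun i => ?_⟩
  rw [Prod.snd_sub, Pi.sub_apply, coordProj_snd]
  split_ifs with hi
  · rw [sub_self, dist_zero_left]
    exact hs i hi
  · rw [sub_zero]
    exact hx.2 i

lemma contraction_coordProj_mem_ball {s : Finset (Fin c)} {z x : E × (Fin c → ℂ)} {r : ℝ}
    (hs : ∀ i ∈ s, ‖z.2 i‖ < r) (hx : x ∈ Metric.ball z r) {t : ℝ} (ht : t ∈ Set.Icc (0 : ℝ) 1) :
    HadamardLemma.contraction (coordProj E s) t x ∈ Metric.ball z r := by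
  have h := convex_ball z r (sub_coordProj_mem_ball hs hx) hx (sub_nonneg.2 ht.2) ht.1
    (sub_add_cancel 1 t)
  convert! h using 1
  simp only [HadamardLemma.contraction, add_apply,
    sub_apply, ContinuousLinearMap.id_apply, smul_apply,
    Complex.coe_smul]
  module

variable {W : Opens (ringedSpace F N)} {Ψ : N → E × (Fin c → ℂ)} {z : E × (Fin c → ℂ)} {r : ℝ}
  {f : Fin c → Fun (X := ringedSpace F N) W}

/-- The ideal generated by coordinates consists of the functions vanishing where these coordinates
vanish. -/
lemma IsBallChart.mem_span_iff [FiniteDimensional ℂ E] (h : IsBallChart W Ψ z r)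
    (hf : ∀ (i : Fin c) (y : N) (hy : y ∈ W), eval y hy (f i) = (Ψ y).2 i) (s : Finset (Fin c))
    (a : Fun (X := ringedSpace F N) W) :
    a ∈ Ideal.span (f '' s) ↔
      ∀ (y : N) (hy : y ∈ W), (∀ i ∈ s, (Ψ y).2 i = 0) → eval y hy a = 0 := by
  refine ⟨fun ha y hy hys => ?_, fun ha => ?_⟩
  · have : Ideal.span (f '' s) ≤ RingHom.ker (eval y hy) := by
      rw [Ideal.span_le]
      rintro _ ⟨i, hi, rfl⟩
      exact (hf i y hy).trans (hys i hi)
    exact this ha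
  -- Either the ball meets the locus where the coordinates in s vanish, and Hadamard's lemma applies
  -- with zero constant term, or some coordinate in s has no zero on the ball and is a unit.
  by_cases hs : ∀ i ∈ s, ‖z.2 i‖ < r
  · obtain ⟨g, hg, hga⟩ := h.exists_contDiffOn a
    have : ProperSpace (E × (Fin c → ℂ)) := FiniteDimensional.proper ℂ _
    obtain ⟨q, hq, hgq⟩ := HadamardLemma.exists_eq_add_sum s
      (fun i => (ContinuousLinearMap.proj i).comp (ContinuousLinearMap.snd ℂ E (Fin c → ℂ)))
      (fun i => ((0, Pi.single i 1) : E × (Fin c → ℂ))) Metric.isOpen_ball (coordProj E s)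
      (coordProj_apply s) (fun x hx t ht => contraction_coordProj_mem_ball hs hx ht) g hg
    choose b hb using fun i => h.exists_eval_eq (q i) (hq i)
    have key : a = ∑ i ∈ s, f i * b i := by
      refine fun_ext fun y hy => ?_
      obtain ⟨y', hy', hyy'⟩ := h.surjOn _ (sub_coordProj_mem_ball hs (h.mapsTo y hy))
      have h0 : g (Ψ y - coordProj E s (Ψ y)) = 0 := by
        rw [← hyy', ← hga y' hy']
        refine ha y' hy' fun i hi => ?_
        rw [hyy', Prod.snd_sub, Pi.sub_apply, coordProj_snd, if_pos hi, sub_self]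
      rw [hga y hy, hgq _ (h.mapsTo y hy), h0, zero_add, map_sum]
      refine Finset.sum_congr rfl fun i _ => ?_
      rw [map_mul, hf, hb]
      rfl
    rw [key]
    exact Ideal.sum_mem _ fun i hi => Ideal.mul_mem_right _ _ (Ideal.subset_span ⟨i, hi, rfl⟩)
  · push Not at hs
    obtain ⟨i, hi, hir⟩ := hs
    have hne (x : E × (Fin c → ℂ)) (hx : x ∈ Metric.ball z r) : x.2 i ≠ 0 := by
      intro h0
      have hr : 0 < r := dist_nonneg.trans_lt hx
      rw [Metric.mem_ball, Prod.dist_eq, max_lt_iff, dist_pi_lt_iff hr] at hx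
      have := hx.2 i
      rw [h0, dist_zero_left] at this
      exact this.not_ge hir
    obtain ⟨b, hb⟩ := h.exists_eval_eq (fun x => (x.2 i)⁻¹)
      (ContDiffOn.inv (by fun_prop) hne)
    have key : a = f i * (b * a) := by
      refine fun_ext fun y hy => ?_
      rw [map_mul, map_mul, hf, hb, mul_inv_cancel_left₀ (hne _ (h.mapsTo y hy))]
    rw [key]
    exact Ideal.mul_mem_right _ _ (Ideal.subset_span ⟨i, hi, rfl⟩)

/-- If the k-th coordinate times a vanishes on the locus of the earlier coordinates, then a vanishes
there wherever the k-th coordinate is nonzero. These points are dense in the locus, so continuity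
finishes the argument. -/
lemma IsBallChart.isWeaklyRegular [FiniteDimensional ℂ E] (h : IsBallChart W Ψ z r)
    (hf : ∀ (i : Fin c) (y : N) (hy : y ∈ W), eval y hy (f i) = (Ψ y).2 i) :
    Koszul.IsWeaklyRegular f := by
  intro k a ha
  rw [← Finset.coe_Iio, h.mem_span_iff hf] at ha ⊢
  intro y hy hyk
  obtain ⟨g, hg, hga⟩ := h.exists_contDiffOn a
  have hg0 (x : E × (Fin c → ℂ)) (hx : x ∈ Metric.ball z r) (hxk : ∀ i ∈ Finset.Iio k, x.2 i = 0)
      (hne : x.2 k ≠ 0) : g x = 0 := by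
    obtain ⟨y', hy', rfl⟩ := h.surjOn x hx
    have := ha y' hy' hxk
    rw [map_mul, hf, hga] at this
    exact (mul_eq_zero.1 this).resolve_left hne
  rw [hga]
  by_cases hk : (Ψ y).2 k = 0
  swap
  · exact hg0 _ (h.mapsTo y hy) hyk hk
  -- Moves only the k-th coordinate away from 0, so it stays in the locus of the earlier
  -- coordinates.
  let γ : ℂ → E × (Fin c → ℂ) := fun ε => Ψ y + ε • (0, Pi.single k 1)
  have hγ : Continuous γ := by fun_prop
  have hγ0 : γ 0 = Ψ y := by simp [γ]
  have hball : Metric.ball z r ∈ nhds (γ 0) := by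
    rw [hγ0]
    exact Metric.isOpen_ball.mem_nhds (h.mapsTo y hy)
  have hlim : Filter.Tendsto (fun ε => g (γ ε)) (nhdsWithin 0 {0}ᶜ) (nhds (g (Ψ y))) := by
    rw [← hγ0]
    exact ((hg.continuousOn.continuousAt hball).comp hγ.continuousAt).tendsto.mono_left
      nhdsWithin_le_nhds
  refine tendsto_nhds_unique hlim (tendsto_const_nhds.congr' ?_)
  filter_upwards [self_mem_nhdsWithin, nhdsWithin_le_nhds (hγ.continuousAt hball)] with ε hε hεb
  refine (hg0 _ hεb (fun i hi => ?_) ?_).symm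
  · have hik : i ≠ k := (Finset.mem_Iio.1 hi).ne
    simp [γ, hyk i hi, hik]
  · simpa [γ, hk] using hε

/-- Criterion for a closed submanifold to be cut out by coordinates. -/
lemma IsBallChart.isKoszulOn [FiniteDimensional ℂ E] {M : Type} [TopologicalSpace M]
    [ChartedSpace E M] {j : M → N} (hj : IsHolomorphic E F j)
    (h : IsBallChart W Ψ z r)
    (hf : ∀ (i : Fin c) (y : N) (hy : y ∈ W), eval y hy (f i) = (Ψ y).2 i)
    (hzero : ∀ s, j s ∈ W → (Ψ (j s)).2 = 0) (hrange : ∀ y ∈ W, (Ψ y).2 = 0 → y ∈ Set.range j)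
    (τ : E → M) (hτ : ∀ u, ((u, 0) : E × (Fin c → ℂ)) ∈ Metric.ball z r →
      ContMDiffAt 𝓘(ℂ, E) 𝓘(ℂ, E) ∞ τ u) (hτj : ∀ s, j s ∈ W → τ (Ψ (j s)).1 = s) :
    IsKoszulOn (ComplexManifold.map j hj) W f where
  isWeaklyRegular := h.isWeaklyRegular hf
  comor_eq_zero_iff a := by
    rw [← Set.image_univ, ← Finset.coe_univ, h.mem_span_iff hf]
    refine ⟨fun ha y hy hy0 => ?_, fun ha => fun_ext fun s hs => ?_⟩
    · obtain ⟨s, rfl⟩ := hrange y hy (funext fun i => hy0 i (Finset.mem_univ i))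
      rw [← eval_comor hj W a s hy, ha, map_zero]
    · rw [map_zero, eval_comor hj W a s hs]
      exact ha _ _ fun i _ => congrFun (hzero s hs) i
  surjective a := by
    by_cases hne : ∃ s, j s ∈ W
    swap
    · exact ⟨0, fun_ext fun s hs => (hne ⟨s, hs⟩).elim⟩
    obtain ⟨s₀, hs₀⟩ := hne
    have hz (i : Fin c) : ‖z.2 i‖ < r := by
      have hx := h.mapsTo _ hs₀
      have hr : 0 < r := dist_nonneg.trans_lt hx
      rw [Metric.mem_ball, Prod.dist_eq, max_lt_iff, dist_pi_lt_iff hr] at hx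
      have := hx.2 i
      rwa [congrFun (hzero s₀ hs₀) i, Pi.zero_apply, dist_zero_left] at this
    obtain ⟨g, hg, hga⟩ := exists_contMDiffAt_eval_eq a
    have hball (x : E × (Fin c → ℂ)) (hx : x ∈ Metric.ball z r) :
        ((x.1, 0) : E × (Fin c → ℂ)) ∈ Metric.ball z r := by
      convert! sub_coordProj_mem_ball (s := Finset.univ) (fun i _ => hz i) hx using 1
      refine Prod.ext (by simp [coordProj_fst]) (funext fun i => ?_)
      simp [coordProj_snd]
    -- Extends a function from the submanifold by making it constant in the normal coordinates.
    obtain ⟨b, hb⟩ := h.exists_eval_eq (fun x => g (τ x.1)) (by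
      intro x hx
      refine ContDiffAt.contDiffWithinAt ?_
      have hx' := hball x hx
      obtain ⟨y, hy, hyx⟩ := h.surjOn _ hx'
      obtain ⟨s, rfl⟩ := hrange y hy (by rw [hyx])
      have hs : τ x.1 = s := by
        have := hτj s hy
        rwa [hyx] at this
      have h1 : ContMDiffAt 𝓘(ℂ, E) 𝓘(ℂ) ∞ (g ∘ τ) x.1 :=
        ContMDiffAt.comp x.1 (by rw [hs]; exact hg s hy) (hτ x.1 hx')
      exact (contMDiffAt_iff_contDiffAt.1 h1).comp x contDiffAt_fst)
    refine ⟨b, fun_ext fun s hs => ?_⟩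
    refine (eval_comor hj W b s hs).trans ((hb (j s) hs).trans ?_)
    rw [hga, hτj s hs]

end BallChart

/-- In immersion charts j is the inclusion `u ↦ (u, 0)`. The normal coordinates form the sequence,
and arbitrarily small balls in the chart provide the open sets on which the criterion for
coordinates applies. -/
lemma IsClosedSubmanifold.isLocallyKoszul {E F : Type} [NormedAddCommGroup E] [NormedSpace ℂ E]
    [FiniteDimensional ℂ E]
    [NormedAddCommGroup F] [NormedSpace ℂ F] [FiniteDimensional ℂ F]
    {M N : Type} [TopologicalSpace M] [ChartedSpace E M] [IsManifold 𝓘(ℂ, E) ω M]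
    [TopologicalSpace N] [ChartedSpace F N] [IsManifold 𝓘(ℂ, F) ω N] {j : M → N}
    (hj : IsClosedSubmanifold E F j) :
    IsLocallyKoszul (ComplexManifold.map j hj.isHolomorphic) := by
  intro p
  by_cases hp : p ∈ Set.range j
  swap
  · exact exists_isKoszulNear_of_notMem_range _ hj.isClosed_range hp
  obtain ⟨t, rfl⟩ := hp
  have h := hj.isSmoothEmbedding.isImmersion.isImmersionAt t
  let φ := h.domChart
  let ψ := h.codChart
  have hφ := h.domChart_mem_maximalAtlas
  have hψ := h.codChart_mem_maximalAtlas
  have : FiniteDimensional ℂ h.complement :=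
    Module.Finite.of_surjective
      ((LinearMap.snd ℂ E h.complement) ∘ₗ h.equiv.symm.toLinearEquiv.toLinearMap)
      (Prod.snd_surjective.comp h.equiv.symm.surjective)
  let c := Module.finrank ℂ h.complement
  let e : h.complement ≃L[ℂ] (Fin c → ℂ) := (Module.finBasis ℂ h.complement).equivFunL
  let L : F ≃L[ℂ] E × (Fin c → ℂ) :=
    h.equiv.symm.trans ((ContinuousLinearEquiv.refl ℂ E).prodCongr e)
  let Ψ : N → E × (Fin c → ℂ) := fun y => L (ψ y)
  have hL (u : E) : L (h.equiv (u, 0)) = (u, 0) := by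
    simp [L]
  have hΨ (y : N) (hy : y ∈ ψ.source) : ContMDiffAt 𝓘(ℂ, F) 𝓘(ℂ, E × (Fin c → ℂ)) ∞ Ψ y :=
    L.contDiff.contMDiff.contMDiffAt.comp y
      ((contMDiffAt_of_mem_maximalAtlas hψ hy).of_le le_top)
  have hΨc : ContinuousOn Ψ ψ.source := fun y hy => (hΨ y hy).continuousAt.continuousWithinAt
  -- As j is an embedding, O meets the image of j only in the part covered by φ, so no other sheet
  -- of the submanifold enters the chart.
  obtain ⟨O, hO, hOφ⟩ := hj.isSmoothEmbedding.isEmbedding.isInducing.isOpen_iff.1 φ.open_source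
  have hwr (u : E) (hu : u ∈ φ.target) : ψ (j (φ.symm u)) = h.equiv (u, 0) := by
    have := h.writtenInCharts
      (show u ∈ (h.domChart.extend 𝓘(ℂ, E)).target by simpa using hu)
    simpa using this
  let V : Set N := (ψ.source ∩ O) ∩ Ψ ⁻¹' (Prod.fst ⁻¹' φ.target)
  have hV : IsOpen V := (hΨc.mono Set.inter_subset_left).isOpen_inter_preimage
    (ψ.open_source.inter hO) (φ.open_target.preimage continuous_fst)
  have hΨj (s : M) (hs : s ∈ φ.source) : Ψ (j s) = (φ s, 0) := by
    have := hwr (φ s) (φ.map_source hs)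
    rw [φ.left_inv hs] at this
    change L (ψ (j s)) = _
    rw [this, hL]
  have hVφ (s : M) (hs : j s ∈ V) : s ∈ φ.source := by
    rw [← hOφ]
    exact hs.1.2
  -- The tangential coordinate of a point of V lies in the target of φ, so it has a point of the
  -- submanifold above it; that point has the same image in the chart ψ, which is injective.
  have hVrange (y : N) (hy : y ∈ V) (hy0 : (Ψ y).2 = 0) : y ∈ Set.range j := by
    refine ⟨φ.symm (Ψ y).1, ψ.injOn (h.source_subset_preimage_source (φ.map_target hy.2)) hy.1.1 ?_⟩
    rw [hwr _ hy.2]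
    apply L.injective
    rw [hL]
    exact Prod.ext rfl hy0.symm
  have htV : j t ∈ V := by
    have ht : t ∈ φ.source := h.mem_domChart_source
    refine ⟨⟨h.mem_codChart_source, ?_⟩, ?_⟩
    · change t ∈ j ⁻¹' O
      rw [hOφ]
      exact ht
    · change (Ψ (j t)).1 ∈ φ.target
      rw [hΨj t ht]
      exact φ.map_source ht
  have hcomp (g : E × (Fin c → ℂ) → ℂ) (y : N) (hy : y ∈ ψ.source)
      (hg : ContDiffAt ℂ ∞ g (Ψ y)) : ContMDiffAt 𝓘(ℂ, F) 𝓘(ℂ) ∞ (fun y => g (Ψ y)) y :=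
    ContMDiffAt.comp y hg.contMDiffAt (hΨ y hy)
  have hcoord (k : Fin c) (y : N) (hy : y ∈ ψ.source) :
      ContMDiffAt 𝓘(ℂ, F) 𝓘(ℂ) ∞ (fun y => (Ψ y).2 k) y :=
    hcomp (fun x => x.2 k) y hy ((contDiff_apply ℂ ℂ k).comp contDiff_snd).contDiffAt
  choose f hf using fun k : Fin c => exists_eval_eq (U := (⟨V, hV⟩ : Opens (ringedSpace F N)))
    (fun y => (Ψ y).2 k) fun y hy => hcoord k y hy.1.1
  refine ⟨⟨V, hV⟩, c, f, htV, fun W hW p hp => ?_⟩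
  let Ws : Set N := W.carrier
  have hWs : IsOpen Ws := W.isOpen
  have hWV : ∀ y ∈ Ws, y ∈ V := fun y hy => hW hy
  -- The coordinate image of W, in which a ball around the image of p is taken.
  have hopen : IsOpen {x | L.symm x ∈ ψ.target ∩ ψ.symm ⁻¹' Ws} :=
    (ψ.isOpen_inter_preimage_symm hWs).preimage L.symm.continuous
  have hpΨ : Ψ p ∈ {x | L.symm x ∈ ψ.target ∩ ψ.symm ⁻¹' Ws} := by
    change L.symm (L (ψ p)) ∈ ψ.target ∩ ψ.symm ⁻¹' Ws
    rw [L.symm_apply_apply]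
    refine ⟨ψ.map_source (hWV p hp).1.1, ?_⟩
    change ψ.symm (ψ p) ∈ Ws
    rw [ψ.left_inv (hWV p hp).1.1]
    exact hp
  obtain ⟨r, hr, hrW⟩ := Metric.isOpen_iff.1 hopen _ hpΨ
  have hW'o : IsOpen (Ws ∩ Ψ ⁻¹' Metric.ball (Ψ p) r) :=
    (hΨc.mono fun y hy => (hWV y hy).1.1).isOpen_inter_preimage hWs Metric.isOpen_ball
  let W' : Opens (ringedSpace F N) := ⟨_, hW'o⟩
  have hW'W : W' ≤ W := fun y hy => hy.1
  have hinv (x) (hx : x ∈ Metric.ball (Ψ p) r) : Ψ (ψ.symm (L.symm x)) = x := by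
    change L (ψ (ψ.symm (L.symm x))) = x
    rw [ψ.right_inv (hrW hx).1, L.apply_symm_apply]
  have hinvW (x) (hx : x ∈ Metric.ball (Ψ p) r) : ψ.symm (L.symm x) ∈ W' :=
    ⟨(hrW hx).2, by rwa [Set.mem_preimage, hinv x hx]⟩
  have hchart : IsBallChart W' Ψ (Ψ p) r := by
    refine ⟨fun g hg => ?_, fun a => ?_, fun y hy => hy.2, fun x hx => ⟨_, hinvW x hx, hinv x hx⟩⟩
    · refine exists_eval_eq (fun y => g (Ψ y)) fun y hy => ?_
      exact hcomp g y (hWV y hy.1).1.1 (hg.contDiffAt (Metric.isOpen_ball.mem_nhds hy.2))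
    · obtain ⟨g, hg, hga⟩ := exists_contMDiffAt_eval_eq a
      refine ⟨fun x => g (ψ.symm (L.symm x)), fun x hx => ?_, fun y hy => ?_⟩
      · refine (contMDiffAt_iff_contDiffAt.1 ?_).contDiffWithinAt
        have h1 : ContMDiffAt 𝓘(ℂ, F) 𝓘(ℂ, F) ∞ ψ.symm (L.symm x) :=
          (contMDiffAt_symm_of_mem_maximalAtlas hψ (hrW hx).1).of_le le_top
        have h2 : ContMDiffAt 𝓘(ℂ, E × (Fin c → ℂ)) 𝓘(ℂ, F) ∞ L.symm x :=
          L.symm.contDiff.contMDiff.contMDiffAt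
        exact (hg _ (hinvW x hx)).comp x (h1.comp x h2)
      · rw [hga]
        change g y = g (ψ.symm (L.symm (L (ψ y))))
        rw [L.symm_apply_apply, ψ.left_inv (hWV y hy.1).1.1]
  refine ⟨W', hW'W.trans hW, hW'W, ⟨hp, Metric.mem_ball_self hr⟩,
    hchart.isKoszulOn hj.isHolomorphic (fun i y hy => ?_) (fun s hs => ?_)
      (fun y hy => hVrange y (hWV y hy.1)) φ.symm (fun u hu => ?_) fun s hs => ?_⟩
  · rw [eval_resFun]
    exact hf i y _
  · rw [hΨj s (hVφ s (hWV _ hs.1))]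
  · have hu' : u ∈ φ.target := by
      have := (hWV _ (hinvW _ hu).1).2
      change (Ψ _).1 ∈ φ.target at this
      rwa [hinv _ hu] at this
    exact (contMDiffAt_symm_of_mem_maximalAtlas hφ hu').of_le le_top
  · have hs' := hVφ s (hWV _ hs.1)
    rw [hΨj s hs', φ.left_inv hs']

end ComplexManifold

end

theorem mainTheorem4 :
    -- smooth subvarieties `S ⊆ T` of a smooth variety `X` over a field
    (∀ (k : Type u) [Field k] (X S T : Scheme.{u}) (p : X ⟶ Spec (CommRingCat.of k))
        (i : S ⟶ X) (j : T ⟶ X) (h : S ⟶ T)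
        [Smooth p] [IsClosedImmersion i] [Smooth (i ≫ p)] [IsClosedImmersion j] [Smooth (j ≫ p)],
      h ≫ j = i → ∀ q : ℕ, Nonempty
        (LocallyRingedSpace.tor q
            ((LocallyRingedSpace.modulePushforward i.toLRSHom).obj
              (LocallyRingedSpace.structureModule S.toLocallyRingedSpace))
            ((LocallyRingedSpace.modulePushforward j.toLRSHom).obj
              (LocallyRingedSpace.structureModule T.toLocallyRingedSpace)) ≅
          (LocallyRingedSpace.modulePushforward i.toLRSHom).obj
            ((LocallyRingedSpace.modulePullback h.toLRSHom).obj
              (LocallyRingedSpace.moduleExteriorPower q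
                (LocallyRingedSpace.moduleDual (LocallyRingedSpace.normalSheaf j.toLRSHom)))))) ∧
    -- closed complex submanifolds `S ⊆ T` of a complex manifold `X`
    (∀ (EX ES ET : Type) [NormedAddCommGroup EX] [NormedSpace ℂ EX] [FiniteDimensional ℂ EX]
        [NormedAddCommGroup ES] [NormedSpace ℂ ES] [FiniteDimensional ℂ ES]
        [NormedAddCommGroup ET] [NormedSpace ℂ ET] [FiniteDimensional ℂ ET]
        (X S T : Type) [TopologicalSpace X] [ChartedSpace EX X] [IsManifold 𝓘(ℂ, EX) ω X]
        [TopologicalSpace S] [ChartedSpace ES S] [IsManifold 𝓘(ℂ, ES) ω S]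
        [TopologicalSpace T] [ChartedSpace ET T] [IsManifold 𝓘(ℂ, ET) ω T]
        (i : S → X) (j : T → X) (h : S → T)
        (hi : ComplexManifold.IsClosedSubmanifold ES EX i)
        (hj : ComplexManifold.IsClosedSubmanifold ET EX j)
        (hh : ComplexManifold.IsHolomorphic ES ET h),
      j ∘ h = i → ∀ q : ℕ, Nonempty
        (LocallyRingedSpace.tor q
            ((LocallyRingedSpace.modulePushforward (ComplexManifold.map i hi.isHolomorphic)).obj
              (LocallyRingedSpace.structureModule (ComplexManifold.ringedSpace ES S)))
            ((LocallyRingedSpace.modulePushforward (ComplexManifold.map j hj.isHolomorphic)).obj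
              (LocallyRingedSpace.structureModule (ComplexManifold.ringedSpace ET T))) ≅
          (LocallyRingedSpace.modulePushforward (ComplexManifold.map i hi.isHolomorphic)).obj
            ((LocallyRingedSpace.modulePullback (ComplexManifold.map h hh)).obj
              (LocallyRingedSpace.moduleExteriorPower q
                (LocallyRingedSpace.moduleDual (LocallyRingedSpace.normalSheaf
                  (ComplexManifold.map j hj.isHolomorphic))))))) := by
  refine ⟨?_, ?_⟩
  · intro k _ X S T p i j h _ _ _ _ _ hij q
    subst hij
    exact LocallyRingedSpace.nonempty_tor_iso h.toLRSHom j.toLRSHom q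
      (AlgebraicGeometry.isLocallyKoszul_of_smooth p j)
  · intro EX ES ET _ _ _ _ _ _ _ _ _ X S T _ _ _ _ _ _ _ _ _ i j h hi hj hh hij q
    -- With i replaced by `j ∘ h`, its morphism of ringed spaces is by definition the composite of
    -- those of h and j.
    subst hij
    exact LocallyRingedSpace.nonempty_tor_iso (ComplexManifold.map h hh)
      (ComplexManifold.map j hj.isHolomorphic) q hj.isLocallyKoszul
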